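/- All graphs are finite. A multigraph may have parallel edges and loops, and $\Vert H\Vert=|E(H)|$ counts edges with multiplicity. A set of vertices of a (multi)graph is connected if it induces a connected subgraph; the empty set counts as connected. For a multigraph $H$, a non-crossing $H$-representation of a simple graph $G$ consists of a subdivision $H'$ of $H$ and a family $(X_v)_{v\in V(G)}$ of connected vertex subsets of $H'$ such that distinct vertices $u,v$ of $G$ are adjacent if and only if $X_u\cap X_v\neq\varnothing$, and such that $X_u\setminus X_v$ is connected for all $u,v\in V(G)$. If $G$ has such a representation, it is called a non-crossing $H$-graph. For an integer $k>0$, a proper $k$-mixed-thin representation of $G$ consists of a partition $(V^1,\dots,V^k)$ of $V(G)$ (classes may be empty) and, for all $1\le i\le j\le k$, a linear order $<_{ij}$ on $V^i\cup V^j$ and a set $E_{i,j}\in\{E(G[V^i,V^j]),E(\overline{G}[V^i,V^j])\}$ (the edges, respectively non-edges, of $G$ between $V^i$ and $V^j$) such that for all $i\le j$: - the restriction of $<_{ij}$ to $V^i$ (to $V^j$) equals $<_{ii}$ (equals $<_{jj}$) or its inverse; - if $u<_{ij}v<_{ij}w$, where $u,v$ lie in one of $V^i,V^j$ and $w$ lies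 in the other (in the same class if $i=j$), and $uw\in E_{i,j}$, then $vw\in E_{i,j}$; - if $u<_{ij}v<_{ij}w$, where $v,w$ lie in one of $V^i,V^j$ and $u$ lies in the other (in the same class if $i=j$), and $uw\in E_{i,j}$, then $uv\in E_{i,j}$. The proper mixed-thinness of $G$ is the least $k>0$ for which such a representation exists. **Theorem.** For every multigraph $H$ with at least one edge, every non-crossing $H$-graph $G$ has proper mixed-thinness at most $$t=2^{\Vert H\Vert}\,(4^{\Vert H\Vert}-1)\,(\Vert H\Vert^2+1)+\Vert H\Vert .$$ Moreover, there is an algorithm that, given a multigraph $H$ with at least one edge and a non-crossing $H$-representation of a graph $G$ (with its framework $H'$), computes a proper $t$-mixed-thin representation of $G$ in time polynomial in the size of the input; here orders and edge choices are written out only for pairs of non-empty classes. -/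

import Mathlib

/-! ### Subdivisions of multigraphs

Multigraphs (parallel edges and loops allowed) are Mathlib's `Graph α β`, with vertex set
`H.vertexSet : Set α` and edge set `H.edgeSet : Set β`. -/

/-- The size `‖H‖ = |E(H)|` of a multigraph, counted with multiplicities. -/
noncomputable def Graph.size {α β : Type*} (H : Graph α β) : ℕ := H.edgeSet.ncard

/-- A set `X` of vertices of a multigraph is connected if any two of its elements are joined by a
walk inside `X`. The empty set is connected. -/
def Graph.IsConnectedSet {α β : Type*} (H : Graph α β) (X : Set α) : Prop :=
  X ⊆ H.vertexSet ∧
    ∀ x ∈ X, ∀ y ∈ X, Relation.ReflTransGen (fun a b => a ∈ X ∧ b ∈ X ∧ H.Adj a b) x y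

/-- The data of a subdivision of `H`: the number `len e` of internal vertices on each edge `e`, and a
reference direction of each edge, from `src e` to `tgt e`, which is only used to number the internal
vertices. Values at elements of `β` that are not edges of `H` play no role. -/
structure Graph.Subdivision {α β : Type*} (H : Graph α β) where
  src : β → α
  tgt : β → α
  isLink : ∀ e ∈ H.edgeSet, H.IsLink e (src e) (tgt e)
  len : β → ℕ

namespace Graph.Subdivision

variable {α β : Type*} {H : Graph α β}

/-- The path `x, z₁, …, z_r, y` (`r = len e`) that replaces the edge `e = xy`: its `0`-th vertex is
`x`, its `i`-th vertex for `1 ≤ i ≤ r` is the internal vertex `(e, i)`, its last vertex is `y`. -/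
def pathVertex (S : H.Subdivision) (e : β) (i : ℕ) : α ⊕ β × ℕ :=
  if i = 0 then Sum.inl (S.src e)
  else if i ≤ S.len e then Sum.inr (e, i)
  else Sum.inl (S.tgt e)

/-- The subdivided multigraph `H'`. The edge `(e, i)`, for `0 ≤ i ≤ len e`, joins the `i`-th and the
`(i + 1)`-st vertex of the path that replaces `e`. -/
def graph (S : H.Subdivision) : Graph (α ⊕ β × ℕ) (β × ℕ) where
  vertexSet := {x | (∃ v ∈ H.vertexSet, x = Sum.inl v) ∨
    ∃ e ∈ H.edgeSet, ∃ i, 1 ≤ i ∧ i ≤ S.len e ∧ x = Sum.inr (e, i)}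
  IsLink f x y := f.1 ∈ H.edgeSet ∧ f.2 ≤ S.len f.1 ∧
    ((x = S.pathVertex f.1 f.2 ∧ y = S.pathVertex f.1 (f.2 + 1)) ∨
      (y = S.pathVertex f.1 f.2 ∧ x = S.pathVertex f.1 (f.2 + 1)))
  isLink_symm := fun _ _ => ⟨fun _ _ h => ⟨h.1, h.2.1, h.2.2.symm⟩⟩
  eq_or_eq_of_isLink_of_isLink := by
    rintro f x y v w ⟨-, -, h⟩ ⟨-, -, h'⟩
    rcases h with ⟨rfl, rfl⟩ | ⟨rfl, rfl⟩ <;> rcases h' with ⟨rfl, rfl⟩ | ⟨rfl, rfl⟩ <;> simp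
  left_mem_of_isLink := by
    have key : ∀ e ∈ H.edgeSet, ∀ i, (∃ v ∈ H.vertexSet, S.pathVertex e i = Sum.inl v) ∨
        ∃ e' ∈ H.edgeSet, ∃ j, 1 ≤ j ∧ j ≤ S.len e' ∧ S.pathVertex e i = Sum.inr (e', j) := by
      intro e he i
      unfold pathVertex
      split_ifs with h0 h1
      · exact Or.inl ⟨_, (S.isLink e he).left_mem, rfl⟩
      · exact Or.inr ⟨e, he, i, Nat.one_le_iff_ne_zero.2 h0, h1, rfl⟩
      · exact Or.inl ⟨_, (S.isLink e he).right_mem, rfl⟩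
    rintro f x y ⟨he, -, ⟨rfl, -⟩ | ⟨-, rfl⟩⟩
    · exact key _ he _
    · exact key _ he _

end Graph.Subdivision

/-! ### Non-crossing `H`-graphs -/

/-- An `H`-representation of a simple graph `G`: a subdivision of `H` (the framework) and a family of
connected vertex subsets of it, indexed by the vertices of `G`, of which `G` is the intersection
graph. -/
structure HRepresentation {α β V : Type*} (H : Graph α β) (G : SimpleGraph V) where
  framework : H.Subdivision
  rep : V → Set (α ⊕ β × ℕ)
  connected : ∀ v, framework.graph.IsConnectedSet (rep v)
  adj_iff : ∀ u v, u ≠ v → (G.Adj u v ↔ (rep u ∩ rep v).Nonempty)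

/-- The family is non-crossing: for any two members `A`, `B`, both `A \ B` and `B \ A` are
connected. -/
def HRepresentation.IsNonCrossing {α β V : Type*} {H : Graph α β} {G : SimpleGraph V}
    (S : HRepresentation H G) : Prop :=
  ∀ u v, S.framework.graph.IsConnectedSet (S.rep u \ S.rep v)

/-- `G` is a non-crossing `H`-graph. -/
def IsNonCrossingHGraph {α β V : Type*} (H : Graph α β) (G : SimpleGraph V) : Prop :=
  ∃ S : HRepresentation H G, S.IsNonCrossing

/-! ### Proper mixed-thinness -/

/-- `r` is a strict linear order on the set `s` (its values outside `s` play no role). -/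
def IsStrictLinearOrderOn {V : Type*} (s : Set V) (r : V → V → Prop) : Prop :=
  (∀ u ∈ s, ¬ r u u) ∧
  (∀ u ∈ s, ∀ v ∈ s, ∀ w ∈ s, r u v → r v w → r u w) ∧
  (∀ u ∈ s, ∀ v ∈ s, u ≠ v → r u v ∨ r v u)

/-- On the set `s`, the relations `r` and `r'` agree or are inverse to each other. -/
def AlignedOn {V : Type*} (s : Set V) (r r' : V → V → Prop) : Prop :=
  (∀ u ∈ s, ∀ v ∈ s, (r u v ↔ r' u v)) ∨ (∀ u ∈ s, ∀ v ∈ s, (r u v ↔ r' v u))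

/-- Adjacency in `G` (sign `true`, matrix entry `1`) or in the complement of `G` (sign `false`,
matrix entry `-1`). -/
def SignedAdj {V : Type*} (G : SimpleGraph V) (sign : Bool) (u v : V) : Prop :=
  if sign then G.Adj u v else Gᶜ.Adj u v

/-- A proper `k`-mixed-thin representation of `G`. The class `V^i` is `{v | cls v = i}` (classes may
be empty); `lt i j` and `sign i j` are only relevant for `i ≤ j`. -/
structure ProperMixedThinRep {V : Type*} (G : SimpleGraph V) (k : ℕ) where
  cls : V → Fin k
  lt : Fin k → Fin k → V → V → Prop
  sign : Fin k → Fin k → Bool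
  linear : ∀ i j, i ≤ j → IsStrictLinearOrderOn {v | cls v = i ∨ cls v = j} (lt i j)
  al_left : ∀ i j, i ≤ j → AlignedOn {v | cls v = i} (lt i j) (lt i i)
  al_right : ∀ i j, i ≤ j → AlignedOn {v | cls v = j} (lt i j) (lt j j)
  co : ∀ i j, i ≤ j → ∀ u v w,
    (cls u = i ∧ cls v = i ∧ cls w = j) ∨ (cls u = j ∧ cls v = j ∧ cls w = i) →
    lt i j u v → lt i j v w → SignedAdj G (sign i j) u w → SignedAdj G (sign i j) v w
  sc : ∀ i j, i ≤ j → ∀ u v w,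
    (cls v = i ∧ cls w = i ∧ cls u = j) ∨ (cls v = j ∧ cls w = j ∧ cls u = i) →
    lt i j u v → lt i j v w → SignedAdj G (sign i j) u w → SignedAdj G (sign i j) u v

/-- The proper mixed-thinness of `G`: the least `k > 0` such that `G` has a proper `k`-mixed-thin
representation (`⊤` if there is none, which does not happen for finite graphs). -/
noncomputable def properMixedThinness {V : Type*} (G : SimpleGraph V) : ℕ∞ :=
  ⨅ k ∈ {k : ℕ | 0 < k ∧ Nonempty (ProperMixedThinRep G k)}, (k : ℕ∞)

/-- The number `2^m (4^m - 1) (m^2 + 1) + m`. -/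
def thinnessBound (m : ℕ) : ℕ := 2 ^ m * (4 ^ m - 1) * (m ^ 2 + 1) + m

/-! ### A random access machine with a step count

Programs are structured programs over registers and finitely many random access arrays of natural
numbers, with random access to a read-only input list and with an append-only output list. The
arithmetic operations are addition and truncated subtraction, so that the unit cost measure is
polynomially related to the running time of Turing machines. -/

namespace RAM

/-- Expressions: numerals, registers, the number of input words, the input word with a computed
index, the entry with a computed index of a fixed array, sum, truncated difference. -/
inductive Expr where
  | const (c : ℕ)
  | reg (x : ℕ)
  | inputLength
  | input (i : Expr)
  | get (a : ℕ) (i : Expr)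
  | add (e₁ e₂ : Expr)
  | sub (e₁ e₂ : Expr)

/-- Programs. A condition holds when its value is nonzero; `loop e p` is the loop `while e do p`. -/
inductive Prog where
  | skip
  | assign (x : ℕ) (e : Expr)
  | store (a : ℕ) (i e : Expr)
  | emit (e : Expr)
  | seq (p q : Prog)
  | ite (e : Expr) (p q : Prog)
  | loop (e : Expr) (p : Prog)

/-- A state: the contents of registers and arrays, and the output written so far. -/
structure State where
  reg : ℕ → ℕ
  arr : ℕ → ℕ → ℕ
  out : List ℕ

/-- At the start, all registers and arrays hold `0` and the output is empty. -/
def State.init : State := ⟨fun _ => 0, fun _ _ => 0, []⟩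

/-- The value of an expression; input words beyond the end of the input are `0`. -/
def Expr.eval (inp : List ℕ) (s : State) : Expr → ℕ
  | const c => c
  | reg x => s.reg x
  | inputLength => inp.length
  | input i => inp.getD (i.eval inp s) 0
  | get a i => s.arr a (i.eval inp s)
  | add e₁ e₂ => e₁.eval inp s + e₂.eval inp s
  | sub e₁ e₂ => e₁.eval inp s - e₂.eval inp s

/-- Evaluating an expression costs one step for each of its nodes. -/
def Expr.cost : Expr → ℕ
  | const _ => 1
  | reg _ => 1
  | inputLength => 1
  | input i => i.cost + 1
  | get _ i => i.cost + 1
  | add e₁ e₂ => e₁.cost + e₂.cost + 1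
  | sub e₁ e₂ => e₁.cost + e₂.cost + 1

/-- `Exec inp p s s' T`: on the input `inp`, the program `p` started in the state `s` halts in the
state `s'` after exactly `T` steps. -/
inductive Exec (inp : List ℕ) : Prog → State → State → ℕ → Prop where
  | skip (s : State) : Exec inp .skip s s 1
  | assign (x : ℕ) (e : Expr) (s : State) :
      Exec inp (.assign x e) s
        ⟨Function.update s.reg x (e.eval inp s), s.arr, s.out⟩ (e.cost + 1)
  | store (a : ℕ) (i e : Expr) (s : State) :
      Exec inp (.store a i e) s
        ⟨s.reg, Function.update s.arr a
          (Function.update (s.arr a) (i.eval inp s) (e.eval inp s)), s.out⟩ (i.cost + e.cost + 1)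
  | emit (e : Expr) (s : State) :
      Exec inp (.emit e) s ⟨s.reg, s.arr, s.out ++ [e.eval inp s]⟩ (e.cost + 1)
  | seq {p q : Prog} {s s' s'' : State} {T T' : ℕ} (hp : Exec inp p s s' T)
      (hq : Exec inp q s' s'' T') : Exec inp (.seq p q) s s'' (T + T')
  | ite_true {e : Expr} {p q : Prog} {s s' : State} {T : ℕ} (he : e.eval inp s ≠ 0)
      (hp : Exec inp p s s' T) : Exec inp (.ite e p q) s s' (T + e.cost + 1)
  | ite_false {e : Expr} {p q : Prog} {s s' : State} {T : ℕ} (he : e.eval inp s = 0)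
      (hq : Exec inp q s s' T) : Exec inp (.ite e p q) s s' (T + e.cost + 1)
  | loop_true {e : Expr} {p : Prog} {s s' s'' : State} {T T' : ℕ} (he : e.eval inp s ≠ 0)
      (hp : Exec inp p s s' T) (hw : Exec inp (.loop e p) s' s'' T') :
      Exec inp (.loop e p) s s'' (T + T' + e.cost + 1)
  | loop_false {e : Expr} {p : Prog} {s : State} (he : e.eval inp s = 0) :
      Exec inp (.loop e p) s s (e.cost + 1)

/-- The size of a list of natural numbers: the total length of the binary expansions, with one
separator for each number. -/
def bitSize (l : List ℕ) : ℕ := (l.map fun a => a.size + 1).sum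

end RAM

/-! ### Encodings of inputs and outputs

Here the vertices and edges of `H` and the vertices of `G` are numbered. -/

open Classical in
/-- The input word list of an `H`-representation of `G`: the numbers of vertices of `G`, of vertices
of `H` and of edges of `H`; for each edge of `H` its two ends and its number of internal vertices in
the framework; and for each vertex of `G` the characteristic vector of its representative, over the
vertices of `H` first and then over the internal vertices of the edges, in order. -/
noncomputable def HRepresentation.encode {n p m : ℕ} {H : Graph (Fin p) (Fin m)}
    {G : SimpleGraph (Fin n)} (S : HRepresentation H G) : List ℕ :=
  [n, p, m] ++
  (List.finRange m).flatMap (fun e =>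
    [(S.framework.src e : ℕ), (S.framework.tgt e : ℕ), S.framework.len e]) ++
  (List.finRange n).flatMap (fun v =>
    (List.finRange p).map (fun x => if Sum.inl x ∈ S.rep v then 1 else 0) ++
    (List.finRange m).flatMap (fun e =>
      (List.range (S.framework.len e)).map
        (fun i => if Sum.inr (e, i + 1) ∈ S.rep v then 1 else 0)))

/-- The word list `out` describes the representation `R`: it lists the class of each vertex, followed,
for each pair `i ≤ j` of indices of nonempty classes, by a record that consists of `i`, `j`, the sign
(`1` for edges, `0` for non-edges) and the vertices of `V^i ∪ V^j` in increasing order with respect to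
`lt i j`. Nothing is written for empty classes: if one of `V^i`, `V^j` is empty, the order on
`V^i ∪ V^j` can be taken to be that of the other class and the sign does not matter. -/
def ProperMixedThinRep.IsEncodedBy {n k : ℕ} {G : SimpleGraph (Fin n)}
    (R : ProperMixedThinRep G k) (out : List ℕ) : Prop :=
  ∃ (pairs : List (Fin k × Fin k)) (ordered : Fin k × Fin k → List (Fin n)),
    pairs.Nodup ∧
    (∀ i j, (i, j) ∈ pairs ↔ i ≤ j ∧ (∃ v, R.cls v = i) ∧ (∃ v, R.cls v = j)) ∧
    (∀ i j, (i, j) ∈ pairs →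
      (∀ v, v ∈ ordered (i, j) ↔ R.cls v = i ∨ R.cls v = j) ∧
      (ordered (i, j)).Pairwise (R.lt i j)) ∧
    out = (List.finRange n).map (fun v => (R.cls v : ℕ)) ++
      pairs.flatMap (fun q =>
        [(q.1 : ℕ), (q.2 : ℕ), if R.sign q.1 q.2 then 1 else 0] ++
          (ordered q).map (fun v => (v : ℕ)))

/-!
Cut the framework into the paths of the edges of `H`, and sort the sets into classes by their type,
which consists of the edge ends that they contain and the edges on which they are full, and by the
edges on which they differ from the first set of their type. Within a type, a set is determined by
its runs, the lengths to which it follows each edge from either end, or avoids it if it contains no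
vertex of `H`. No run can vary in the same direction as another one between two sets of the same
type, since one of their differences would be disconnected. Hence at most two runs vary within a
class, in opposite directions, and one can sort the class by them. Between two classes,
non-adjacency is a system of upper bounds on sums of two runs, so that, after reversing one of the
two orders if necessary, a pair that lies between two non-adjacent pairs is non-adjacent. This is
what makes it possible to merge the orders.

All of these notions are defined by bounded quantifiers and sums over the input, and a calculus of
polynomial time computations that is closed under these evaluates the resulting representation.
-/

/-! ### Merging sorted classes -/

/-- The order of `L`, reversed if `rev` holds. -/
def OrientedLE {L : Type*} [LinearOrder L] (rev : Prop) (x y : L) : Prop :=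
  (rev → y ≤ x) ∧ (¬ rev → x ≤ y)

namespace OrientedLE

variable {L : Type*} [LinearOrder L] {rev : Prop} {x y z : L}

theorem refl (rev : Prop) (x : L) : OrientedLE rev x x :=
  ⟨fun _ => le_rfl, fun _ => le_rfl⟩

theorem trans (h : OrientedLE rev x y) (h' : OrientedLE rev y z) : OrientedLE rev x z :=
  ⟨fun hr => (h'.1 hr).trans (h.1 hr), fun hr => (h.2 hr).trans (h'.2 hr)⟩

theorem total (rev : Prop) (x y : L) : OrientedLE rev x y ∨ OrientedLE rev y x := by
  by_cases hr : rev <;> simp [OrientedLE, hr, le_total]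

theorem antisymm (h : OrientedLE rev x y) (h' : OrientedLE rev y x) : x = y := by
  by_cases hr : rev
  · exact le_antisymm (h'.1 hr) (h.1 hr)
  · exact le_antisymm (h.2 hr) (h'.2 hr)

end OrientedLE

/-- A partition of `V` into classes indexed by `ι`, together with an order on `V` in which each
class is to be arranged, given by an embedding into a linear order `L`. -/
structure Arrangement (V ι L : Type*) where
  cls : V → ι
  pos : V → L
  pos_injective : Function.Injective pos

namespace Arrangement

variable {V ι L : Type*} [LinearOrder L] (A : Arrangement V ι L) (G : SimpleGraph V)

/-- Each class is a proper interval graph, in the given order. -/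
def IsProper : Prop :=
  ∀ u v w, A.cls u = A.cls v → A.cls v = A.cls w → A.pos u < A.pos v → A.pos v < A.pos w →
    G.Adj u w → G.Adj u v ∧ G.Adj v w

/-- `u'` lies in the class of `u` and above `u`, and `v'` lies in the class of `v` and below `v`,
where the order of the latter class is reversed if `rev` holds: whenever `u'` precedes `v'` in a
merged order of the two classes, so does `u` precede `v`. -/
def Inside (rev : Prop) (u v u' v' : V) : Prop :=
  (A.cls u' = A.cls u ∧ A.pos u ≤ A.pos u') ∧
    A.cls v' = A.cls v ∧ OrientedLE rev (A.pos v') (A.pos v)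

/-- Some nonadjacent pair forces `u` to precede `v` in the merged order of their classes. -/
def Cut (rev : Prop) (u v : V) : Prop :=
  ∃ u' v', A.Inside rev u v u' v' ∧ ¬ G.Adj u' v'

/-- Between the classes `i` and `j`, nonadjacency is convex with respect to `Inside`. -/
def Compatible (rev : Prop) (i j : ι) : Prop :=
  ∀ u v, A.cls u = i → A.cls v = j → A.Cut G rev u v →
    (∃ u' v', A.Inside rev u' v' u v ∧ ¬ G.Adj u' v') → ¬ G.Adj u v

/-- The class `j` has to be reversed before it is merged with the class `i`. -/
def Reversed (i j : ι) : Prop :=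
  ¬ A.Compatible G False i j

variable {A G}

theorem Inside.refl (rev : Prop) (u v : V) : A.Inside rev u v u v :=
  ⟨⟨rfl, le_rfl⟩, rfl, .refl rev _⟩

theorem Inside.trans {rev : Prop} {u v u' v' u'' v'' : V} (h : A.Inside rev u v u' v')
    (h' : A.Inside rev u' v' u'' v'') : A.Inside rev u v u'' v'' :=
  ⟨⟨h'.1.1.trans h.1.1, h.1.2.trans h'.1.2⟩, h'.2.1.trans h.2.1, h'.2.2.trans h.2.2⟩

theorem Cut.of_inside {rev : Prop} {u v u' v' : V} (h : A.Cut G rev u' v')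
    (hin : A.Inside rev u v u' v') : A.Cut G rev u v :=
  let ⟨x, y, hxy, hn⟩ := h
  ⟨x, y, hin.trans hxy, hn⟩

theorem cut_of_not_adj {rev : Prop} {u v : V} (h : ¬ G.Adj u v) : A.Cut G rev u v :=
  ⟨u, v, .refl rev u v, h⟩

theorem compatible_reversed {i j : ι} (h : A.Compatible G False i j ∨ A.Compatible G True i j) :
    A.Compatible G (A.Reversed G i j) i j := by
  by_cases hf : A.Compatible G False i j
  · rwa [Reversed, eq_true hf, not_true]
  · rw [Reversed, eq_false hf, not_false_eq_true]
    exact h.resolve_left hf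

variable [Fintype V]

open Classical in
variable (A G) in
/-- The position of `x` in the merged order of the classes `i` and `j`, in which a member `u` of
the class `i` precedes a member `v` of the class `j` if and only if they are cut. For `i = j` this
is the position of `x` in the class `i`. -/
noncomputable def position (i j : ι) (x : V) : ℕ :=
  if A.cls x = i then
    Finset.card {u | A.cls u = i ∧ A.pos u < A.pos x} +
      Finset.card {v | A.cls v = j ∧ i ≠ j ∧ ¬ A.Cut G (A.Reversed G i j) x v}
  else
    Finset.card {u | A.cls u = i ∧ A.Cut G (A.Reversed G i j) u x} +
      Finset.card {v | A.cls v = j ∧ v ≠ x ∧ OrientedLE (A.Reversed G i j) (A.pos v) (A.pos x)}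

section

variable {i j : ι} {u v x y : V}

theorem position_lt_of_pos_lt (hx : A.cls x = i) (hy : A.cls y = i) (h : A.pos x < A.pos y) :
    A.position G i j x < A.position G i j y := by
  classical
  rw [position, position, if_pos hx, if_pos hy]
  refine add_lt_add_of_lt_of_le (Finset.card_lt_card ⟨fun u hu => ?_, fun hs => ?_⟩)
    (Finset.card_le_card fun v hv => ?_)
  · simp only [Finset.mem_filter, Finset.mem_univ, true_and] at hu ⊢
    exact ⟨hu.1, hu.2.trans h⟩
  · have := hs (Finset.mem_filter.2 ⟨Finset.mem_univ x, hx, h⟩)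
    simp only [Finset.mem_filter, lt_self_iff_false, and_false] at this
  · simp only [Finset.mem_filter, Finset.mem_univ, true_and] at hv ⊢
    exact ⟨hv.1, hv.2.1, fun hc =>
      hv.2.2 (hc.of_inside ⟨⟨hy.trans hx.symm, h.le⟩, rfl, .refl _ _⟩)⟩

theorem position_lt_of_orientedLE (hij : i ≠ j) (hx : A.cls x = j) (hy : A.cls y = j) (hne : x ≠ y)
    (h : OrientedLE (A.Reversed G i j) (A.pos x) (A.pos y)) :
    A.position G i j x < A.position G i j y := by
  classical
  rw [position, position, if_neg (hx ▸ hij.symm), if_neg (hy ▸ hij.symm)]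
  refine add_lt_add_of_le_of_lt (Finset.card_le_card fun u hu => ?_)
    (Finset.card_lt_card ⟨fun v hv => ?_, fun hs => ?_⟩)
  · simp only [Finset.mem_filter, Finset.mem_univ, true_and] at hu ⊢
    exact ⟨hu.1, hu.2.of_inside ⟨⟨rfl, le_rfl⟩, hx.trans hy.symm, h⟩⟩
  · simp only [Finset.mem_filter, Finset.mem_univ, true_and] at hv ⊢
    refine ⟨hv.1, fun hvy => hne (A.pos_injective ?_), hv.2.2.trans h⟩
    exact h.antisymm (hvy ▸ hv.2.2)
  · have := hs (Finset.mem_filter.2 ⟨Finset.mem_univ x, hx, hne, h⟩)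
    simp only [Finset.mem_filter, ne_eq, not_true_eq_false, false_and, and_false] at this

theorem position_lt_of_cut (hij : i ≠ j) (hu : A.cls u = i) (hv : A.cls v = j)
    (h : A.Cut G (A.Reversed G i j) u v) : A.position G i j u < A.position G i j v := by
  classical
  rw [position, position, if_pos hu, if_neg (hv ▸ hij.symm)]
  refine add_lt_add_of_lt_of_le (Finset.card_lt_card ⟨fun x hx => ?_, fun hs => ?_⟩)
    (Finset.card_le_card fun y hy => ?_)
  · simp only [Finset.mem_filter, Finset.mem_univ, true_and] at hx ⊢
    exact ⟨hx.1, h.of_inside ⟨⟨hu.trans hx.1.symm, hx.2.le⟩, rfl, .refl _ _⟩⟩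
  · have := hs (Finset.mem_filter.2 ⟨Finset.mem_univ u, hu, h⟩)
    simp only [Finset.mem_filter, lt_self_iff_false, and_false] at this
  · simp only [Finset.mem_filter, Finset.mem_univ, true_and] at hy ⊢
    refine ⟨hy.1, fun hyv => hy.2.2 (hyv ▸ h), ?_⟩
    refine (OrientedLE.total _ _ _).resolve_right fun hvy => hy.2.2 (h.of_inside ?_)
    exact ⟨⟨rfl, le_rfl⟩, hv.trans hy.1.symm, hvy⟩

theorem position_lt_of_not_cut (hij : i ≠ j) (hu : A.cls u = i) (hv : A.cls v = j)
    (h : ¬ A.Cut G (A.Reversed G i j) u v) : A.position G i j v < A.position G i j u := by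
  classical
  rw [position, position, if_pos hu, if_neg (hv ▸ hij.symm)]
  refine add_lt_add_of_le_of_lt (Finset.card_le_card fun x hx => ?_)
    (Finset.card_lt_card ⟨fun y hy => ?_, fun hs => ?_⟩)
  · simp only [Finset.mem_filter, Finset.mem_univ, true_and] at hx ⊢
    refine ⟨hx.1, lt_of_not_ge fun hux => h (hx.2.of_inside ?_)⟩
    exact ⟨⟨hx.1.trans hu.symm, hux⟩, rfl, .refl _ _⟩
  · simp only [Finset.mem_filter, Finset.mem_univ, true_and] at hy ⊢
    exact ⟨hy.1, hij, fun hc => h (hc.of_inside ⟨⟨rfl, le_rfl⟩, hy.1.trans hv.symm, hy.2.2⟩)⟩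
  · have := hs (Finset.mem_filter.2 ⟨Finset.mem_univ v, hv, hij, h⟩)
    simp only [Finset.mem_filter, ne_eq, not_true_eq_false, false_and, and_false] at this

theorem position_lt_iff_pos_lt (hx : A.cls x = i) (hy : A.cls y = i) :
    A.position G i j x < A.position G i j y ↔ A.pos x < A.pos y := by
  refine ⟨fun h => ?_, position_lt_of_pos_lt hx hy⟩
  by_contra hc
  rcases (not_lt.1 hc).eq_or_lt with he | hl
  · exact h.ne (congrArg _ (A.pos_injective he.symm))
  · exact h.asymm (position_lt_of_pos_lt hy hx hl)

theorem position_lt_iff_orientedLE (hij : i ≠ j) (hx : A.cls x = j) (hy : A.cls y = j) :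
    A.position G i j x < A.position G i j y ↔
      x ≠ y ∧ OrientedLE (A.Reversed G i j) (A.pos x) (A.pos y) := by
  refine ⟨fun h => ?_, fun h => position_lt_of_orientedLE hij hx hy h.1 h.2⟩
  have hne : x ≠ y := fun he => h.ne (congrArg _ he)
  refine ⟨hne, (OrientedLE.total _ _ _).resolve_right fun hc => ?_⟩
  exact h.asymm (position_lt_of_orientedLE hij hy hx hne.symm hc)

theorem position_lt_iff_cut (hij : i ≠ j) (hu : A.cls u = i) (hv : A.cls v = j) :
    A.position G i j u < A.position G i j v ↔ A.Cut G (A.Reversed G i j) u v :=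
  ⟨fun h => by_contra fun hc => h.asymm (position_lt_of_not_cut hij hu hv hc),
    position_lt_of_cut hij hu hv⟩

theorem position_lt_iff_not_cut (hij : i ≠ j) (hu : A.cls u = i) (hv : A.cls v = j) :
    A.position G i j v < A.position G i j u ↔ ¬ A.Cut G (A.Reversed G i j) u v :=
  ⟨fun h hc => h.asymm (position_lt_of_cut hij hu hv hc), position_lt_of_not_cut hij hu hv⟩

theorem position_injOn (i j : ι) :
    Set.InjOn (A.position G i j) {x | A.cls x = i ∨ A.cls x = j} := by
  intro x hx y hy h
  by_contra hne
  have hpos : A.pos x ≠ A.pos y := A.pos_injective.ne hne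
  have hlt := h.not_lt
  have hgt := h.not_gt
  by_cases hxi : A.cls x = i <;> by_cases hyi : A.cls y = i
  · rw [position_lt_iff_pos_lt hxi hyi] at hlt
    rw [position_lt_iff_pos_lt hyi hxi] at hgt
    exact hpos (le_antisymm (not_lt.1 hgt) (not_lt.1 hlt))
  · have hyj := hy.resolve_left hyi
    have hij : i ≠ j := fun hij => hyi (hyj.trans hij.symm)
    rw [position_lt_iff_cut hij hxi hyj] at hlt
    exact hgt ((position_lt_iff_not_cut hij hxi hyj).2 hlt)
  · have hxj := hx.resolve_left hxi
    have hij : i ≠ j := fun hij => hxi (hxj.trans hij.symm)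
    rw [position_lt_iff_cut hij hyi hxj] at hgt
    exact hlt ((position_lt_iff_not_cut hij hyi hxj).2 hgt)
  · have hxj := hx.resolve_left hxi
    have hyj := hy.resolve_left hyi
    have hij : i ≠ j := fun hij => hxi (hxj.trans hij.symm)
    rw [position_lt_iff_orientedLE hij hxj hyj] at hlt
    rw [position_lt_iff_orientedLE hij hyj hxj] at hgt
    exact (OrientedLE.total _ _ _).elim (fun hc => hlt ⟨hne, hc⟩) fun hc => hgt ⟨Ne.symm hne, hc⟩

theorem isStrictLinearOrderOn_position (i j : ι) :
    IsStrictLinearOrderOn {x | A.cls x = i ∨ A.cls x = j}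
      fun x y => A.position G i j x < A.position G i j y :=
  ⟨fun _ _ => lt_irrefl _, fun _ _ _ _ _ _ => lt_trans,
    fun _ hx _ hy hne => lt_or_gt_of_ne ((position_injOn i j).ne hx hy hne)⟩

theorem not_adj_of_position_left (hA : A.Compatible G (A.Reversed G i j) i j) (hij : i ≠ j)
    {u v w : V}
    (h : (A.cls u = i ∧ A.cls v = i ∧ A.cls w = j) ∨ (A.cls u = j ∧ A.cls v = j ∧ A.cls w = i))
    (huv : A.position G i j u < A.position G i j v)
    (hvw : A.position G i j v < A.position G i j w) (huw : ¬ G.Adj u w) : ¬ G.Adj v w := by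
  rcases h with ⟨hu, hv, hw⟩ | ⟨hu, hv, hw⟩
  · rw [position_lt_iff_pos_lt hu hv] at huv
    rw [position_lt_iff_cut hij hv hw] at hvw
    exact hA v w hv hw hvw ⟨u, w, ⟨⟨hv.trans hu.symm, huv.le⟩, rfl, .refl _ _⟩, huw⟩
  · rw [position_lt_iff_orientedLE hij hu hv] at huv
    rw [position_lt_iff_not_cut hij hw hv] at hvw
    refine absurd ((cut_of_not_adj fun hwu => huw hwu.symm).of_inside ?_) hvw
    exact ⟨⟨rfl, le_rfl⟩, hu.trans hv.symm, huv.2⟩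

theorem not_adj_of_position_right (hA : A.Compatible G (A.Reversed G i j) i j) (hij : i ≠ j)
    {u v w : V}
    (h : (A.cls v = i ∧ A.cls w = i ∧ A.cls u = j) ∨ (A.cls v = j ∧ A.cls w = j ∧ A.cls u = i))
    (huv : A.position G i j u < A.position G i j v)
    (hvw : A.position G i j v < A.position G i j w) (huw : ¬ G.Adj u w) : ¬ G.Adj u v := by
  rcases h with ⟨hv, hw, hu⟩ | ⟨hv, hw, hu⟩
  · rw [position_lt_iff_not_cut hij hv hu] at huv
    rw [position_lt_iff_pos_lt hv hw] at hvw
    refine absurd ((cut_of_not_adj fun hwu => huw hwu.symm).of_inside ?_) huv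
    exact ⟨⟨hw.trans hv.symm, hvw.le⟩, rfl, .refl _ _⟩
  · rw [position_lt_iff_cut hij hu hv] at huv
    rw [position_lt_iff_orientedLE hij hv hw] at hvw
    exact hA u v hu hv huv ⟨u, w, ⟨⟨rfl, le_rfl⟩, hv.trans hw.symm, hvw.2⟩, huw⟩

theorem alignedOn_position_left (i j k : ι) :
    AlignedOn {x | A.cls x = i} (fun x y => A.position G i j x < A.position G i j y)
      fun x y => A.position G i k x < A.position G i k y :=
  Or.inl fun _ hx _ hy =>
    (position_lt_iff_pos_lt hx hy).trans (position_lt_iff_pos_lt hx hy).symm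

theorem alignedOn_position_right (i j : ι) :
    AlignedOn {x | A.cls x = j} (fun x y => A.position G i j x < A.position G i j y)
      fun x y => A.position G j j x < A.position G j j y := by
  by_cases hij : i = j
  · subst hij
    exact Or.inl fun _ _ _ _ => Iff.rfl
  have key : ∀ {x y : V}, x ≠ y ∧ A.pos x ≤ A.pos y ↔ A.pos x < A.pos y := fun {x y} => by
    rw [lt_iff_le_and_ne, A.pos_injective.ne_iff, and_comm]
  by_cases hr : A.Reversed G i j
  · refine Or.inr fun x hx y hy => ?_
    beta_reduce
    rw [position_lt_iff_orientedLE hij hx hy, position_lt_iff_pos_lt hy hx, ← key]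
    simp only [OrientedLE, hr, true_imp_iff, not_true, false_imp_iff, and_true, ne_comm]
  · refine Or.inl fun x hx y hy => ?_
    beta_reduce
    rw [position_lt_iff_orientedLE hij hx hy, position_lt_iff_pos_lt hx hy, ← key]
    simp only [OrientedLE, hr, true_imp_iff, not_false_eq_true, false_imp_iff, true_and]

end

/-- The proper mixed-thin representation that merges the classes pairwise: edges within a class, and
nonedges between two classes. -/
noncomputable def mixedThinRep {k : ℕ} {A : Arrangement V (Fin k) L} (hP : A.IsProper G)
    (hC : ∀ i j, i ≠ j → A.Compatible G False i j ∨ A.Compatible G True i j) :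
    ProperMixedThinRep G k where
  cls := A.cls
  lt i j u v := A.position G i j u < A.position G i j v
  sign i j := decide (i = j)
  linear i j _ := isStrictLinearOrderOn_position i j
  al_left i j _ := alignedOn_position_left i j i
  al_right i j _ := alignedOn_position_right i j
  co i j _ u v w h huv hvw huw := by
    by_cases hij : i = j
    · subst hij
      simp only [or_self, decide_true, SignedAdj, if_true] at h huw ⊢
      obtain ⟨hu, hv, hw⟩ := h
      exact (hP u v w (hu.trans hv.symm) (hv.trans hw.symm) ((position_lt_iff_pos_lt hu hv).1 huv)
        ((position_lt_iff_pos_lt hv hw).1 hvw) huw).2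
    · simp only [SignedAdj, hij, decide_false, Bool.false_eq_true, if_false,
        SimpleGraph.compl_adj] at huw ⊢
      exact ⟨fun he => hvw.ne (congrArg _ he),
        not_adj_of_position_left (compatible_reversed (hC i j hij)) hij h huv hvw huw.2⟩
  sc i j _ u v w h huv hvw huw := by
    by_cases hij : i = j
    · subst hij
      simp only [or_self, decide_true, SignedAdj, if_true] at h huw ⊢
      obtain ⟨hv, hw, hu⟩ := h
      exact (hP u v w (hu.trans hv.symm) (hv.trans hw.symm) ((position_lt_iff_pos_lt hu hv).1 huv)
        ((position_lt_iff_pos_lt hv hw).1 hvw) huw).1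
    · simp only [SignedAdj, hij, decide_false, Bool.false_eq_true, if_false,
        SimpleGraph.compl_adj] at huw ⊢
      exact ⟨fun he => huv.ne (congrArg _ he),
        not_adj_of_position_right (compatible_reversed (hC i j hij)) hij h huv hvw huw.2⟩

end Arrangement

namespace Arrangement

variable {V ι L I : Type*} [LinearOrder L] {A : Arrangement V ι L} {G : SimpleGraph V}
  {i j : ι}

variable (A) in
/-- On the class `i`, all but two of the functions `x h` are constant; along the order of the class,
one of the exceptions increases and the other one decreases. -/
def Opposed (i : ι) (x : I → V → ℕ) : Prop :=
  ∃ h₁ h₂, h₁ ≠ h₂ ∧ ∀ u v, A.cls u = i → A.cls v = i → A.pos u ≤ A.pos v →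
    (∀ h, h ≠ h₂ → x h u ≤ x h v) ∧ ∀ h, h ≠ h₁ → x h v ≤ x h u

theorem Opposed.sub {x : I → V → ℕ} (hx : A.Opposed i x) (c : I → ℕ) :
    A.Opposed i fun h v => c h - x h v := by
  obtain ⟨h₁, h₂, hne, hmon⟩ := hx
  exact ⟨h₂, h₁, hne.symm, fun u v hu hv huv =>
    ⟨fun h hh => Nat.sub_le_sub_left ((hmon u v hu hv huv).2 h hh) _,
      fun h hh => Nat.sub_le_sub_left ((hmon u v hu hv huv).1 h hh) _⟩⟩

theorem Opposed.comp {J : Type*} {x : I → V → ℕ} (hx : A.Opposed i x) (e : J ≃ I) :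
    A.Opposed i fun h v => x (e h) v := by
  obtain ⟨h₁, h₂, hne, hmon⟩ := hx
  refine ⟨e.symm h₁, e.symm h₂, e.symm.injective.ne hne, fun u v hu hv huv =>
    ⟨fun h hh => (hmon u v hu hv huv).1 _ ?_, fun h hh => (hmon u v hu hv huv).2 _ ?_⟩⟩ <;>
  exact fun he => hh (e.eq_symm_apply.2 he)

theorem compatible_of_forall_adj (rev : Prop)
    (h : ∀ u v, A.cls u = i → A.cls v = j → G.Adj u v) : A.Compatible G rev i j :=
  fun _ _ hu hv ⟨u', v', hin, hn⟩ _ => absurd (h u' v' (hin.1.1.trans hu) (hin.2.1.trans hv)) hn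

theorem compatible_of_forall_not_adj (rev : Prop)
    (h : ∀ u v, A.cls u = i → A.cls v = j → ¬ G.Adj u v) : A.Compatible G rev i j :=
  fun u v hu hv _ _ => h u v hu hv

/-- Moving `u` up and `v` down should never decrease some of the sums `x h u + y h v` and never
increase the other ones. This fails only if the exceptions of `x` and `y` of the same direction
coincide, which a reversal of the second class repairs. -/
theorem compatible_of_opposed {x y : I → V → ℕ} {c : I → ℕ} (hx : A.Opposed i x)
    (hy : A.Opposed j y)
    (h : ∀ u v, A.cls u = i → A.cls v = j → (¬ G.Adj u v ↔ ∀ h, x h u + y h v ≤ c h)) :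
    A.Compatible G False i j ∨ A.Compatible G True i j := by
  obtain ⟨h₁, h₂, hh, hx⟩ := hx
  obtain ⟨g₁, g₂, hg, hy⟩ := hy
  by_cases hc : h₁ ≠ g₁ ∧ h₂ ≠ g₂
  · refine Or.inl ?_
    rintro u v hu hv ⟨u₁, v₁, ⟨⟨hu₁, ku₁⟩, hv₁, kv₁⟩, n₁⟩ ⟨u₂, v₂, ⟨⟨hu₂, ku₂⟩, hv₂, kv₂⟩, n₂⟩
    rw [h _ _ (by grind) (by grind)] at n₁ n₂ ⊢
    intro g
    by_cases hg : g = h₁ ∨ g = g₂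
    · exact (add_le_add ((hx u u₁ hu (hu₁.trans hu) ku₁).1 g (by grind))
        ((hy v₁ v (hv₁.trans hv) hv (kv₁.2 not_false)).2 g (by grind))).trans (n₁ g)
    · exact (add_le_add ((hx u₂ u (hu₂ ▸ hu) hu ku₂).2 g (by grind))
        ((hy v v₂ hv (hv₂ ▸ hv) (kv₂.2 not_false)).1 g (by grind))).trans (n₂ g)
  · refine Or.inr ?_
    rintro u v hu hv ⟨u₁, v₁, ⟨⟨hu₁, ku₁⟩, hv₁, kv₁⟩, n₁⟩ ⟨u₂, v₂, ⟨⟨hu₂, ku₂⟩, hv₂, kv₂⟩, n₂⟩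
    rw [h _ _ (by grind) (by grind)] at n₁ n₂ ⊢
    intro g
    by_cases hg : g = h₁ ∨ g = g₁
    · exact (add_le_add ((hx u u₁ hu (hu₁.trans hu) ku₁).1 g (by grind))
        ((hy v v₁ hv (hv₁.trans hv) (kv₁.1 trivial)).1 g (by grind))).trans (n₁ g)
    · exact (add_le_add ((hx u₂ u (hu₂ ▸ hu) hu ku₂).2 g (by grind))
        ((hy v₂ v (hv₂ ▸ hv) hv (kv₂.1 trivial)).2 g (by grind))).trans (n₂ g)

end Arrangement

/-! ### Numbering classes -/

section ClassIndex

variable {V γ : Type*} [LinearOrder V] (f : V → γ)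

/-- `r` is the first element of its fiber under `f`. -/
def IsFirst (r : V) : Prop :=
  ∀ x, x < r → f x ≠ f r

open Classical in
/-- The number of fibers of `f` whose first element precedes that of the fiber of `v`, so that the
fibers are numbered in the order of their first elements. -/
noncomputable def classIndex [Fintype V] (v : V) : ℕ :=
  Finset.card {r | IsFirst f r ∧ ∀ x, x ≤ r → f x ≠ f v}

variable {f}

theorem exists_isFirst [Finite V] (v : V) : ∃ r, IsFirst f r ∧ f r = f v := by
  obtain ⟨r, hr, hmin⟩ := Set.exists_min_image {x | f x = f v} id (Set.toFinite _) ⟨v, rfl⟩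
  exact ⟨r, fun x hx he => hx.not_ge (hmin x (he.trans hr)), hr⟩

theorem IsFirst.eq_of_apply_eq {r s : V} (hr : IsFirst f r) (hs : IsFirst f s) (h : f r = f s) :
    r = s :=
  le_antisymm (not_lt.1 fun hlt => hr s hlt h.symm) (not_lt.1 fun hlt => hs r hlt h)

variable [Fintype V]

theorem classIndex_congr {u v : V} (h : f u = f v) : classIndex f u = classIndex f v := by
  rw [classIndex, classIndex, h]

theorem classIndex_lt_of_isFirst {r s : V} (hr : IsFirst f r) (hs : IsFirst f s) (h : r < s) :
    classIndex f r < classIndex f s := by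
  classical
  refine Finset.card_lt_card ⟨fun x hx => ?_, fun hc => ?_⟩
  · simp only [Finset.mem_filter, Finset.mem_univ, true_and] at hx ⊢
    refine ⟨hx.1, fun y hy hys => ?_⟩
    rcases lt_or_ge y s with hlt | hge
    · exact hs y hlt hys
    · exact hx.2 r (h.le.trans (hge.trans hy)) rfl
  · have hmem := hc (Finset.mem_filter.2 ⟨Finset.mem_univ r, hr, fun x hx => hs x (hx.trans_lt h)⟩)
    exact (Finset.mem_filter.1 hmem).2.2 r le_rfl rfl

theorem classIndex_eq_iff {u v : V} : classIndex f u = classIndex f v ↔ f u = f v := by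
  refine ⟨fun h => ?_, classIndex_congr⟩
  obtain ⟨r, hr, hru⟩ := exists_isFirst (f := f) u
  obtain ⟨s, hs, hsv⟩ := exists_isFirst (f := f) v
  rw [← classIndex_congr hru, ← classIndex_congr hsv] at h
  rcases lt_trichotomy r s with hlt | rfl | hlt
  · exact absurd h (classIndex_lt_of_isFirst hr hs hlt).ne
  · rw [← hru, hsv]
  · exact absurd h (classIndex_lt_of_isFirst hs hr hlt).ne'

theorem classIndex_lt_card {C : Type*} [Fintype C] (code : V → C)
    (hcode : ∀ u v, code u = code v → f u = f v) (v : V) : classIndex f v < Fintype.card C := by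
  classical
  obtain ⟨r, hr, hrv⟩ := exists_isFirst (f := f) v
  have hlt : classIndex f v < Finset.card {s | IsFirst f s} := by
    refine Finset.card_lt_card ⟨fun x hx => ?_, fun hc => ?_⟩
    · simp only [Finset.mem_filter, Finset.mem_univ, true_and] at hx ⊢
      exact hx.1
    · have hmem := hc (Finset.mem_filter.2 ⟨Finset.mem_univ r, hr⟩)
      exact (Finset.mem_filter.1 hmem).2.2 r le_rfl hrv
  refine hlt.trans_le (Finset.card_le_card_of_injOn code (fun _ _ => Finset.mem_univ _) ?_)
  intro s hs t ht hst
  simp only [Finset.coe_filter, Finset.mem_univ, true_and, Set.mem_ofPred_eq] at hs ht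
  exact hs.eq_of_apply_eq ht (hcode s t hst)

end ClassIndex

/-! ### Path models -/

/-- A family of sets of points of disjoint paths, one path for each `e : E` with the points
`0, …, len e + 1`, that models a family of vertex sets of a subdivision: the ends of the path of an
edge stand for the ends of the edge, and `mem v e i` says that the `i`-th point of `e` lies in the
set of `v`. The number `tag v` identifies the isolated vertex of which the set of `v` consists, and
is `0` if there is none. -/
structure PathModel (V E : Type*) where
  len : E → ℕ
  mem : V → E → ℕ → Prop
  tag : V → ℕ

namespace PathModel

variable {V E : Type*}

section Definitions

variable [LinearOrder V] [Fintype E] [LinearOrder E] (D : PathModel V E)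

/-- The `j`-th point of the edge `h.1`, counted from its second end if `h.2` holds. Pairs
`h : E × Bool` stand for half-edges. -/
def coord (h : E × Bool) (j : ℕ) : ℕ :=
  if h.2 then D.len h.1 + 1 - j else j

/-- The `j`-th point of the half-edge `h` lies in the set of `v`. -/
def Side (v : V) (h : E × Bool) (j : ℕ) : Prop :=
  D.mem v h.1 (D.coord h j)

/-- The set of `v` contains an end of an edge. -/
def Branch (v : V) : Prop :=
  ∃ h, D.Side v h 0

/-- The set of `v` contains all points of `e` if it contains an end of some edge, and none
otherwise. -/
def Full (v : V) (e : E) : Prop :=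
  ∀ i < D.len e + 2, (D.mem v e i ↔ D.Branch v)

open Classical in
/-- The number of points of `h` that lie in the set of `v` before the first gap if the set contains
an end of some edge, and that do not lie in it before its first point otherwise. The two ends of the
edge are not counted. -/
noncomputable def run (v : V) (h : E × Bool) : ℕ :=
  Finset.card {i ∈ Finset.range (D.len h.1) | ∀ j < i + 2, (D.Side v h j ↔ D.Branch v)}

/-- The ends of edges in the set of `v` and the edges on which it is full. -/
def type (v : V) : Set (E × Bool) × Set E :=
  ({h | D.Side v h 0}, {e | D.Full v e})

/-- The set of `v`, which contains an end of an edge, and the first set of the same type have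
different runs on the edge `e`. -/
def Differs (v : V) (e : E) : Prop :=
  D.Branch v ∧
    ∃ r s, (IsFirst D.type r ∧ D.type r = D.type v) ∧ D.run v (e, s) ≠ D.run r (e, s)

/-- The invariant that determines the class of `v` in the mixed-thin representation. -/
def classOf (v : V) : (Set (E × Bool) × Set E) × Set E :=
  (D.type v, {e | D.Differs v e})

/-- The run of `h` is not constant on the class of `v`. -/
def Varies (v : V) (h : E × Bool) : Prop :=
  ∃ u, D.classOf u = D.classOf v ∧ D.run u h ≠ D.run v h

/-- `h` is the first half-edge whose run is not constant on the class of `v`. -/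
def Leading (v : V) (h : E × Bool) : Prop :=
  D.Varies v h ∧ ∀ g, D.Varies v g → toLex h ≤ toLex g

/-- The set of `v` contains no point of an edge. -/
def Degenerate (v : V) : Prop :=
  ¬ D.Branch v ∧ ∀ e, D.Full v e

open Classical in
/-- The run of `h` if `h` is leading, and the rest of its edge otherwise. Within a class, all
weights increase when the leading run does. -/
noncomputable def weight (v : V) (h : E × Bool) : ℕ :=
  if D.Leading v h then D.run v h else D.len h.1 - D.run v h

open Classical in
/-- The key by which each class is sorted. -/
noncomputable def key (v : V) : ℕ :=
  if D.Degenerate v then D.tag v else ∑ h, D.weight v h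

/-- The sets of `u` and `v` meet on some edge. -/
def Meets (u v : V) : Prop :=
  ∃ e, ∃ i < D.len e + 2, D.mem u e i ∧ D.mem v e i

/-- The properties of a path model that come from a non-crossing representation of `G`. -/
structure Represents (G : SimpleGraph V) : Prop where
  adj_iff : ∀ u v, u ≠ v → (G.Adj u v ↔
    D.Meets u v ∨ D.Degenerate u ∧ D.Degenerate v ∧ D.tag u = D.tag v ∧ D.tag u ≠ 0)
  prefix_or_suffix : ∀ v e i, D.Branch v → i < D.len e + 2 → D.mem v e i →
    (∀ j ≤ i, D.mem v e j) ∨ ∀ j, i ≤ j → j < D.len e + 2 → D.mem v e j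
  edge_unique : ∀ v e i e' i', ¬ D.Branch v → i < D.len e + 2 → i' < D.len e' + 2 →
    D.mem v e i → D.mem v e' i' → e = e'
  convex : ∀ v e i j k, ¬ D.Branch v → i ≤ j → j ≤ k → k < D.len e + 2 →
    D.mem v e i → D.mem v e k → D.mem v e j
  single : ∀ u v h h', D.type u = D.type v → D.run v h < D.run u h → D.run v h' < D.run u h' →
    h = h'

end Definitions

variable {D : PathModel V E} {G : SimpleGraph V} {u v w : V} {e : E} {h : E × Bool} {i j : ℕ}

theorem coord_lt (hi : i < D.len h.1 + 2) : D.coord h i < D.len h.1 + 2 := by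
  unfold coord
  split_ifs <;> omega

theorem coord_coord (hi : i < D.len h.1 + 2) : D.coord h (D.coord h i) = i := by
  unfold coord
  split_ifs <;> omega

theorem coord_not_add_coord (s : Bool) (hi : i < D.len e + 2) :
    D.coord (e, !s) i + D.coord (e, s) i = D.len e + 1 := by
  cases s <;> simp [coord] <;> omega

theorem side_coord (hi : i < D.len h.1 + 2) : D.Side v h (D.coord h i) ↔ D.mem v h.1 i := by
  rw [Side, coord_coord hi]

theorem side_not {s : Bool} (hj : j < D.len e + 2) :
    D.Side v (e, !s) (D.len e + 1 - j) ↔ D.Side v (e, s) j := by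
  cases s <;> simp [Side, coord, show D.len e + 1 - (D.len e + 1 - j) = j by omega]

theorem side_zero_false (hv : ¬ D.Branch v) (h : E × Bool) : ¬ D.Side v h 0 :=
  fun hs => hv ⟨h, hs⟩

theorem meets_of_side (hj : j < D.len h.1 + 2) (hu : D.Side u h j) (hv : D.Side v h j) :
    D.Meets u v :=
  ⟨h.1, _, coord_lt hj, hu, hv⟩

theorem coord_pos_of_not_branch (hv : ¬ D.Branch v) (hi : i < D.len e + 2) (h : D.mem v e i)
    (s : Bool) : 1 ≤ D.coord (e, s) i := by
  by_contra h0
  have hs := (side_coord (h := (e, s)) hi).2 h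
  rw [show D.coord (e, s) i = 0 by omega] at hs
  exact side_zero_false hv _ hs

theorem run_le (v : V) (h : E × Bool) : D.run v h ≤ D.len h.1 := by
  classical
  exact (Finset.card_filter_le _ _).trans (Finset.card_range _).le

theorem le_run_iff (h1 : 1 ≤ i) (hi : i ≤ D.len h.1) :
    i ≤ D.run v h ↔ ∀ j ≤ i, (D.Side v h j ↔ D.Branch v) := by
  classical
  constructor
  · intro hr
    by_contra hcon
    have hsub : {a ∈ Finset.range (D.len h.1) | ∀ j < a + 2, (D.Side v h j ↔ D.Branch v)} ⊆
        Finset.range (i - 1) := by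
      intro a ha
      simp only [Finset.mem_filter, Finset.mem_range] at ha ⊢
      by_contra hai
      exact hcon fun j hj => ha.2 j (by omega)
    have hle : D.run v h ≤ i - 1 := (Finset.card_le_card hsub).trans (Finset.card_range _).le
    omega
  · intro hr
    have hsub : Finset.range i ⊆
        {a ∈ Finset.range (D.len h.1) | ∀ j < a + 2, (D.Side v h j ↔ D.Branch v)} := by
      intro a ha
      simp only [Finset.mem_filter, Finset.mem_range] at ha ⊢
      exact ⟨by omega, fun j hj => hr j (by omega)⟩
    exact (Finset.card_range i).ge.trans (Finset.card_le_card hsub)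

theorem side_of_le_run (hv : D.Branch v) (h1 : 1 ≤ j) (hj : j ≤ D.run v h) : D.Side v h j :=
  ((le_run_iff h1 (hj.trans (run_le v h))).1 hj j le_rfl).2 hv

theorem side_run_succ (hv : ¬ D.Branch v) (hl : D.run v h < D.len h.1) :
    D.Side v h (D.run v h + 1) := by
  by_contra hs
  refine (Nat.lt_succ_self (D.run v h)).not_ge ((le_run_iff (by omega) hl).2 fun j hj => ?_)
  refine iff_of_false (fun hj' => ?_) hv
  rcases Nat.eq_zero_or_pos j with rfl | h0
  · exact side_zero_false hv h hj'
  · rcases hj.lt_or_eq with hlt | rfl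
    · exact hv (((le_run_iff h0 (by omega)).1 (Nat.lt_succ_iff.1 hlt) j le_rfl).1 hj')
    · exact hs hj'

theorem run_lt_coord (hv : ¬ D.Branch v) (hi : i < D.len e + 2) (h : D.mem v e i) (s : Bool) :
    D.run v (e, s) < D.coord (e, s) i := by
  by_contra! hle
  have h1 := coord_pos_of_not_branch hv hi h s
  have hl : D.coord (e, s) i ≤ D.len e := hle.trans (run_le v (e, s))
  exact hv (((le_run_iff h1 hl).1 hle _ le_rfl).1 ((side_coord hi).2 h))

theorem Full.run_eq (he : D.Full v e) (s : Bool) : D.run v (e, s) = D.len e := by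
  refine le_antisymm (run_le _ _) ?_
  rcases Nat.eq_zero_or_pos (D.len e) with h0 | h0
  · omega
  · exact (le_run_iff h0 le_rfl).2 fun j hj => he _ (coord_lt (h := (e, s)) (by dsimp; omega))

theorem exists_mem_of_not_full (hv : ¬ D.Branch v) (he : ¬ D.Full v e) :
    ∃ i < D.len e + 2, D.mem v e i := by
  simpa [Full, hv] using he

theorem run_add_run_lt (hv : ¬ D.Branch v) (he : ¬ D.Full v e) :
    D.run v (e, false) + D.run v (e, true) < D.len e := by
  obtain ⟨i, hi, hm⟩ := exists_mem_of_not_full hv he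
  have h1 := run_lt_coord hv hi hm false
  have h2 := run_lt_coord hv hi hm true
  have h3 := D.coord_not_add_coord false hi
  simp only [Bool.not_false] at h3
  omega

theorem Represents.full_of_ne (hD : D.Represents G) (hv : ¬ D.Branch v) (he : ¬ D.Full v e)
    {e' : E} (hne : e' ≠ e) : D.Full v e' := by
  obtain ⟨i, hi, hm⟩ := exists_mem_of_not_full hv he
  exact fun j hj => iff_of_false (fun hm' => hne (hD.edge_unique v e' j e i hv hj hi hm' hm)) hv

theorem Represents.exists_coord_le_run (hD : D.Represents G) (hv : D.Branch v) (h1 : 1 ≤ i)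
    (hi : i ≤ D.len e) (h : D.mem v e i) :
    ∃ s, D.coord (e, s) i ≤ D.run v (e, s) ∧ D.Side v (e, s) 0 := by
  rcases hD.prefix_or_suffix v e i hv (by omega) h with hp | hs
  · exact ⟨false, (le_run_iff h1 hi).2 fun j hj => iff_of_true (hp j hj) hv, hp 0 (by omega)⟩
  · refine ⟨true, (le_run_iff ?_ ?_).2 fun j hj => iff_of_true (hs _ ?_ ?_) hv, hs _ ?_ ?_⟩ <;>
    simp only [coord, if_true] at * <;> omega

/-- A set with an end of an edge meets a set without one if and only if it extends further from some
end of an edge than the complement of the other. -/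
theorem Represents.not_meets_iff_of_branch_of_not (hD : D.Represents G) (hu : D.Branch u)
    (hv : ¬ D.Branch v) : ¬ D.Meets u v ↔ ∀ h, D.run u h ≤ D.run v h := by
  constructor
  · intro hn h
    by_contra! hlt
    have hl := D.run_le u h
    exact hn (meets_of_side (by omega) (side_of_le_run hu (by omega) hlt)
      (side_run_succ hv (by omega)))
  · rintro hle ⟨e, i, hi, h1, h2⟩
    have i1 := coord_pos_of_not_branch hv hi h2 false
    have i2 := coord_pos_of_not_branch hv hi h2 true
    have hc := D.coord_not_add_coord false hi
    simp only [coord, Bool.not_false, Bool.false_eq_true, if_true, if_false] at i1 i2 hc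
    obtain ⟨s, hs, -⟩ := hD.exists_coord_le_run hu i1 (by omega) h1
    exact ((hs.trans (hle (e, s))).trans_lt (run_lt_coord hv hi h2 s)).false

theorem Represents.not_meets_iff_of_branch (hD : D.Represents G) (hu : D.Branch u)
    (hv : D.Branch v) (hno : ∀ h, ¬ (D.Side u h 0 ∧ D.Side v h 0)) :
    ¬ D.Meets u v ↔ ∀ h : E × Bool, D.run u h + D.run v (h.1, !h.2) ≤ D.len h.1 := by
  constructor
  · rintro hn ⟨e, s⟩
    by_contra! hlt
    have h1 := D.run_le u (e, s)
    have h2 := D.run_le v (e, !s)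
    simp only at hlt h1 h2
    refine hn (meets_of_side (h := (e, s)) (j := D.run u (e, s)) (by dsimp; omega)
      (side_of_le_run hu (by omega) le_rfl) ((side_not (by omega)).1 ?_))
    exact side_of_le_run hv (by omega) (by omega)
  · rintro hle ⟨e, i, hi, h1, h2⟩
    have hpos : ∀ s, 1 ≤ D.coord (e, s) i := fun s => by
      by_contra h0
      refine hno (e, s) ?_
      rw [show 0 = D.coord (e, s) i by omega]
      exact ⟨(side_coord hi).2 h1, (side_coord hi).2 h2⟩
    have i1 : 1 ≤ i := hpos false
    have i2 : i ≤ D.len e := by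
      have h0 := hpos true
      simp only [coord, if_true] at h0
      omega
    obtain ⟨s, hs, hs0⟩ := hD.exists_coord_le_run hu i1 i2 h1
    obtain ⟨t, ht, ht0⟩ := hD.exists_coord_le_run hv i1 i2 h2
    obtain rfl : t = !s := Bool.eq_not_iff.2 fun h => hno (e, s) ⟨hs0, h ▸ ht0⟩
    have hc := D.coord_not_add_coord s hi
    have := hle (e, s)
    simp only at this
    omega

theorem Represents.mem_iff_of_not_branch (hD : D.Represents G) (hv : ¬ D.Branch v)
    (he : ¬ D.Full v e) (hi : i < D.len e + 2) :
    D.mem v e i ↔ D.run v (e, false) < i ∧ i + D.run v (e, true) ≤ D.len e := by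
  constructor
  · intro h
    have h1 := run_lt_coord hv hi h false
    have h2 := run_lt_coord hv hi h true
    simp only [coord, Bool.false_eq_true, if_false, if_true] at h1 h2
    omega
  · rintro ⟨h1, h2⟩
    have hlt := run_add_run_lt hv he
    have first : D.mem v e (D.run v (e, false) + 1) :=
      side_run_succ (h := (e, false)) hv (by dsimp; omega)
    have last : D.mem v e (D.len e - D.run v (e, true)) := by
      have := side_run_succ (h := (e, true)) hv (by dsimp; omega)
      simpa only [Side, coord, if_true, Nat.add_sub_add_right] using this
    exact hD.convex v e _ i _ hv (by omega) (by omega) (by omega) first last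

theorem Represents.meets_iff_of_not_branch (hD : D.Represents G) (hu : ¬ D.Branch u)
    (hv : ¬ D.Branch v) (hue : ¬ D.Full u e) (hve : ¬ D.Full v e) :
    D.Meets u v ↔ D.run u (e, false) + D.run v (e, true) < D.len e ∧
      D.run v (e, false) + D.run u (e, true) < D.len e := by
  constructor
  · rintro ⟨e', i, hi, h1, h2⟩
    obtain rfl : e' = e := by
      by_contra hne
      exact hu ((hD.full_of_ne hu hue hne i hi).1 h1)
    rw [hD.mem_iff_of_not_branch hu hue hi] at h1
    rw [hD.mem_iff_of_not_branch hv hve hi] at h2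
    omega
  · rintro ⟨h1, h2⟩
    have hu' := run_add_run_lt hu hue
    have hv' := run_add_run_lt hv hve
    refine ⟨e, max (D.run u (e, false)) (D.run v (e, false)) + 1, by omega, ?_, ?_⟩
    · rw [hD.mem_iff_of_not_branch hu hue (by omega)]
      omega
    · rw [hD.mem_iff_of_not_branch hv hve (by omega)]
      omega

end PathModel

/-! ### The order on a class -/

namespace PathModel

variable {V E : Type*} {D : PathModel V E} {G : SimpleGraph V} {r u v w x y : V}
  {a b e : E} {h h₁ h₂ h₃ : E × Bool}

theorem side_zero_iff (huv : D.type u = D.type v) (h : E × Bool) :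
    D.Side u h 0 ↔ D.Side v h 0 :=
  Set.ext_iff.1 (congrArg Prod.fst huv) h

theorem branch_iff (huv : D.type u = D.type v) : D.Branch u ↔ D.Branch v :=
  exists_congr (side_zero_iff huv)

theorem full_iff (huv : D.type u = D.type v) (e : E) : D.Full u e ↔ D.Full v e :=
  Set.ext_iff.1 (congrArg Prod.snd huv) e

theorem degenerate_iff (huv : D.type u = D.type v) : D.Degenerate u ↔ D.Degenerate v :=
  and_congr (not_congr (branch_iff huv)) (forall_congr' (full_iff huv))

theorem Represents.run_eq_of_two (hD : D.Represents G) (huv : D.type u = D.type v)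
    (h12 : h₁ ≠ h₂) (h13 : h₁ ≠ h₃) (h23 : h₂ ≠ h₃) (hd₁ : D.run u h₁ ≠ D.run v h₁)
    (hd₂ : D.run u h₂ ≠ D.run v h₂) : D.run u h₃ = D.run v h₃ := by
  by_contra hd₃
  have up := fun h h' => hD.single u v h h' huv
  have down := fun h h' => hD.single v u h h' huv.symm
  rcases lt_or_gt_of_ne hd₁ with l₁ | l₁ <;> rcases lt_or_gt_of_ne hd₂ with l₂ | l₂ <;>
    rcases lt_or_gt_of_ne hd₃ with l₃ | l₃ <;> grind

section Classes

variable [LinearOrder V]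

theorem type_eq_of_classOf_eq (huv : D.classOf u = D.classOf v) : D.type u = D.type v :=
  congrArg Prod.fst huv

theorem differs_iff_of_classOf_eq (huv : D.classOf u = D.classOf v) (e : E) :
    D.Differs u e ↔ D.Differs v e :=
  Set.ext_iff.1 (congrArg Prod.snd huv) e

theorem differs_iff (hr : IsFirst D.type r) (hrv : D.type r = D.type v) (hv : D.Branch v) :
    D.Differs v e ↔ ∃ s, D.run v (e, s) ≠ D.run r (e, s) := by
  constructor
  · rintro ⟨-, r', s, ⟨hr', hrv'⟩, hs⟩
    exact ⟨s, hr'.eq_of_apply_eq hr (hrv'.trans hrv.symm) ▸ hs⟩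
  · rintro ⟨s, hs⟩
    exact ⟨hv, r, s, ⟨hr, hrv⟩, hs⟩

theorem varies_iff (huv : D.classOf u = D.classOf v) (h : E × Bool) :
    D.Varies u h ↔ D.Varies v h := by
  have imp : ∀ {u v}, D.classOf u = D.classOf v → D.Varies u h → D.Varies v h := by
    rintro u v huv ⟨w, hw, hne⟩
    by_cases hu : D.run u h = D.run v h
    · exact ⟨w, hw.trans huv, hu ▸ hne⟩
    · exact ⟨u, huv, hu⟩
  exact ⟨imp huv, imp huv.symm⟩

theorem Varies.exists_run_ne (hv : D.Varies v h) (n : ℕ) :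
    ∃ u, D.classOf u = D.classOf v ∧ D.run u h ≠ n := by
  obtain ⟨u, hu, hne⟩ := hv
  by_cases huh : D.run u h = n
  · exact ⟨v, rfl, fun hvh => hne (huh.trans hvh.symm)⟩
  · exact ⟨u, hu, huh⟩

theorem run_eq_of_not_varies (hv : ¬ D.Varies v h) (hu : D.classOf u = D.classOf v) :
    D.run u h = D.run v h :=
  not_not.1 fun hne => hv ⟨u, hu, hne⟩

theorem Represents.run_eq_of_differs_not (hD : D.Represents G) (hr : IsFirst D.type r)
    (hrx : D.type r = D.type x) (hxy : D.classOf x = D.classOf y) (hab : a ≠ b)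
    (hb : D.Differs x b) {s : Bool} (hx : D.run x (a, s) ≠ D.run r (a, s))
    (hy : D.run y (a, !s) ≠ D.run r (a, !s)) (t : Bool) : D.run x (b, t) = D.run y (b, t) := by
  have hty := type_eq_of_classOf_eq hxy
  obtain ⟨q, hq⟩ := (differs_iff hr hrx hb.1).1 hb
  obtain ⟨p, hp⟩ := (differs_iff hr (hrx.trans hty) ((branch_iff hty).1 hb.1)).1
    ((differs_iff_of_classOf_eq hxy b).1 hb)
  have hx' : D.run x (a, !s) = D.run r (a, !s) :=
    hD.run_eq_of_two hrx.symm (h₂ := (b, q)) (by grind) (by simp) (by grind) hx hq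
  have hy' : D.run y (a, s) = D.run r (a, s) :=
    hD.run_eq_of_two (hrx.trans hty).symm (h₂ := (b, p)) (by grind) (by simp) (by grind) hy hp
  exact hD.run_eq_of_two hty (h₁ := (a, s)) (h₂ := (a, !s)) (by simp) (by simp [hab])
    (by simp [hab]) (hy' ▸ hx) (hx' ▸ hy.symm)

theorem varies_of_run_ne (hu : D.classOf u = D.classOf v) (hw : D.classOf w = D.classOf v)
    (hne : D.run u h ≠ D.run w h) : D.Varies v h :=
  (varies_iff hu h).1 ⟨w, hw.trans hu.symm, hne.symm⟩

theorem Varies.not_full (hv : D.Varies v h) : ¬ D.Full v h.1 := by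
  obtain ⟨u, hu, hne⟩ := hv
  intro hf
  have hu' := (full_iff (type_eq_of_classOf_eq hu) h.1).2 hf
  exact hne ((hu'.run_eq h.2).trans (hf.run_eq h.2).symm)

theorem Represents.fst_eq_of_varies_of_not_branch (hD : D.Represents G) (hb : ¬ D.Branch v)
    (hv₁ : D.Varies v h₁) (hv₂ : D.Varies v h₂) : h₁.1 = h₂.1 := by
  by_contra hne
  exact hv₁.not_full (hD.full_of_ne hb hv₂.not_full hne)

variable [Finite V]

/-- Every set of the class differs from the first one `r` of its type on exactly one half of `a` and
on one half of `b`. Sets that differ from `r` on opposite halves of `a` agree on `b`. -/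
theorem Represents.not_varies_of_varies_both (hD : D.Represents G) (hab : a ≠ b)
    (ha : D.Differs v a) (hb : D.Differs v b) (hf : D.Varies v (a, false))
    (ht : D.Varies v (a, true)) (t : Bool) : ¬ D.Varies v (b, t) := by
  obtain ⟨r, hr, hrv⟩ := exists_isFirst (f := D.type) v
  obtain ⟨x, hx, hxr⟩ := hf.exists_run_ne (D.run r (a, false))
  obtain ⟨y, hy, hyr⟩ := ht.exists_run_ne (D.run r (a, true))
  have agree : ∀ {z z' s}, D.classOf z = D.classOf v → D.classOf z' = D.classOf v →
      D.run z (a, s) ≠ D.run r (a, s) → D.run z' (a, !s) ≠ D.run r (a, !s) →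
      D.run z (b, t) = D.run z' (b, t) := fun hz hz' hs hs' =>
    hD.run_eq_of_differs_not hr (hrv.trans (type_eq_of_classOf_eq hz).symm) (hz.trans hz'.symm) hab
      ((differs_iff_of_classOf_eq hz b).2 hb) hs hs' t
  have constant : ∀ z, D.classOf z = D.classOf v → D.run z (b, t) = D.run x (b, t) := by
    intro z hz
    have hty := type_eq_of_classOf_eq hz
    obtain ⟨_ | _, hs⟩ := (differs_iff hr (hrv.trans hty.symm) ((branch_iff hty).2 ha.1)).1
      ((differs_iff_of_classOf_eq hz a).2 ha)
    · exact (agree (s := false) hz hy hs hyr).trans (agree (s := false) hx hy hxr hyr).symm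
    · exact (agree (s := false) hx hz hxr hs).symm
  rintro ⟨z, hz, hne⟩
  exact hne ((constant z hz).trans (constant v rfl).symm)

theorem Varies.differs (hv : D.Varies v h) (hb : D.Branch v) : D.Differs v h.1 := by
  obtain ⟨r, hr, hrv⟩ := exists_isFirst (f := D.type) v
  obtain ⟨u, hu, hne⟩ := hv.exists_run_ne (D.run r h)
  have hty := type_eq_of_classOf_eq hu
  exact (differs_iff_of_classOf_eq hu _).1
    ((differs_iff hr (hrv.trans hty.symm) ((branch_iff hty).2 hb)).2 ⟨h.2, hne⟩)

theorem Represents.differs_eq_or_eq (hD : D.Represents G) (hab : a ≠ b) (ha : D.Differs v a)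
    (hb : D.Differs v b) (he : D.Differs v e) : e = a ∨ e = b := by
  obtain ⟨r, hr, hrv⟩ := exists_isFirst (f := D.type) v
  obtain ⟨s, hs⟩ := (differs_iff hr hrv ha.1).1 ha
  obtain ⟨t, ht⟩ := (differs_iff hr hrv ha.1).1 hb
  obtain ⟨q, hq⟩ := (differs_iff hr hrv ha.1).1 he
  by_contra! hne
  exact hq (hD.run_eq_of_two hrv.symm (h₁ := (a, s)) (h₂ := (b, t)) (by simp [hab])
    (by simp [hne.1.symm]) (by simp [hne.2.symm]) hs ht)

theorem Represents.eq_or_eq_of_varies_of_fst_eq (hD : D.Represents G) (hne : h₁ ≠ h₂)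
    (h12 : h₁.1 = h₂.1) (hv₁ : D.Varies v h₁) (hv₂ : D.Varies v h₂) (hv : D.Varies v h) :
    h = h₁ ∨ h = h₂ := by
  have cases_of_fst : ∀ g : E × Bool, g.1 = h₁.1 → g = h₁ ∨ g = h₂ := by
    rintro ⟨e, s⟩ rfl
    cases s <;> rcases h₁ with ⟨_, _ | _⟩ <;> rcases h₂ with ⟨_, _ | _⟩ <;> simp_all
  have varies_half : ∀ s, D.Varies v (h₁.1, s) := fun s => by
    rcases cases_of_fst (h₁.1, s) rfl with hs | hs <;> rw [hs] <;> assumption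
  refine cases_of_fst h ?_
  by_cases hb : D.Branch v
  · by_contra hh
    exact hD.not_varies_of_varies_both (Ne.symm hh) (hv₁.differs hb) (hv.differs hb)
      (varies_half false) (varies_half true) h.2 hv
  · exact hD.fst_eq_of_varies_of_not_branch hb hv hv₁

theorem Represents.eq_or_eq_of_varies (hD : D.Represents G) (hne : h₁ ≠ h₂)
    (hv₁ : D.Varies v h₁) (hv₂ : D.Varies v h₂) (hv : D.Varies v h) : h = h₁ ∨ h = h₂ := by
  by_cases h12 : h₁.1 = h₂.1
  · exact hD.eq_or_eq_of_varies_of_fst_eq hne h12 hv₁ hv₂ hv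
  have hb : D.Branch v :=
    not_not.1 fun hb => h12 (hD.fst_eq_of_varies_of_not_branch hb hv₁ hv₂)
  by_contra! hh
  rcases hD.differs_eq_or_eq h12 (hv₁.differs hb) (hv₂.differs hb) (hv.differs hb) with he | he
  · exact (hD.eq_or_eq_of_varies_of_fst_eq hh.1 he hv hv₁ hv₂).elim hh.2.symm hne.symm
  · exact (hD.eq_or_eq_of_varies_of_fst_eq hh.2 he hv hv₂ hv₁).elim hh.1.symm hne

end Classes

section Key

variable [LinearOrder V] [LinearOrder E]

theorem Leading.unique (hl₁ : D.Leading v h₁) (hl₂ : D.Leading v h₂) : h₁ = h₂ :=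
  toLex.injective (le_antisymm (hl₁.2 h₂ hl₂.1) (hl₂.2 h₁ hl₁.1))

theorem leading_iff (huv : D.classOf u = D.classOf v) (h : E × Bool) :
    D.Leading u h ↔ D.Leading v h :=
  and_congr (varies_iff huv h) (forall_congr' fun g => imp_congr_left (varies_iff huv g))

theorem weight_of_leading (hl : D.Leading v h) (hu : D.classOf u = D.classOf v) :
    D.weight u h = D.run u h :=
  if_pos ((leading_iff hu h).2 hl)

theorem weight_of_ne_leading (hl : D.Leading v h₁) (hu : D.classOf u = D.classOf v)
    (hne : h ≠ h₁) : D.weight u h = D.len h.1 - D.run u h :=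
  if_neg fun hl' => hne (((leading_iff hu h).1 hl').unique hl)

theorem Varies.exists_leading [Finite E] (hv : D.Varies v h) : ∃ g, D.Leading v g := by
  obtain ⟨g, hg, hmin⟩ := Set.exists_min_image {g | D.Varies v g} toLex (Set.toFinite _) ⟨h, hv⟩
  exact ⟨g, hg, hmin⟩

variable [Fintype E]

theorem key_of_leading (hl : D.Leading v h) (hu : D.classOf u = D.classOf v) :
    D.key u = ∑ g, D.weight u g :=
  if_neg fun hd =>
    hl.1.not_full (((degenerate_iff (type_eq_of_classOf_eq hu)).1 hd).2 h.1)

theorem key_lt_key (hl : D.Leading v h₁) (hu : D.classOf u = D.classOf v)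
    (hw : D.classOf w = D.classOf v) (h₁le : D.run w h₁ ≤ D.run u h₁)
    (hle : ∀ h, h ≠ h₁ → D.run u h ≤ D.run w h) (hne : D.run w h ≠ D.run u h) :
    D.key w < D.key u := by
  rw [key_of_leading hl hu, key_of_leading hl hw]
  refine Finset.sum_lt_sum (fun g _ => ?_) ⟨h, Finset.mem_univ h, ?_⟩
  · by_cases hg : g = h₁
    · rwa [hg, weight_of_leading hl hu, weight_of_leading hl hw]
    · rw [weight_of_ne_leading hl hu hg, weight_of_ne_leading hl hw hg]
      exact Nat.sub_le_sub_left (hle g hg) _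
  · by_cases hh : h = h₁
    · subst hh
      rw [weight_of_leading hl hu, weight_of_leading hl hw]
      exact lt_of_le_of_ne h₁le hne
    · rw [weight_of_ne_leading hl hu hh, weight_of_ne_leading hl hw hh]
      have hle' := hle h hh
      have hlen := D.run_le w h
      omega

theorem Represents.run_le_run_of_key_le (hD : D.Represents G) (hl : D.Leading v h₁)
    (hu : D.classOf u = D.classOf v) (hw : D.classOf w = D.classOf v) (hk : D.key u ≤ D.key w) :
    D.run u h₁ ≤ D.run w h₁ := by
  by_contra! hlt
  have hty := type_eq_of_classOf_eq (hu.trans hw.symm)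
  refine (key_lt_key hl hu hw hlt.le (fun h hh => ?_) hlt.ne).not_ge hk
  by_contra! hlt'
  exact hh (hD.single u w h h₁ hty hlt' hlt)

variable [Finite V]

theorem Represents.run_ge_run_of_key_le (hD : D.Represents G) (hl : D.Leading v h₁)
    (hu : D.classOf u = D.classOf v) (hw : D.classOf w = D.classOf v) (hk : D.key u ≤ D.key w)
    (hh : h ≠ h₁) : D.run w h ≤ D.run u h := by
  by_contra! hlt
  have hty := type_eq_of_classOf_eq (hw.trans hu.symm)
  refine (key_lt_key hl hu hw ?_ (fun g hg => ?_) hlt.ne').not_ge hk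
  · by_contra! hlt'
    exact hh (hD.single w u h h₁ hty hlt hlt')
  · by_contra! hlt'
    obtain rfl | rfl := hD.eq_or_eq_of_varies hh (varies_of_run_ne hu hw hlt.ne) hl.1
      (varies_of_run_ne hu hw hlt'.ne')
    · exact hlt.asymm hlt'
    · exact hg rfl

theorem Represents.exists_opposed_runs [Nonempty E] (hD : D.Represents G) (v : V) :
    ∃ h₁ h₂, h₁ ≠ h₂ ∧ ∀ u w, D.classOf u = D.classOf v → D.classOf w = D.classOf v →
      D.key u ≤ D.key w → (∀ h, h ≠ h₂ → D.run u h ≤ D.run w h) ∧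
        ∀ h, h ≠ h₁ → D.run w h ≤ D.run u h := by
  by_cases hvar : ∃ h, D.Varies v h
  · obtain ⟨h₁, hl⟩ := hvar.elim fun _ => Varies.exists_leading
    obtain ⟨h₂, hne, hconst⟩ : ∃ h₂, h₁ ≠ h₂ ∧ ∀ h, D.Varies v h → h = h₁ ∨ h = h₂ := by
      by_cases hsecond : ∃ h₂, h₁ ≠ h₂ ∧ D.Varies v h₂
      · obtain ⟨h₂, hne, hv₂⟩ := hsecond
        exact ⟨h₂, hne, fun h hv => hD.eq_or_eq_of_varies hne hl.1 hv₂ hv⟩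
      · push Not at hsecond
        exact ⟨(h₁.1, !h₁.2), fun he => by simpa using congrArg Prod.snd he,
          fun h hv => Or.inl (not_not.1 fun hh => hsecond h (Ne.symm hh) hv)⟩
    refine ⟨h₁, h₂, hne, fun u w hu hw hk =>
      ⟨fun h hh => ?_, fun h hh => hD.run_ge_run_of_key_le hl hu hw hk hh⟩⟩
    by_contra! hlt
    obtain rfl | rfl := hconst h (varies_of_run_ne hu hw hlt.ne')
    · exact hlt.not_ge (hD.run_le_run_of_key_le hl hu hw hk)
    · exact hh rfl
  · obtain ⟨e⟩ := ‹Nonempty E›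
    push Not at hvar
    refine ⟨(e, false), (e, true), by simp, fun u w hu hw _ => ?_⟩
    have heq : ∀ h, D.run u h = D.run w h := fun h =>
      (run_eq_of_not_varies (hvar h) hu).trans (run_eq_of_not_varies (hvar h) hw).symm
    exact ⟨fun h _ => (heq h).le, fun h _ => (heq h).ge⟩

end Key

end PathModel

/-! ### The number of classes -/

namespace PathModel

variable {V E : Type*} {D : PathModel V E} {G : SimpleGraph V} {u v : V} {e : E}

/-- Codes of classes: the ends of edges, the full edges and the at most two edges on which a set
differs from the first one of its type, or a single edge. -/
abbrev ClassCode (E : Type*) : Type _ :=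
  ({B : Finset (E × Bool) // B ≠ ∅} × Finset E × Option (E × E)) ⊕ E

theorem card_classCode [Fintype E] [DecidableEq E] :
    Fintype.card (ClassCode E) = thinnessBound (Fintype.card E) := by
  have hcard : Fintype.card {B : Finset (E × Bool) // B ≠ ∅} = 4 ^ Fintype.card E - 1 := by
    rw [Fintype.card_subtype_compl, Fintype.card_finset, Fintype.card_prod, Fintype.card_bool,
      mul_comm, pow_mul]
    simp
  rw [Fintype.card_sum, Fintype.card_prod, hcard, Fintype.card_prod, Fintype.card_finset,
    Fintype.card_option, Fintype.card_prod, thinnessBound]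
  ring

theorem not_branch_of_code {B : Finset (E × Bool)} {F : Finset E} (hB : B = {(e, false)})
    (hF : F = {e}) (hBu : ∀ h, h ∈ B ↔ D.Side u h 0) (hFu : ∀ e, e ∈ F ↔ D.Full u e) :
    ¬ D.Branch u := by
  intro hb
  have hfull : D.Full u e := (hFu e).1 (by simp [hF])
  have hend : D.Side u (e, true) 0 := (hfull _ (coord_lt (h := (e, true)) (Nat.succ_pos _))).2 hb
  have hmem := (hBu _).2 hend
  simp [hB] at hmem

section

variable [LinearOrder V]

variable (D) in
/-- `c` encodes the class of `v`. The degenerate sets borrow a code that no set with an end of an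
edge has: it would be full on an edge and contain only one of its ends. -/
def IsCode (v : V) : ClassCode E → Prop
  | .inl (B, F, p) =>
    (D.Branch v ∧ (∀ h, h ∈ B.1 ↔ D.Side v h 0) ∧ (∀ e, e ∈ F ↔ D.Full v e) ∧
      ∀ e, D.Differs v e ↔ ∃ q ∈ p, e = q.1 ∨ e = q.2) ∨
    D.Degenerate v ∧ ∃ e, B.1 = {(e, false)} ∧ F = {e}
  | .inr e => ¬ D.Branch v ∧ ¬ D.Full v e

theorem classOf_eq_of_not_branch (hu : ¬ D.Branch u) (hv : ¬ D.Branch v)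
    (huv : ∀ e, D.Full u e ↔ D.Full v e) : D.classOf u = D.classOf v := by
  have hside : ∀ {w}, ¬ D.Branch w → {h | D.Side w h 0} = ∅ := fun hw =>
    Set.eq_empty_of_forall_notMem (side_zero_false hw)
  have hdiff : ∀ {w}, ¬ D.Branch w → {e | D.Differs w e} = ∅ := fun hw =>
    Set.eq_empty_of_forall_notMem fun _ he => hw he.1
  have hfull : {e | D.Full u e} = {e | D.Full v e} := Set.ext huv
  rw [classOf, classOf, type, type, hside hu, hside hv, hdiff hu, hdiff hv, hfull]

theorem Represents.classOf_eq_of_not_full (hD : D.Represents G) (hu : ¬ D.Branch u)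
    (hv : ¬ D.Branch v) (hue : ¬ D.Full u e) (hve : ¬ D.Full v e) :
    D.classOf u = D.classOf v := by
  refine classOf_eq_of_not_branch hu hv fun e' => ?_
  by_cases he : e' = e
  · exact iff_of_false (he ▸ hue) (he ▸ hve)
  · exact iff_of_true (hD.full_of_ne hu hue he) (hD.full_of_ne hv hve he)

theorem Represents.classOf_eq_of_isCode (hD : D.Represents G) {c : ClassCode E}
    (hu : D.IsCode u c) (hv : D.IsCode v c) : D.classOf u = D.classOf v := by
  rcases c with ⟨B, F, p⟩ | e
  · rcases hu with ⟨hbu, hBu, hFu, hpu⟩ | ⟨hdu, e, hB, hF⟩ <;>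
    rcases hv with ⟨hbv, hBv, hFv, hpv⟩ | ⟨hdv, e', hB', hF'⟩
    · exact Prod.ext (Prod.ext (Set.ext fun h => (hBu h).symm.trans (hBv h))
        (Set.ext fun e => (hFu e).symm.trans (hFv e)))
        (Set.ext fun e => (hpu e).trans (hpv e).symm)
    · exact absurd hbu (not_branch_of_code hB' hF' hBu hFu)
    · exact absurd hbv (not_branch_of_code hB hF hBv hFv)
    · exact classOf_eq_of_not_branch hdu.1 hdv.1 fun e => iff_of_true (hdu.2 e) (hdv.2 e)
  · exact hD.classOf_eq_of_not_full hu.1 hv.1 hu.2 hv.2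

theorem Represents.exists_differs_pair [Finite V] (hD : D.Represents G) (v : V) :
    ∃ p : Option (E × E), ∀ e, D.Differs v e ↔ ∃ q ∈ p, e = q.1 ∨ e = q.2 := by
  by_cases ha : ∃ a, D.Differs v a
  · obtain ⟨a, ha⟩ := ha
    by_cases hb : ∃ b, a ≠ b ∧ D.Differs v b
    · obtain ⟨b, hab, hb⟩ := hb
      refine ⟨some (a, b), fun e => ?_⟩
      simp only [Option.mem_some_iff, exists_eq_left']
      exact ⟨hD.differs_eq_or_eq hab ha hb, by rintro (rfl | rfl) <;> assumption⟩
    · push Not at hb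
      refine ⟨some (a, a), fun e => ?_⟩
      simp only [Option.mem_some_iff, exists_eq_left', or_self]
      exact ⟨fun he => not_not.1 fun hne => hb e (Ne.symm hne) he, by rintro rfl; exact ha⟩
  · push Not at ha
    exact ⟨none, fun e => iff_of_false (ha e) (by simp)⟩

theorem Represents.exists_isCode [Finite V] [Finite E] [Nonempty E] (hD : D.Represents G) (v : V) :
    ∃ c, D.IsCode v c := by
  classical
  have := Fintype.ofFinite E
  by_cases hb : D.Branch v
  · obtain ⟨p, hp⟩ := hD.exists_differs_pair v
    obtain ⟨h, hh⟩ := hb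
    exact ⟨.inl (⟨Finset.univ.filter fun h => D.Side v h 0,
      Finset.ne_empty_of_mem (a := h) (by simpa using hh)⟩,
      Finset.univ.filter (D.Full v), p), .inl ⟨⟨h, hh⟩, by simp, by simp, hp⟩⟩
  · by_cases hd : D.Degenerate v
    · obtain ⟨e⟩ := ‹Nonempty E›
      exact ⟨.inl (⟨{(e, false)}, Finset.singleton_ne_empty _⟩, {e}, none),
        .inr ⟨hd, e, rfl, rfl⟩⟩
    · obtain ⟨e, he⟩ : ∃ e, ¬ D.Full v e := by simpa [Degenerate, hb] using hd
      exact ⟨.inr e, hb, he⟩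

theorem Represents.classIndex_lt [Fintype V] [Fintype E] [Nonempty E] (hD : D.Represents G)
    (v : V) :
    classIndex D.classOf v < thinnessBound (Fintype.card E) := by
  classical
  choose code hcode using hD.exists_isCode
  rw [← card_classCode]
  exact classIndex_lt_card code
    (fun u v huv => hD.classOf_eq_of_isCode (hcode u) (huv ▸ hcode v)) v

end

/-! ### The mixed-thin representation of a path model -/

theorem Represents.adj_iff_meets (hD : D.Represents G) (hu : ¬ D.Degenerate u) (huv : u ≠ v) :
    G.Adj u v ↔ D.Meets u v :=
  (hD.adj_iff u v huv).trans (or_iff_left fun h => hu h.1)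

theorem Represents.adj_iff_meets_of_classOf_ne [LinearOrder V] (hD : D.Represents G)
    (huv : D.classOf u ≠ D.classOf v) : G.Adj u v ↔ D.Meets u v :=
  (hD.adj_iff u v fun h => huv (h ▸ rfl)).trans (or_iff_left fun h =>
    huv (classOf_eq_of_not_branch h.1.1 h.2.1.1 fun e => iff_of_true (h.1.2 e) (h.2.1.2 e)))

theorem Represents.adj_of_branch (hD : D.Represents G) (hu : D.Branch u)
    (huv : D.type u = D.type v) (hne : u ≠ v) : G.Adj u v :=
  have ⟨h, hh⟩ := hu
  (hD.adj_iff u v hne).2 (Or.inl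
    (meets_of_side (h := h) (Nat.succ_pos _) hh ((side_zero_iff huv h).1 hh)))

theorem Represents.adj_iff_of_degenerate (hD : D.Represents G) (hu : D.Degenerate u)
    (hv : D.Degenerate v) (hne : u ≠ v) : G.Adj u v ↔ D.tag u = D.tag v ∧ D.tag u ≠ 0 := by
  have hm : ¬ D.Meets u v := fun ⟨e, i, hi, hmem, _⟩ => hu.1 ((hu.2 e i hi).1 hmem)
  simp [hD.adj_iff u v hne, hm, hu, hv]

section Arrangement

variable [LinearOrder V] [Fintype E] [LinearOrder E] [Nonempty E]

/-- Sets that contain no end of an edge and are not full on `e` are intervals in `e`. The two runs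
of such an interval are monotone, in opposite directions, along its class. -/
theorem Represents.adj_between_of_not_full [Finite V] (hD : D.Represents G)
    (hv : ¬ D.Branch v) (hve : ¬ D.Full v e) (hu : D.classOf u = D.classOf v)
    (hw : D.classOf w = D.classOf v) (huv : D.key u ≤ D.key v) (hvw : D.key v ≤ D.key w)
    (huv' : u ≠ v) (hvw' : v ≠ w) (huw' : u ≠ w) (hadj : G.Adj u w) : G.Adj u v ∧ G.Adj v w := by
  have hnd : ∀ {x}, D.classOf x = D.classOf v → ¬ D.Branch x ∧ ¬ D.Full x e := fun hx =>
    ⟨mt (branch_iff (type_eq_of_classOf_eq hx)).1 hv,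
      mt (full_iff (type_eq_of_classOf_eq hx) e).1 hve⟩
  have hmeets : ∀ {x y}, D.classOf x = D.classOf v → D.classOf y = D.classOf v → x ≠ y →
      (G.Adj x y ↔ D.run x (e, false) + D.run y (e, true) < D.len e ∧
        D.run y (e, false) + D.run x (e, true) < D.len e) := fun hx hy hxy =>
    (hD.adj_iff_meets (fun hd => (hnd hx).2 (hd.2 e)) hxy).trans
      (hD.meets_iff_of_not_branch (hnd hx).1 (hnd hy).1 (hnd hx).2 (hnd hy).2)
  rw [hmeets hu hw huw'] at hadj
  rw [hmeets hu rfl huv', hmeets rfl hw hvw']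
  obtain ⟨h₁, h₂, hne, hmon⟩ := hD.exists_opposed_runs v
  obtain ⟨huv₁, huv₂⟩ := hmon u v hu rfl huv
  obtain ⟨hvw₁, hvw₂⟩ := hmon v w rfl hw hvw
  by_cases hc : (e, false) ≠ h₂ ∧ (e, true) ≠ h₁
  · have := huv₁ _ hc.1
    have := hvw₁ _ hc.1
    have := huv₂ _ hc.2
    have := hvw₂ _ hc.2
    omega
  · have hc₁ : (e, false) ≠ h₁ := by grind
    have hc₂ : (e, true) ≠ h₂ := by grind
    have := huv₂ _ hc₁
    have := hvw₂ _ hc₁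
    have := huv₁ _ hc₂
    have := hvw₁ _ hc₂
    omega

variable [Fintype V]

/-- The classes of a path model, sorted by their keys. -/
noncomputable def Represents.arrangement (hD : D.Represents G) :
    Arrangement V (Fin (thinnessBound (Fintype.card E))) (ℕ ×ₗ V) where
  cls v := ⟨classIndex D.classOf v, hD.classIndex_lt v⟩
  pos v := toLex (D.key v, v)
  pos_injective _ _ h := congrArg (fun p => (ofLex p).2) h

theorem Represents.cls_eq_iff (hD : D.Represents G) :
    hD.arrangement.cls u = hD.arrangement.cls v ↔ D.classOf u = D.classOf v :=
  Fin.ext_iff.trans classIndex_eq_iff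

theorem Represents.key_le_key_of_pos_le (hD : D.Represents G)
    (h : hD.arrangement.pos u ≤ hD.arrangement.pos v) : D.key u ≤ D.key v :=
  Prod.Lex.monotone_fst _ _ h

theorem Represents.opposed_run (hD : D.Represents G) (v : V) :
    hD.arrangement.Opposed (hD.arrangement.cls v) fun h u => D.run u h := by
  obtain ⟨h₁, h₂, hne, hmon⟩ := hD.exists_opposed_runs v
  exact ⟨h₁, h₂, hne, fun u w hu hw huw =>
    hmon u w (hD.cls_eq_iff.1 hu) (hD.cls_eq_iff.1 hw) (hD.key_le_key_of_pos_le huw)⟩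

theorem Represents.isProper (hD : D.Represents G) : hD.arrangement.IsProper G := by
  intro u v w hcuv hcvw huv hvw hadj
  have hu : D.classOf u = D.classOf v := hD.cls_eq_iff.1 hcuv
  have hw : D.classOf w = D.classOf v := (hD.cls_eq_iff.1 hcvw).symm
  have hkuv := hD.key_le_key_of_pos_le huv.le
  have hkvw := hD.key_le_key_of_pos_le hvw.le
  have huv' : u ≠ v := fun h => huv.ne (congrArg _ h)
  have hvw' : v ≠ w := fun h => hvw.ne (congrArg _ h)
  have htu := type_eq_of_classOf_eq hu
  have htw := type_eq_of_classOf_eq hw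
  by_cases hb : D.Branch v
  · exact ⟨(hD.adj_of_branch hb htu.symm huv'.symm).symm, hD.adj_of_branch hb htw.symm hvw'⟩
  by_cases hd : D.Degenerate v
  · have hdu := (degenerate_iff htu).2 hd
    have hdw := (degenerate_iff htw).2 hd
    rw [hD.adj_iff_of_degenerate hdu hdw hadj.ne] at hadj
    rw [hD.adj_iff_of_degenerate hdu hd huv', hD.adj_iff_of_degenerate hd hdw hvw']
    simp only [key, if_pos hd, if_pos hdu, if_pos hdw] at hkuv hkvw
    omega
  · obtain ⟨e, he⟩ : ∃ e, ¬ D.Full v e := by simpa [Degenerate, hb] using hd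
    exact hD.adj_between_of_not_full hb he hu hw hkuv hkvw huv' hvw' hadj.ne hadj

variable {i j : Fin (thinnessBound (Fintype.card E))}

theorem Represents.type_eq_of_cls_eq (hD : D.Represents G)
    (h : hD.arrangement.cls u = hD.arrangement.cls v) : D.type u = D.type v :=
  type_eq_of_classOf_eq (hD.cls_eq_iff.1 h)

theorem Represents.adj_iff_meets_of_cls_ne (hD : D.Represents G)
    (h : hD.arrangement.cls u ≠ hD.arrangement.cls v) : G.Adj u v ↔ D.Meets u v :=
  hD.adj_iff_meets_of_classOf_ne (mt hD.cls_eq_iff.2 h)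

variable (hD : D.Represents G) (hcls : hD.arrangement.cls u ≠ hD.arrangement.cls v)

include hcls

theorem Represents.compatible_of_branch (hu : D.Branch u) (hv : D.Branch v) :
    hD.arrangement.Compatible G False (hD.arrangement.cls u) (hD.arrangement.cls v) ∨
      hD.arrangement.Compatible G True (hD.arrangement.cls u) (hD.arrangement.cls v) := by
  by_cases hno : ∀ h, ¬ (D.Side u h 0 ∧ D.Side v h 0)
  · have hv' := (hD.opposed_run v).comp (Equiv.prodCongr (Equiv.refl E) Equiv.boolNot)
    refine Arrangement.compatible_of_opposed (c := fun h => D.len h.1) (hD.opposed_run u) hv'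
      fun u' v' hu' hv' => ?_
    have htu := hD.type_eq_of_cls_eq hu'
    have htv := hD.type_eq_of_cls_eq hv'
    rw [hD.adj_iff_meets_of_cls_ne (hu' ▸ hv' ▸ hcls), hD.not_meets_iff_of_branch
      ((branch_iff htu).2 hu) ((branch_iff htv).2 hv) fun h =>
        mt (and_congr (side_zero_iff htu h) (side_zero_iff htv h)).1 (hno h)]
    rfl
  · push Not at hno
    obtain ⟨h, hhu, hhv⟩ := hno
    exact Or.inl (Arrangement.compatible_of_forall_adj _ fun u' v' hu' hv' =>
      (hD.adj_iff_meets_of_cls_ne (hu' ▸ hv' ▸ hcls)).2 (meets_of_side (h := h) (Nat.succ_pos _)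
        ((side_zero_iff (hD.type_eq_of_cls_eq hu') h).2 hhu)
        ((side_zero_iff (hD.type_eq_of_cls_eq hv') h).2 hhv)))

theorem Represents.compatible_of_branch_left (hu : D.Branch u) (hv : ¬ D.Branch v) :
    hD.arrangement.Compatible G False (hD.arrangement.cls u) (hD.arrangement.cls v) ∨
      hD.arrangement.Compatible G True (hD.arrangement.cls u) (hD.arrangement.cls v) := by
  refine Arrangement.compatible_of_opposed (c := fun h => D.len h.1) (hD.opposed_run u)
    ((hD.opposed_run v).sub fun h => D.len h.1) fun u' v' hu' hv' => ?_
  rw [hD.adj_iff_meets_of_cls_ne (hu' ▸ hv' ▸ hcls), hD.not_meets_iff_of_branch_of_not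
    ((branch_iff (hD.type_eq_of_cls_eq hu')).2 hu)
    (mt (branch_iff (hD.type_eq_of_cls_eq hv')).1 hv)]
  refine forall_congr' fun h => ?_
  have := D.run_le v' h
  omega

theorem Represents.compatible_of_branch_right (hu : ¬ D.Branch u) (hv : D.Branch v) :
    hD.arrangement.Compatible G False (hD.arrangement.cls u) (hD.arrangement.cls v) ∨
      hD.arrangement.Compatible G True (hD.arrangement.cls u) (hD.arrangement.cls v) := by
  refine Arrangement.compatible_of_opposed (c := fun h => D.len h.1)
    ((hD.opposed_run u).sub fun h => D.len h.1) (hD.opposed_run v) fun u' v' hu' hv' => ?_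
  rw [G.adj_comm, hD.adj_iff_meets_of_cls_ne (hu' ▸ hv' ▸ hcls.symm),
    hD.not_meets_iff_of_branch_of_not ((branch_iff (hD.type_eq_of_cls_eq hv')).2 hv)
      (mt (branch_iff (hD.type_eq_of_cls_eq hu')).1 hu)]
  refine forall_congr' fun h => ?_
  have := D.run_le u' h
  omega

theorem Represents.not_adj_of_not_branch (hu : ¬ D.Branch u) (hv : ¬ D.Branch v) :
    ¬ G.Adj u v := by
  rw [hD.adj_iff_meets_of_cls_ne hcls]
  rintro ⟨e, i, hi, hui, hvi⟩
  exact hcls (hD.cls_eq_iff.2 (hD.classOf_eq_of_not_full (e := e) hu hv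
    (fun hf => hu ((hf i hi).1 hui)) fun hf => hv ((hf i hi).1 hvi)))

omit hcls

theorem Represents.compatible (hij : i ≠ j) :
    hD.arrangement.Compatible G False i j ∨ hD.arrangement.Compatible G True i j := by
  by_cases hne : (∃ u, hD.arrangement.cls u = i) ∧ ∃ v, hD.arrangement.cls v = j
  · obtain ⟨⟨u, rfl⟩, v, rfl⟩ := hne
    by_cases hu : D.Branch u <;> by_cases hv : D.Branch v
    · exact hD.compatible_of_branch hij hu hv
    · exact hD.compatible_of_branch_left hij hu hv
    · exact hD.compatible_of_branch_right hij hu hv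
    · exact Or.inl (Arrangement.compatible_of_forall_not_adj _ fun u' v' hu' hv' =>
        hD.not_adj_of_not_branch (hu' ▸ hv' ▸ hij)
          (mt (branch_iff (hD.type_eq_of_cls_eq hu')).1 hu)
          (mt (branch_iff (hD.type_eq_of_cls_eq hv')).1 hv))
  · exact Or.inl (Arrangement.compatible_of_forall_adj _ fun u v hu hv =>
      absurd ⟨⟨u, hu⟩, v, hv⟩ hne)

end Arrangement

end PathModel

/-! ### The path model of a representation -/

namespace PathModel

variable {V E : Type*} {D : PathModel V E} {u v : V} {e : E} {h : E × Bool}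

theorem not_full_of_run_lt (hlt : D.run v h < D.run u h) : ¬ D.Full v h.1 := fun hf =>
  (hlt.trans_le (run_le u h)).ne (hf.run_eq h.2)

theorem side_zero_of_run_pos (hv : D.Branch v) (h0 : 0 < D.run v h) : D.Side v h 0 :=
  ((le_run_iff h0 (run_le v h)).1 le_rfl 0 (Nat.zero_le _)).2 hv

theorem not_side_run_succ (h0 : D.Side v h 0) (hf : ¬ D.Full v h.1) :
    ¬ D.Side v h (D.run v h + 1) := by
  have hv : D.Branch v := ⟨h, h0⟩
  have hside : ∀ {j}, j ≤ D.run v h → D.Side v h j := fun {j} hj => by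
    rcases Nat.eq_zero_or_pos j with rfl | hj0
    · exact h0
    · exact side_of_le_run hv hj0 hj
  intro hs
  rcases (run_le v h).lt_or_eq with hlt | heq
  · refine (Nat.lt_succ_self (D.run v h)).not_ge
      ((le_run_iff (Nat.succ_pos _) hlt).2 fun j hj => ?_)
    rcases hj.lt_or_eq with hj | rfl
    · exact iff_of_true (hside (Nat.lt_succ_iff.1 hj)) hv
    · exact iff_of_true hs hv
  · refine hf fun i hi => iff_of_true ((side_coord hi).1 ?_) hv
    have hc := coord_lt hi
    rcases (Nat.lt_succ_iff.1 hc).lt_or_eq with hc | hc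
    · exact hside (by omega)
    · rwa [hc, ← heq]

theorem full_of_len_le_run_add_run {s : Bool} (hv : D.Branch v) (h0 : 0 < D.run v (e, s))
    (h0' : 0 < D.run v (e, !s)) (hle : D.len e ≤ D.run v (e, s) + D.run v (e, !s)) :
    D.Full v e := by
  refine fun i hi => iff_of_true ((side_coord (h := (e, s)) hi).1 ?_) hv
  have hc : D.coord (e, s) i < D.len e + 2 := coord_lt hi
  by_cases hr : D.coord (e, s) i ≤ D.run v (e, s)
  · exact ((le_run_iff h0 (run_le v _)).1 le_rfl _ hr).2 hv
  · rw [← side_not hc]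
    exact ((le_run_iff h0' (run_le v _)).1 le_rfl _ (by omega)).2 hv

end PathModel

section Subdivision

variable {α β : Type*} {H : Graph α β} (T : H.Subdivision) {b c : β} {i j k l : ℕ}

theorem pathVertex_eq_inr_iff :
    T.pathVertex b i = Sum.inr (c, l) ↔ b = c ∧ i = l ∧ 1 ≤ l ∧ l ≤ T.len b := by
  unfold Graph.Subdivision.pathVertex
  grind

theorem pathVertex_of_le_len (h1 : 1 ≤ i) (h2 : i ≤ T.len b) :
    T.pathVertex b i = Sum.inr (b, i) :=
  (pathVertex_eq_inr_iff T).2 ⟨rfl, rfl, h1, h2⟩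

theorem exists_eq_inr_of_trapped {Y : Set (α ⊕ β × ℕ)} (hY : T.graph.IsConnectedSet Y)
    (hji : j < i) (hik : i < k) (hk : k ≤ T.len b + 1) (hjY : T.pathVertex b j ∉ Y)
    (hkY : T.pathVertex b k ∉ Y) (hiY : T.pathVertex b i ∈ Y) :
    ∀ y ∈ Y, ∃ l, j < l ∧ l < k ∧ y = Sum.inr (b, l) := by
  intro y hy
  induction hY.2 _ hiY y hy with
  | refl => exact ⟨i, hji, hik, pathVertex_of_le_len T (by omega) (by omega)⟩
  | @tail a c _ hac ih =>
    obtain ⟨l, hjl, hlk, rfl⟩ := ih hac.1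
    obtain ⟨-, hc, f, -, -, hlink⟩ := hac
    rcases hlink with ⟨hf, rfl⟩ | ⟨rfl, hf⟩ <;>
    obtain ⟨hfb, hfl, -⟩ := (pathVertex_eq_inr_iff T).1 hf.symm <;>
    rw [hfb] at hc ⊢
    · have hne : f.2 + 1 ≠ k := fun hk => hkY (hk ▸ hc)
      exact ⟨f.2 + 1, by omega, by omega, pathVertex_of_le_len T (by omega) (by omega)⟩
    · have hne : f.2 ≠ j := fun hj => hjY (hj ▸ hc)
      exact ⟨f.2, by omega, by omega, pathVertex_of_le_len T (by omega) (by omega)⟩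

theorem eq_singleton_of_forall_pathVertex_ne {Y : Set (α ⊕ β × ℕ)}
    (hY : T.graph.IsConnectedSet Y) {x : α ⊕ β × ℕ} (hx : x ∈ Y)
    (hiso : ∀ b ∈ H.edgeSet, ∀ i < T.len b + 2, T.pathVertex b i ≠ x) : Y = {x} := by
  refine Set.eq_singleton_iff_unique_mem.2 ⟨hx, fun y hy => ?_⟩
  rcases (hY.2 x hx y hy).cases_head with rfl | ⟨c, ⟨-, -, f, hf, hfl, ⟨rfl, -⟩ | ⟨-, rfl⟩⟩, -⟩
  · rfl
  · exact absurd rfl (hiso _ hf _ (by omega))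
  · exact absurd rfl (hiso _ hf _ (by omega))

theorem exists_eq_inl_of_forall_pathVertex_ne {x : α ⊕ β × ℕ} (hx : x ∈ T.graph.vertexSet)
    (hiso : ∀ b ∈ H.edgeSet, ∀ i < T.len b + 2, T.pathVertex b i ≠ x) : ∃ y, x = Sum.inl y := by
  rcases hx with ⟨y, -, rfl⟩ | ⟨b, hb, i, h1, h2, rfl⟩
  · exact ⟨y, rfl⟩
  · exact absurd (pathVertex_of_le_len T h1 h2) (hiso b hb i (by omega))

end Subdivision

namespace HRepresentation

open PathModel

variable {α β V E : Type*} {H : Graph α β} {G : SimpleGraph V} (S : HRepresentation H G)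
  (ε : E → β) (g : α → ℕ)

/-- The path model of a representation, for an enumeration `ε` of the edges of `H` and a numbering
`g` of its vertices. The tag of the set of `v` is `g x + 1` if the set consists of a single vertex
`x` of `H`; other sets need no meaningful tag. -/
noncomputable def model : PathModel V E where
  len e := S.framework.len (ε e)
  mem v e i := S.framework.pathVertex (ε e) i ∈ S.rep v
  tag v := ∑ᶠ x ∈ {x | Sum.inl x ∈ S.rep v}, (g x + 1)

variable {S ε g} {u v : V} {e : E} {h h' : E × Bool} {i j k : ℕ}

theorem exists_eq_coord_of_trapped {Y : Set (α ⊕ β × ℕ)}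
    (hY : S.framework.graph.IsConnectedSet Y) (hji : j < i) (hik : i < k)
    (hk : k ≤ (S.model ε g).len h.1 + 1)
    (hjY : S.framework.pathVertex (ε h.1) ((S.model ε g).coord h j) ∉ Y)
    (hkY : S.framework.pathVertex (ε h.1) ((S.model ε g).coord h k) ∉ Y)
    (hiY : S.framework.pathVertex (ε h.1) ((S.model ε g).coord h i) ∈ Y) :
    ∀ y ∈ Y, ∃ l, j < l ∧ l < k ∧ y = Sum.inr (ε h.1, (S.model ε g).coord h l) := by
  obtain ⟨e, _ | _⟩ := h
  · exact exists_eq_inr_of_trapped S.framework hY hji hik hk hjY hkY hiY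
  · have hlen : (S.model ε g).len e = S.framework.len (ε e) := rfl
    simp only [coord, if_true] at hk hjY hkY hiY ⊢
    intro y hy
    obtain ⟨l, hl₁, hl₂, rfl⟩ := exists_eq_inr_of_trapped S.framework hY (by omega) (by omega)
      (by omega) hkY hjY hiY y hy
    exact ⟨(S.model ε g).len e + 1 - l, by omega, by omega, by congr 2; omega⟩

theorem model_prefix_or_suffix (hv : (S.model ε g).Branch v)
    (hi : (S.model ε g).mem v e i) :
    (∀ j ≤ i, (S.model ε g).mem v e j) ∨
      ∀ j, i ≤ j → j < (S.model ε g).len e + 2 → (S.model ε g).mem v e j := by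
  by_contra! hc
  obtain ⟨⟨j, hji, hj⟩, k, hik, hkl, hk⟩ := hc
  have hji' : j ≠ i := fun h => hj (h ▸ hi)
  have hik' : i ≠ k := fun h => hk (h ▸ hi)
  obtain ⟨⟨e', s⟩, hs⟩ := hv
  obtain ⟨l, -, -, hl⟩ := exists_eq_inr_of_trapped S.framework (S.connected v)
    (by omega : j < i) (by omega : i < k) (Nat.lt_succ_iff.1 hkl) hj hk hi _ hs
  have hlen : (S.model ε g).len e' = S.framework.len (ε e') := rfl
  obtain ⟨-, hl, hl1, hl2⟩ := (pathVertex_eq_inr_iff _).1 hl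
  cases s <;> simp only [coord] at hl <;> grind

theorem trapped_of_not_branch (hv : ¬ (S.model ε g).Branch v)
    (hi : i < (S.model ε g).len e + 2) (hmem : (S.model ε g).mem v e i) :
    ∀ y ∈ S.rep v, ∃ l, 0 < l ∧ l < (S.model ε g).len e + 1 ∧ y = Sum.inr (ε e, l) := by
  have h₁ := coord_pos_of_not_branch hv hi hmem false
  have h₂ := coord_pos_of_not_branch hv hi hmem true
  simp only [coord, Bool.false_eq_true, if_false, if_true] at h₁ h₂
  exact exists_eq_inr_of_trapped S.framework (S.connected v) h₁ (by omega) le_rfl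
    (side_zero_false hv (e, false)) (side_zero_false hv (e, true)) hmem

theorem model_edge_unique (hε : Function.Injective ε) {e' : E} {i' : ℕ}
    (hv : ¬ (S.model ε g).Branch v) (hi : i < (S.model ε g).len e + 2)
    (hmem : (S.model ε g).mem v e i) (hmem' : (S.model ε g).mem v e' i') : e = e' := by
  obtain ⟨l, -, -, hl⟩ := trapped_of_not_branch hv hi hmem _ hmem'
  exact hε ((pathVertex_eq_inr_iff _).1 hl).1.symm

theorem model_convex (hv : ¬ (S.model ε g).Branch v) (hij : i ≤ j) (hjk : j ≤ k)
    (hk : k < (S.model ε g).len e + 2) (hi : (S.model ε g).mem v e i)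
    (hkv : (S.model ε g).mem v e k) : (S.model ε g).mem v e j := by
  by_contra hj
  have hij' : i ≠ j := fun h => hj (h ▸ hi)
  have : j ≠ k := fun h => hj (h ▸ hkv)
  have hi₁ := coord_pos_of_not_branch hv (by omega) hi false
  obtain ⟨l, -, hlj, hl⟩ := exists_eq_inr_of_trapped S.framework (S.connected v) hi₁
    (lt_of_le_of_ne hij hij') (hjk.trans (Nat.lt_succ_iff.1 hk)) (side_zero_false hv (e, false)) hj
    hi _ hkv
  obtain ⟨-, hkl, -⟩ := (pathVertex_eq_inr_iff _).1 hl
  omega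

theorem trapped_of_run_lt_of_branch (hS : S.IsNonCrossing)
    (huv : (S.model ε g).type u = (S.model ε g).type v) (hu : (S.model ε g).Branch u)
    (hlt : (S.model ε g).run v h < (S.model ε g).run u h) :
    (S.rep u \ S.rep v).Nonempty ∧ ∀ y ∈ S.rep u \ S.rep v, ∃ l,
      0 < l ∧ l ≤ (S.model ε g).run u h ∧ y = Sum.inr (ε h.1, (S.model ε g).coord h l) := by
  have hle := run_le (D := S.model ε g) u h
  have hnv := not_full_of_run_lt hlt
  have hnu := mt (full_iff huv h.1).1 hnv
  have hu₀ : (S.model ε g).Side u h 0 := side_zero_of_run_pos hu (by omega)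
  have hv₀ := (side_zero_iff huv h).1 hu₀
  have hmem : S.framework.pathVertex (ε h.1)
      ((S.model ε g).coord h ((S.model ε g).run v h + 1)) ∈ S.rep u \ S.rep v :=
    ⟨side_of_le_run hu (by omega) hlt, not_side_run_succ hv₀ hnv⟩
  refine ⟨⟨_, hmem⟩, fun y hy => ?_⟩
  obtain ⟨l, hl, hlu, rfl⟩ := exists_eq_coord_of_trapped (j := 0)
    (k := (S.model ε g).run u h + 1) (hS u v) (by omega) (by omega) (by omega)
    (fun hm => hm.2 hv₀) (fun hm => not_side_run_succ hu₀ hnu hm.1) hmem y hy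
  exact ⟨l, hl, by omega, rfl⟩

theorem trapped_of_run_lt_of_not_branch (hS : S.IsNonCrossing)
    (hu : ¬ (S.model ε g).Branch u) (hv : ¬ (S.model ε g).Branch v)
    (hlt : (S.model ε g).run v h < (S.model ε g).run u h) (hi : i < (S.model ε g).len h.1 + 2)
    (hmem : (S.model ε g).mem u h.1 i) :
    (S.rep v \ S.rep u).Nonempty ∧ ∀ y ∈ S.rep v \ S.rep u, ∃ l,
      0 < l ∧ l < (S.model ε g).coord h i ∧ y = Sum.inr (ε h.1, (S.model ε g).coord h l) := by
  have hle := run_le (D := S.model ε g) u h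
  have hi' : (S.model ε g).run u h < (S.model ε g).coord h i := run_lt_coord hu hi hmem h.2
  have hrun : S.framework.pathVertex (ε h.1)
      ((S.model ε g).coord h ((S.model ε g).run v h + 1)) ∈ S.rep v \ S.rep u :=
    ⟨side_run_succ hv (by omega), fun hm =>
      hu (((le_run_iff (Nat.succ_pos _) (by omega)).1 hlt _ le_rfl).1 hm)⟩
  exact ⟨⟨_, hrun⟩, exists_eq_coord_of_trapped (hS v u) (Nat.succ_pos _) (by omega)
    (Nat.lt_succ_iff.1 (coord_lt hi)) (fun hm => side_zero_false hv h hm.1)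
    (fun hm => hm.2 ((side_coord hi).2 hmem)) hrun⟩

theorem model_single_of_branch (hS : S.IsNonCrossing) (hε : Function.Injective ε)
    (huv : (S.model ε g).type u = (S.model ε g).type v) (hu : (S.model ε g).Branch u)
    (hh : (S.model ε g).run v h < (S.model ε g).run u h)
    (hh' : (S.model ε g).run v h' < (S.model ε g).run u h') : h = h' := by
  obtain ⟨⟨y, hy⟩, hsub⟩ := trapped_of_run_lt_of_branch hS huv hu hh
  obtain ⟨l, hl, hlu, rfl⟩ := hsub y hy
  obtain ⟨l', hl', hlu', heq⟩ := (trapped_of_run_lt_of_branch hS huv hu hh').2 _ hy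
  obtain ⟨e, s⟩ := h
  obtain ⟨e', s'⟩ := h'
  obtain ⟨hee, hc⟩ := Prod.ext_iff.1 (Sum.inr_injective heq)
  obtain rfl : e = e' := hε hee
  by_contra hne
  obtain rfl : s' = !s := Bool.eq_not_iff.2 fun hs => hne (hs ▸ rfl)
  have hle := run_le (D := S.model ε g) u (e, s)
  have hle' := run_le (D := S.model ε g) u (e, !s)
  refine mt (full_iff huv e).1 (not_full_of_run_lt hh)
    (full_of_len_le_run_add_run (s := s) hu (by omega) (by omega) ?_)
  cases s <;> simp [coord] at * <;> omega

theorem model_single_of_not_branch (hS : S.IsNonCrossing) (hε : Function.Injective ε)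
    (huv : (S.model ε g).type u = (S.model ε g).type v) (hu : ¬ (S.model ε g).Branch u)
    (hh : (S.model ε g).run v h < (S.model ε g).run u h)
    (hh' : (S.model ε g).run v h' < (S.model ε g).run u h') : h = h' := by
  have hv : ¬ (S.model ε g).Branch v := mt (branch_iff huv).2 hu
  obtain ⟨i, hi, hmem⟩ :=
    exists_mem_of_not_full hu (mt (full_iff huv h.1).1 (not_full_of_run_lt hh))
  obtain ⟨i', hi', hmem'⟩ :=
    exists_mem_of_not_full hu (mt (full_iff huv h'.1).1 (not_full_of_run_lt hh'))
  obtain ⟨e, s⟩ := h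
  obtain ⟨e', s'⟩ := h'
  obtain rfl : e = e' := model_edge_unique hε hu hi hmem hmem'
  obtain ⟨⟨y, hy⟩, hsub⟩ := trapped_of_run_lt_of_not_branch hS hu hv hh hi hmem
  obtain ⟨l, hl, hli, rfl⟩ := hsub y hy
  obtain ⟨l', hl', hli', heq⟩ :=
    (trapped_of_run_lt_of_not_branch hS hu hv hh' hi hmem).2 _ hy
  have hc := congrArg Prod.snd (Sum.inr_injective heq)
  by_contra hne
  obtain rfl : s' = !s := Bool.eq_not_iff.2 fun hs => hne (hs ▸ rfl)
  cases s <;> simp [coord] at * <;> omega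

theorem degenerate_iff_forall_not_mem : (S.model ε g).Degenerate v ↔
    ∀ e, ∀ i < (S.model ε g).len e + 2, ¬ (S.model ε g).mem v e i := by
  constructor
  · exact fun hv e i hi hm => hv.1 ((hv.2 e i hi).1 hm)
  · intro hm
    have hb : ¬ (S.model ε g).Branch v := fun ⟨h, hh⟩ => hm h.1 _ (coord_lt (Nat.succ_pos _)) hh
    exact ⟨hb, fun e i hi => iff_of_false (hm e i hi) hb⟩

theorem rep_eq_singleton_of_degenerate (hε : Set.range ε = H.edgeSet)
    (hv : (S.model ε g).Degenerate v) {x : α ⊕ β × ℕ} (hx : x ∈ S.rep v) :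
    ∃ y, x = Sum.inl y ∧ S.rep v = {Sum.inl y} := by
  have hiso : ∀ b ∈ H.edgeSet, ∀ i < S.framework.len b + 2, S.framework.pathVertex b i ≠ x := by
    rw [← hε]
    rintro _ ⟨e, rfl⟩ i hi rfl
    exact degenerate_iff_forall_not_mem.1 hv e i hi hx
  obtain ⟨y, rfl⟩ := exists_eq_inl_of_forall_pathVertex_ne S.framework ((S.connected v).1 hx) hiso
  exact ⟨y, rfl, eq_singleton_of_forall_pathVertex_ne S.framework (S.connected v) hx hiso⟩

theorem degenerate_of_not_meets (hε : Set.range ε = H.edgeSet) (huv : ¬ (S.model ε g).Meets u v)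
    {x : α ⊕ β × ℕ} (hu : x ∈ S.rep u) (hv : x ∈ S.rep v) : (S.model ε g).Degenerate u := by
  have hx := eq_singleton_of_forall_pathVertex_ne S.framework (S.connected u) hu
    fun b hb i hi h => by
      obtain ⟨e, rfl⟩ := hε ▸ hb
      exact huv ⟨e, i, hi, h.symm.subst hu, h.symm.subst hv⟩
  refine degenerate_iff_forall_not_mem.2 fun e i hi hm => huv ⟨e, i, hi, hm, ?_⟩
  have hm' : S.framework.pathVertex (ε e) i ∈ S.rep u := hm
  rw [hx, Set.mem_singleton_iff] at hm'
  exact hm'.symm.subst hv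

theorem model_tag_of_rep_eq {x : α} (hv : S.rep v = {Sum.inl x}) :
    (S.model ε g).tag v = g x + 1 := by
  simp [model, hv]

theorem model_adj_iff (hε : Set.range ε = H.edgeSet)
    (hg : Set.InjOn g {x | ∃ v, S.rep v = {Sum.inl x}}) (huv : u ≠ v) :
    G.Adj u v ↔ (S.model ε g).Meets u v ∨ (S.model ε g).Degenerate u ∧
      (S.model ε g).Degenerate v ∧ (S.model ε g).tag u = (S.model ε g).tag v ∧
      (S.model ε g).tag u ≠ 0 := by
  rw [S.adj_iff u v huv]
  constructor
  · rintro ⟨x, hxu, hxv⟩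
    refine or_iff_not_imp_left.2 fun hm => ?_
    have hu := degenerate_of_not_meets hε hm hxu hxv
    have hv := degenerate_of_not_meets hε (fun ⟨e, i, hi, h₁, h₂⟩ => hm ⟨e, i, hi, h₂, h₁⟩) hxv hxu
    obtain ⟨y, rfl, hy⟩ := rep_eq_singleton_of_degenerate hε hu hxu
    obtain ⟨z, hyz, hz⟩ := rep_eq_singleton_of_degenerate hε hv hxv
    obtain rfl := Sum.inl_injective hyz
    rw [model_tag_of_rep_eq hy, model_tag_of_rep_eq hz]
    exact ⟨hu, hv, rfl, Nat.succ_ne_zero _⟩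
  · rintro (⟨e, i, -, hu, hv⟩ | ⟨hu, hv, heq, h0⟩)
    · exact ⟨_, hu, hv⟩
    · have hne : ∀ {w}, (S.model ε g).Degenerate w → (S.model ε g).tag w ≠ 0 →
          ∃ y, S.rep w = {Sum.inl y} := fun {w} hw hw0 => by
        obtain ⟨x, hx⟩ : (S.rep w).Nonempty := Set.nonempty_iff_ne_empty.2 fun he =>
          hw0 (by simp [model, he])
        exact (rep_eq_singleton_of_degenerate hε hw hx).imp fun y hy => hy.2
      obtain ⟨y, hy⟩ := hne hu h0
      obtain ⟨z, hz⟩ := hne hv (heq ▸ h0)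
      rw [model_tag_of_rep_eq hy, model_tag_of_rep_eq hz, add_left_inj] at heq
      rw [hy, hz, hg ⟨u, hy⟩ ⟨v, hz⟩ heq, Set.inter_self]
      exact Set.singleton_nonempty _

theorem model_represents (hS : S.IsNonCrossing) (hε : Function.Injective ε)
    (hrange : Set.range ε = H.edgeSet) (hg : Set.InjOn g {x | ∃ v, S.rep v = {Sum.inl x}}) :
    (S.model ε g).Represents G where
  adj_iff _ _ huv := model_adj_iff hrange hg huv
  prefix_or_suffix _ _ _ hv _ hm := model_prefix_or_suffix hv hm
  edge_unique _ _ _ _ _ hv hi _ hm hm' := model_edge_unique hε hv hi hm hm'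
  convex _ _ _ _ _ hv hij hjk hk hi hk' := model_convex hv hij hjk hk hi hk'
  single u _ _ _ huv h h' := by
    by_cases hu : (S.model ε g).Branch u
    · exact model_single_of_branch hS hε huv hu h h'
    · exact model_single_of_not_branch hS hε huv hu h h'

end HRepresentation

/-! ### The bound -/

theorem exists_properMixedThinRep {α β V : Type*} [Finite V] {H : Graph α β} {G : SimpleGraph V}
    (hH : 0 < H.size) (hG : IsNonCrossingHGraph H G) :
    Nonempty (ProperMixedThinRep G (thinnessBound H.size)) := by
  classical
  obtain ⟨S, hS⟩ := hG
  let := Fintype.ofFinite V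
  let : LinearOrder V := linearOrderOfSTO WellOrderingRel
  let : Fintype H.edgeSet := (Set.finite_of_ncard_pos hH).fintype
  let : LinearOrder H.edgeSet := linearOrderOfSTO WellOrderingRel
  have hcard : Fintype.card H.edgeSet = H.size := by rw [← Nat.card_eq_fintype_card]; rfl
  have : Nonempty H.edgeSet := Fintype.card_pos_iff.1 (hcard ▸ hH)
  have hfinite : {x | ∃ v, S.rep v = {Sum.inl x}}.Finite :=
    Set.Finite.of_finite_image (f := fun x => ({Sum.inl x} : Set (α ⊕ β × ℕ)))
      ((Set.finite_range S.rep).subset (by rintro _ ⟨x, ⟨v, hv⟩, rfl⟩; exact ⟨v, hv⟩))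
      fun x _ y _ h => Sum.inl_injective (Set.singleton_injective h)
  obtain ⟨g, hg⟩ := Set.countable_iff_exists_injOn.1 hfinite.countable
  have hD := S.model_represents hS (ε := ((↑) : H.edgeSet → β)) Subtype.val_injective
    Subtype.range_coe hg
  exact ⟨hcard ▸ Arrangement.mixedThinRep hD.isProper fun _ _ hij => hD.compatible hij⟩

namespace RAM

/-! ### A calculus of polynomial time computations -/

/-- The program `p`, started in the state `s`, halts in the state `s'` after at most `B` steps. -/
def Runs (inp : List ℕ) (p : Prog) (s s' : State) (B : ℕ) : Prop := ∃ T ≤ B, Exec inp p s s' T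

namespace Runs

variable {inp : List ℕ} {p q : Prog} {s s' s'' : State} {B B' : ℕ} {e : Expr}

theorem mono (h : Runs inp p s s' B) (hB : B ≤ B') : Runs inp p s s' B' := by
  obtain ⟨T, hT, hp⟩ := h
  exact ⟨T, hT.trans hB, hp⟩

theorem seq (hp : Runs inp p s s' B) (hq : Runs inp q s' s'' B') :
    Runs inp (.seq p q) s s'' (B + B') := by
  obtain ⟨T, hT, hp⟩ := hp
  obtain ⟨T', hT', hq⟩ := hq
  exact ⟨T + T', Nat.add_le_add hT hT', .seq hp hq⟩

theorem ite_true (he : e.eval inp s ≠ 0) (hp : Runs inp p s s' B) :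
    Runs inp (.ite e p q) s s' (B + e.cost + 1) := by
  obtain ⟨T, hT, hp⟩ := hp
  exact ⟨_, by gcongr, .ite_true he hp⟩

theorem ite_false (he : e.eval inp s = 0) (hq : Runs inp q s s' B) :
    Runs inp (.ite e p q) s s' (B + e.cost + 1) := by
  obtain ⟨T, hT, hq⟩ := hq
  exact ⟨_, by gcongr, .ite_false he hq⟩

theorem loop_true (he : e.eval inp s ≠ 0) (hp : Runs inp p s s' B)
    (hw : Runs inp (.loop e p) s' s'' B') :
    Runs inp (.loop e p) s s'' (B + B' + e.cost + 1) := by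
  obtain ⟨T, hT, hp⟩ := hp
  obtain ⟨T', hT', hw⟩ := hw
  exact ⟨_, by gcongr, .loop_true he hp hw⟩

theorem loop_false (he : e.eval inp s = 0) : Runs inp (.loop e p) s s (e.cost + 1) :=
  ⟨_, le_rfl, .loop_false he⟩

theorem emit (e : Expr) (s : State) :
    Runs inp (.emit e) s ⟨s.reg, s.arr, s.out ++ [e.eval inp s]⟩ (e.cost + 1) :=
  ⟨_, le_rfl, .emit e s⟩

/-- `inv j` holds before round `j`. -/
theorem exists_loop (inv : ℕ → State → Prop) {b : ℕ}
    (he : ∀ j s, inv j s → e.eval inp s = b - j)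
    (hstep : ∀ j < b, ∀ s, inv j s → ∃ s', Runs inp p s s' B ∧ inv (j + 1) s')
    (h₀ : inv 0 s) :
    ∃ s', Runs inp (.loop e p) s s' ((b + 1) * (B + e.cost + 1)) ∧ inv b s' := by
  suffices h : ∀ k j s, j + k = b → inv j s →
      ∃ s', Runs inp (.loop e p) s s' ((k + 1) * (B + e.cost + 1)) ∧ inv b s' from
    h b 0 s (Nat.zero_add b) h₀
  intro k
  induction k with
  | zero =>
    rintro j s rfl hj
    exact ⟨s, (loop_false (by simp [he _ s hj])).mono (by omega), hj⟩
  | succ k ih =>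
    intro j s hjk hj
    obtain ⟨s', hs', hj'⟩ := hstep j (by omega) s hj
    obtain ⟨s'', hs'', hb⟩ := ih (j + 1) s' (by omega) hj'
    refine ⟨s'', (loop_true (by rw [he j s hj]; omega) hs' hs'').mono (le_of_eq ?_), hb⟩
    ring

end Runs

/-- The state `s` with the `c`-th cell of the array `0`, which serves as a stack, set to `a`. -/
def State.setCell (s : State) (c a : ℕ) : State :=
  ⟨s.reg, Function.update s.arr 0 (Function.update (s.arr 0) c a), s.out⟩

/-- The state `s` with the register `x` set to `a`. -/
def State.setReg (s : State) (x a : ℕ) : State := ⟨Function.update s.reg x a, s.arr, s.out⟩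

@[simp] theorem State.setCell_reg (s : State) (c a : ℕ) : (s.setCell c a).reg = s.reg := rfl

@[simp] theorem State.setCell_out (s : State) (c a : ℕ) : (s.setCell c a).out = s.out := rfl

@[simp] theorem State.setCell_arr (s : State) (c a c' : ℕ) :
    (s.setCell c a).arr 0 c' = if c' = c then a else s.arr 0 c' := by
  simp [setCell, Function.update_apply]

@[simp] theorem State.setReg_reg (s : State) (x a : ℕ) :
    (s.setReg x a).reg = Function.update s.reg x a := rfl

@[simp] theorem State.setReg_out (s : State) (x a : ℕ) : (s.setReg x a).out = s.out := rfl

@[simp] theorem State.setReg_arr (s : State) (x a : ℕ) : (s.setReg x a).arr = s.arr := rfl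

/-- The contents of the `c`-th cell of the stack. -/
abbrev Expr.cell (c : ℕ) : Expr := .get 0 (.const c)

theorem Runs.setCell {inp : List ℕ} {s : State} (c : ℕ) (e : Expr) {a : ℕ}
    (he : e.eval inp s = a) :
    Runs inp (.store 0 (.const c) e) s (s.setCell c a) (e.cost + 2) := by
  subst he
  exact ⟨_, by simp only [Expr.cost]; omega, .store 0 (.const c) e s⟩

theorem Runs.setReg {inp : List ℕ} {s : State} (x : ℕ) (e : Expr) {a : ℕ}
    (he : e.eval inp s = a) : Runs inp (.assign x e) s (s.setReg x a) (e.cost + 1) :=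
  he ▸ ⟨_, le_rfl, .assign x e s⟩

/-- The state `s'` arises from `s` by writing the words `l` and leaving the value `a` in the cell
`d` of the stack, where the cells above `d` may be used as scratch space. -/
structure Extends (d : ℕ) (l : List ℕ) (a : ℕ) (s s' : State) : Prop where
  out : s'.out = s.out ++ l
  reg : s'.reg = s.reg
  cell : s'.arr 0 d = a
  below : ∀ c < d, s'.arr 0 c = s.arr 0 c

theorem monotone_eval (q : Polynomial ℕ) : Monotone fun n => q.eval n := by
  intro a b h
  simp only [Polynomial.eval_eq_sum]
  exact Finset.sum_le_sum fun i _ => Nat.mul_le_mul_left _ (Nat.pow_le_pow_left h i)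

theorem length_le_bitSize (l : List ℕ) : l.length ≤ bitSize l := by
  rw [bitSize, ← List.length_map (fun a : ℕ => a.size + 1)]
  exact List.length_le_sum_of_one_le _ (by simp)

/-- A family of situations in which the same program is to be run: inputs and values of the
variables `x < depth`, where the variable `x` is kept in the register `x`. -/
structure Context (ι : Type*) where
  input : ι → List ℕ
  depth : ℕ
  var : ι → ℕ → ℕ

namespace Context

variable {ι : Type*} {C : Context ι} {l l' : ι → List ℕ} {f g b : ι → ℕ} {P Q : ι → Prop}

/-- A single program writes the words `l i` and computes the value `f i` in every situation `i`, in
time polynomial in the number of input words. -/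
def Realizes (C : Context ι) (l : ι → List ℕ) (f : ι → ℕ) : Prop :=
  ∀ d, ∃ (p : Prog) (time : Polynomial ℕ), ∀ i s, (∀ x < C.depth, s.reg x = C.var i x) →
    ∃ s', Runs (C.input i) p s s' (time.eval (C.input i).length) ∧ Extends d (l i) (f i) s s'

/-- A single program computes `f i` in every situation `i`. -/
abbrev Computes (C : Context ι) (f : ι → ℕ) : Prop := C.Realizes (fun _ => []) f

/-- A single program writes `l i` in every situation `i`. -/
abbrev Writes (C : Context ι) (l : ι → List ℕ) : Prop := ∃ f, C.Realizes l f

/-- A single program decides `P i` in every situation `i`. -/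
def Decides (C : Context ι) (P : ι → Prop) : Prop := ∃ f, C.Computes f ∧ ∀ i, f i ≠ 0 ↔ P i

/-- The situations inside the body of a loop over the indices below `b`. -/
def bind (C : Context ι) (b : ι → ℕ) : Context (Σ i, Fin (b i)) where
  input p := C.input p.1
  depth := C.depth + 1
  var p := Function.update (C.var p.1) C.depth p.2

theorem Realizes.weaken (h : C.Realizes l f) (b : ι → ℕ) :
    (C.bind b).Realizes (fun p => l p.1) (fun p => f p.1) := by
  intro d
  obtain ⟨p, time, h⟩ := h d
  refine ⟨p, time, fun i s hs => h i.1 s fun x hx => ?_⟩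
  rw [hs x (Nat.lt_succ_of_lt hx)]
  exact Function.update_of_ne hx.ne _ _

theorem computes_of_eval (e : Expr)
    (he : ∀ i s, (∀ x < C.depth, s.reg x = C.var i x) → e.eval (C.input i) s = f i) :
    C.Computes f := by
  refine fun d => ⟨.store 0 (.const d) e, Polynomial.C (e.cost + 2), fun i s hs =>
    ⟨s.setCell d (f i), (Runs.setCell d e (he i s hs)).mono (by simp), by simp, rfl, by simp, ?_⟩⟩
  intro c hc
  simp [hc.ne]

theorem computes_const (c : ℕ) : C.Computes fun _ => c :=
  computes_of_eval (.const c) fun _ _ _ => rfl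

theorem computes_index (b : ι → ℕ) : (C.bind b).Computes fun p => (p.2 : ℕ) :=
  computes_of_eval (.reg C.depth) fun p s hs => by
    simp [Expr.eval, hs C.depth (Nat.lt_succ_self _), bind]

/-- The expression `e` computes the value to be stored from the one that is in the cell `d`. -/
theorem Computes.of_cell (hf : C.Computes f) (e : ℕ → Expr) (cost : ℕ)
    (hcost : ∀ d, (e d).cost = cost)
    (he : ∀ i d s, s.arr 0 d = f i → (e d).eval (C.input i) s = g i) : C.Computes g := by
  intro d
  obtain ⟨p, time, h⟩ := hf d
  refine ⟨.seq p (.store 0 (.const d) (e d)), time + Polynomial.C (cost + 2), fun i s hs => ?_⟩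
  obtain ⟨s₁, h₁, out₁, reg₁, cell₁, below₁⟩ := h i s hs
  refine ⟨_, (h₁.seq (Runs.setCell d (e d) (he i d s₁ cell₁))).mono (by simp [hcost]),
    by simpa using out₁, reg₁, by simp, fun c hc => ?_⟩
  simp [hc.ne, below₁ c hc]

theorem Computes.input (hf : C.Computes f) : C.Computes fun i => (C.input i).getD (f i) 0 :=
  hf.of_cell (fun d => .input (.cell d)) 3 (fun _ => rfl) fun i d s h => by simp [Expr.eval, h]

theorem Computes.map₂ (hf : C.Computes f) (hg : C.Computes g) (op : ℕ → ℕ → ℕ)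
    (e : Expr → Expr → Expr) (hcost : ∀ x y, (e x y).cost = x.cost + y.cost + 1)
    (he : ∀ inp s x y, (e x y).eval inp s = op (x.eval inp s) (y.eval inp s)) :
    C.Computes fun i => op (f i) (g i) := by
  intro d
  obtain ⟨p, time, hp⟩ := hf d
  obtain ⟨q, time', hq⟩ := hg (d + 1)
  refine ⟨.seq p (.seq q (.store 0 (.const d) (e (.cell d) (.cell (d + 1))))),
    time + (time' + 7), fun i s hs => ?_⟩
  obtain ⟨s₁, h₁, out₁, reg₁, cell₁, below₁⟩ := hp i s hs
  obtain ⟨s₂, h₂, out₂, reg₂, cell₂, below₂⟩ := hq i s₁ (by rwa [reg₁])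
  have heval : (e (.cell d) (.cell (d + 1))).eval (C.input i) s₂ = op (f i) (g i) := by
    simp [he, Expr.eval, cell₂, below₂ d d.lt_succ_self, cell₁]
  refine ⟨_, (h₁.seq (h₂.seq (Runs.setCell d _ heval))).mono (by simp [hcost, Expr.cost]),
    by simpa [out₁] using out₂, reg₂.trans reg₁, by simp, fun c hc => ?_⟩
  simp [hc.ne, below₂ c (by omega), below₁ c hc]

theorem Computes.add (hf : C.Computes f) (hg : C.Computes g) : C.Computes fun i => f i + g i :=
  hf.map₂ hg (· + ·) .add (fun _ _ => rfl) fun _ _ _ _ => rfl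

theorem Computes.sub (hf : C.Computes f) (hg : C.Computes g) : C.Computes fun i => f i - g i :=
  hf.map₂ hg (· - ·) .sub (fun _ _ => rfl) fun _ _ _ _ => rfl

theorem Computes.emit (hf : C.Computes f) : C.Writes fun i => [f i] := by
  refine ⟨f, fun d => ?_⟩
  obtain ⟨p, time, h⟩ := hf d
  refine ⟨.seq p (.emit (.cell d)), time + 3, fun i s hs => ?_⟩
  obtain ⟨s₁, h₁, out₁, reg₁, cell₁, below₁⟩ := h i s hs
  exact ⟨_, (h₁.seq (.emit _ _)).mono (by simp [Expr.cost]), by simp [Expr.eval, out₁, cell₁], reg₁,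
    cell₁, below₁⟩

theorem Realizes.seq (hl : C.Realizes l f) (hl' : C.Realizes l' g) :
    C.Realizes (fun i => l i ++ l' i) g := by
  intro d
  obtain ⟨p, time, hp⟩ := hl d
  obtain ⟨q, time', hq⟩ := hl' d
  refine ⟨.seq p q, time + time', fun i s hs => ?_⟩
  obtain ⟨s₁, h₁, out₁, reg₁, -, below₁⟩ := hp i s hs
  obtain ⟨s₂, h₂, out₂, reg₂, cell₂, below₂⟩ := hq i s₁ (by rwa [reg₁])
  exact ⟨_, (h₁.seq h₂).mono (by simp), by simp [out₂, out₁], reg₂.trans reg₁, cell₂,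
    fun c hc => (below₂ c hc).trans (below₁ c hc)⟩

theorem Realizes.ite {_ : DecidablePred P} (hP : C.Decides P) (hl : C.Realizes l f)
    (hl' : C.Realizes l' g) :
    C.Realizes (fun i => if P i then l i else l' i) (fun i => if P i then f i else g i) := by
  obtain ⟨c, hc, hcP⟩ := hP
  intro d
  obtain ⟨r, time₀, hr⟩ := hc d
  obtain ⟨p, time, hp⟩ := hl d
  obtain ⟨q, time', hq⟩ := hl' d
  refine ⟨.seq r (.ite (.cell d) p q), time₀ + (time + time' + 3), fun i s hs => ?_⟩
  obtain ⟨s₁, h₁, out₁, reg₁, cell₁, below₁⟩ := hr i s hs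
  rw [List.append_nil] at out₁
  by_cases h : P i
  · obtain ⟨s₂, h₂, out₂, reg₂, cell₂, below₂⟩ := hp i s₁ (by rwa [reg₁])
    have hcell : (Expr.cell d).eval (C.input i) s₁ ≠ 0 := by simpa [Expr.eval, cell₁, hcP i] using h
    exact ⟨s₂, (h₁.seq (.ite_true hcell h₂)).mono (by simp [Expr.cost]; omega),
      by simp [h, out₂, out₁], reg₂.trans reg₁, by simp [h, cell₂],
      fun c hc => (below₂ c hc).trans (below₁ c hc)⟩
  · obtain ⟨s₂, h₂, out₂, reg₂, cell₂, below₂⟩ := hq i s₁ (by rwa [reg₁])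
    have hcell : (Expr.cell d).eval (C.input i) s₁ = 0 := by
      simpa [Expr.eval, cell₁] using (hcP i).not.2 h
    exact ⟨s₂, (h₁.seq (.ite_false hcell h₂)).mono (by simp [Expr.cost]; omega),
      by simp [h, out₂, out₁], reg₂.trans reg₁, by simp [h, cell₂],
      fun c hc => (below₂ c hc).trans (below₁ c hc)⟩

/-- The body of the loop for `Realizes.loop`: the loop variable is in the register `x`, the value
accumulated so far in the cell `d`, and `q` leaves the value to be added in the cell `d + 3`. -/
def loopBody (x d : ℕ) (q : Prog) : Prog :=
  .seq q (.seq (.store 0 (.const d) (.add (.cell d) (.cell (d + 3))))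
    (.assign x (.add (.reg x) (.const 1))))

/-- A loop with the body `loopBody x d q`. The cell `d + 1` holds the number of rounds, and the cell
`d + 2` the original contents of the register `x`, which are restored at the end. -/
def loopProg (x d : ℕ) (q : Prog) : Prog :=
  .seq (.store 0 (.const (d + 2)) (.reg x)) (.seq (.store 0 (.const d) (.const 0))
    (.seq (.assign x (.const 0)) (.seq (.loop (.sub (.cell (d + 1)) (.reg x)) (loopBody x d q))
      (.assign x (.cell (d + 2))))))

/-- The state `s'` reached from `s` in the execution of `loopProg x d q` before the round `j`, for a
loop with `b` rounds of which the first `j` have written `l` and accumulated `a`. -/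
structure LoopInvariant (x d b : ℕ) (l : List ℕ) (a j : ℕ) (s s' : State) : Prop where
  out : s'.out = s.out ++ l
  reg : s'.reg = Function.update s.reg x j
  acc : s'.arr 0 d = a
  bound : s'.arr 0 (d + 1) = b
  saved : s'.arr 0 (d + 2) = s.reg x
  below : ∀ c < d, s'.arr 0 c = s.arr 0 c

theorem LoopInvariant.step {inp : List ℕ} {x d b j B a a' : ℕ} {l l' : List ℕ} {q : Prog}
    {s s₁ s₂ : State} (h : LoopInvariant x d b l a j s s₁) (hq : Runs inp q s₁ s₂ B)
    (hs : Extends (d + 3) l' a' s₁ s₂) :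
    ∃ s₃, Runs inp (loopBody x d q) s₁ s₃ (B + 11) ∧
      LoopInvariant x d b (l ++ l') (a + a') (j + 1) s s₃ := by
  obtain ⟨out₁, reg₁, acc₁, bound₁, saved₁, below₁⟩ := h
  obtain ⟨out₂, reg₂, cell₂, below₂⟩ := hs
  have hacc : (Expr.add (.cell d) (.cell (d + 3))).eval inp s₂ = a + a' := by
    simp [Expr.eval, cell₂, below₂ d (by omega), acc₁]
  have hnext : (Expr.add (.reg x) (.const 1)).eval inp (s₂.setCell d (a + a')) = j + 1 := by
    simp [Expr.eval, reg₂, reg₁]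
  refine ⟨_, (hq.seq ((Runs.setCell d _ hacc).seq (Runs.setReg x _ hnext))).mono
    (by simp [Expr.cost]), ⟨by simp [out₂, out₁], by simp [reg₂, reg₁], by simp,
      by simp [below₂, bound₁], by simp [below₂, saved₁], fun c hc => ?_⟩⟩
  simp [hc.ne, below₂ c (by omega), below₁ c hc]

theorem Runs.loopProg {inp : List ℕ} {x d b B : ℕ} {q : Prog} {s : State} (l : ℕ → List ℕ)
    (a : ℕ → ℕ) (hl : l 0 = []) (ha : a 0 = 0) (hb : s.arr 0 (d + 1) = b)
    (hstep : ∀ j < b, ∀ s₁, LoopInvariant x d b (l j) (a j) j s s₁ → ∃ s₂,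
      Runs inp (loopBody x d q) s₁ s₂ B ∧
        LoopInvariant x d b (l (j + 1)) (a (j + 1)) (j + 1) s s₂) :
    ∃ s', Runs inp (loopProg x d q) s s' ((b + 1) * (B + 5) + 11) ∧ Extends d (l b) (a b) s s' := by
  let s₀ := ((s.setCell (d + 2) (s.reg x)).setCell d 0).setReg x 0
  have h₀ : LoopInvariant x d b (l 0) (a 0) 0 s s₀ :=
    ⟨by simp [s₀, hl], by simp [s₀], by simp [s₀, ha], by simp [s₀, hb], by simp [s₀],
      fun c hc => by simp [s₀, hc.ne, (show c ≠ d + 2 by omega)]⟩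
  obtain ⟨s₁, hloop, h₁⟩ := Runs.exists_loop (e := .sub (.cell (d + 1)) (.reg x))
    (fun j => LoopInvariant x d b (l j) (a j) j s)
    (fun j s₁ h => by simp [Expr.eval, h.bound, h.reg]) hstep h₀
  have hrestore : (Expr.cell (d + 2)).eval inp s₁ = s.reg x := by simp [Expr.eval, h₁.saved]
  refine ⟨s₁.setReg x (s.reg x), ((Runs.setCell (d + 2) (.reg x) rfl).seq
    ((Runs.setCell d (.const 0) rfl).seq ((Runs.setReg x (.const 0) rfl).seq
      (hloop.seq (Runs.setReg x _ hrestore))))).mono ?_,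
    ⟨h₁.out, by simp [h₁.reg], h₁.acc, h₁.below⟩⟩
  simp only [Expr.cost, Nat.reduceAdd, Nat.add_assoc]
  omega

/-- Loops over the indices below `b` are possible: `b` can be computed, and it is at most the number
of input words. -/
def IsBound (C : Context ι) (b : ι → ℕ) : Prop := C.Computes b ∧ ∀ i, b i ≤ (C.input i).length

theorem IsBound.weaken {b' : ι → ℕ} (hb : C.IsBound b') (b : ι → ℕ) :
    (C.bind b).IsBound fun p => b' p.1 :=
  ⟨Realizes.weaken hb.1 b, fun p => hb.2 p.1⟩

theorem Realizes.loop {l : (Σ i, Fin (b i)) → List ℕ} {f : (Σ i, Fin (b i)) → ℕ}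
    (h : (C.bind b).Realizes l f) (hb : C.IsBound b) :
    C.Realizes (fun i => (List.finRange (b i)).flatMap fun j => l ⟨i, j⟩)
      (fun i => ∑ j, f ⟨i, j⟩) := by
  intro d
  obtain ⟨r, time₀, hr⟩ := hb.1 (d + 1)
  obtain ⟨q, time, hq⟩ := h (d + 3)
  refine ⟨.seq r (loopProg C.depth d q), time₀ + ((Polynomial.X + 1) * (time + 16) + 11),
    fun i s hs => ?_⟩
  obtain ⟨s₁, h₁, out₁, reg₁, cell₁, below₁⟩ := hr i s hs
  let done (j : ℕ) : List (Fin (b i)) := (List.finRange (b i)).take j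
  have done_all : done (b i) = List.finRange (b i) := List.take_of_length_le (by simp)
  have done_succ (j : ℕ) (hj : j < b i) : done (j + 1) = done j ++ [⟨j, hj⟩] := by
    simp [done, List.take_succ_eq_append_getElem, hj]
  obtain ⟨s₂, h₂, out₂, reg₂, cell₂, below₂⟩ := Runs.loopProg (x := C.depth) (q := q)
    (inp := C.input i) (B := time.eval (C.input i).length + 11)
    (fun j => (done j).flatMap fun j => l ⟨i, j⟩) (fun j => ((done j).map fun j => f ⟨i, j⟩).sum)
    rfl rfl cell₁ fun j hj s₂ hinv => by
      obtain ⟨s₃, h₃, hs₃⟩ := hq ⟨i, j, hj⟩ s₂ fun x hx => by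
        rcases eq_or_ne x C.depth with rfl | hne
        · simp [hinv.reg, bind]
        · simpa [hinv.reg, bind, hne, reg₁] using hs x (lt_of_le_of_ne (Nat.lt_succ_iff.1 hx) hne)
      simpa [done_succ j hj, bind] using hinv.step h₃ hs₃
  rw [done_all] at out₂ cell₂
  refine ⟨s₂, (h₁.seq h₂).mono ?_, by simpa [out₁] using out₂, reg₂.trans reg₁, ?_,
    fun c hc => (below₂ c hc).trans (below₁ c (by omega))⟩
  · simp only [Polynomial.eval_add, Polynomial.eval_mul, Polynomial.eval_X, Polynomial.eval_one,
      Polynomial.eval_ofNat, Nat.add_assoc, Nat.reduceAdd]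
    gcongr
    exact hb.2 i
  · exact cell₂.trans (Fin.sum_univ_def _).symm

theorem Writes.append (hl : C.Writes l) (hl' : C.Writes l') : C.Writes fun i => l i ++ l' i := by
  obtain ⟨f, hf⟩ := hl
  obtain ⟨g, hg⟩ := hl'
  exact ⟨g, hf.seq hg⟩

theorem Writes.guard {_ : DecidablePred P} (hP : C.Decides P) (hl : C.Writes l) :
    C.Writes fun i => if P i then l i else [] := by
  obtain ⟨f, hf⟩ := hl
  exact ⟨_, hf.ite hP (computes_const 0)⟩

theorem Writes.flatMap_finRange {l : ∀ i, Fin (b i) → List ℕ}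
    (hl : (C.bind b).Writes fun p => l p.1 p.2) (hb : C.IsBound b) :
    C.Writes fun i => (List.finRange (b i)).flatMap (l i) := by
  obtain ⟨f, hf⟩ := hl
  exact ⟨_, hf.loop hb⟩

theorem Computes.sum {f : ∀ i, Fin (b i) → ℕ} (hf : (C.bind b).Computes fun p => f p.1 p.2)
    (hb : C.IsBound b) : C.Computes fun i => ∑ j, f i j := by
  convert Realizes.loop hf hb
  exact (List.flatMap_eq_nil_iff.2 fun _ _ => rfl).symm

theorem Computes.ite {_ : DecidablePred P} (hP : C.Decides P) (hf : C.Computes f)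
    (hg : C.Computes g) : C.Computes fun i => if P i then f i else g i := by
  simpa using Realizes.ite hP hf hg

namespace Decides

theorem congr (hP : C.Decides P) (h : ∀ i, P i ↔ Q i) : C.Decides Q := by
  obtain ⟨f, hf, hfP⟩ := hP
  exact ⟨f, hf, fun i => (hfP i).trans (h i)⟩

theorem weaken (hP : C.Decides P) (b : ι → ℕ) : (C.bind b).Decides fun p => P p.1 := by
  obtain ⟨f, hf, hfP⟩ := hP
  exact ⟨_, Realizes.weaken hf b, fun p => hfP p.1⟩

theorem indicator {_ : DecidablePred P} (hP : C.Decides P) :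
    C.Computes fun i => if P i then 1 else 0 :=
  .ite hP (computes_const 1) (computes_const 0)

theorem not (hP : C.Decides P) : C.Decides fun i => ¬ P i := by
  classical
  have hcompl : C.Computes fun i => 1 - if P i then 1 else 0 := (computes_const 1).sub hP.indicator
  exact ⟨_, hcompl, fun i => by by_cases h : P i <;> simp [h]⟩

theorem or (hP : C.Decides P) (hQ : C.Decides Q) : C.Decides fun i => P i ∨ Q i := by
  obtain ⟨f, hf, hfP⟩ := hP
  obtain ⟨g, hg, hgQ⟩ := hQ
  exact ⟨_, hf.add hg, fun i => (by omega : _ ↔ f i ≠ 0 ∨ g i ≠ 0).trans (or_congr (hfP i) (hgQ i))⟩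

theorem and (hP : C.Decides P) (hQ : C.Decides Q) : C.Decides fun i => P i ∧ Q i :=
  (hP.not.or hQ.not).not.congr fun i => by tauto

theorem imp (hP : C.Decides P) (hQ : C.Decides Q) : C.Decides fun i => P i → Q i :=
  (hP.not.or hQ).congr fun i => by tauto

theorem iff (hP : C.Decides P) (hQ : C.Decides Q) : C.Decides fun i => P i ↔ Q i :=
  ((hP.imp hQ).and (hQ.imp hP)).congr fun _ => iff_def.symm

theorem lt (hf : C.Computes f) (hg : C.Computes g) : C.Decides fun i => f i < g i :=
  ⟨_, hg.sub hf, fun i => by omega⟩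

theorem le (hf : C.Computes f) (hg : C.Computes g) : C.Decides fun i => f i ≤ g i :=
  (lt hg hf).not.congr fun _ => not_lt

theorem eq (hf : C.Computes f) (hg : C.Computes g) : C.Decides fun i => f i = g i :=
  ((le hf hg).and (le hg hf)).congr fun _ => le_antisymm_iff.symm

theorem exists_fin {P : ∀ i, Fin (b i) → Prop} (hP : (C.bind b).Decides fun p => P p.1 p.2)
    (hb : C.IsBound b) : C.Decides fun i => ∃ j, P i j := by
  obtain ⟨f, hf, hfP⟩ := hP
  exact ⟨_, Computes.sum (f := fun i j => f ⟨i, j⟩) hf hb,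
    fun i => by simpa using exists_congr fun j => hfP ⟨i, j⟩⟩

theorem forall_fin {P : ∀ i, Fin (b i) → Prop} (hP : (C.bind b).Decides fun p => P p.1 p.2)
    (hb : C.IsBound b) : C.Decides fun i => ∀ j, P i j :=
  (exists_fin (P := fun i j => ¬ P i j) hP.not hb).not.congr fun i => by simp

end Decides

theorem Writes.exists_prog (hl : C.Writes l) (hC : C.depth = 0) :
    ∃ (p : Prog) (time : Polynomial ℕ), ∀ i, ∃ s T, Exec (C.input i) p State.init s T ∧
      T ≤ time.eval (bitSize (C.input i)) ∧ s.out = l i := by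
  obtain ⟨f, hf⟩ := hl
  obtain ⟨p, time, h⟩ := hf 0
  refine ⟨p, time, fun i => ?_⟩
  obtain ⟨s, ⟨T, hT, hp⟩, hs⟩ := h i State.init (by simp [hC])
  exact ⟨s, T, hp, hT.trans (monotone_eval time (length_le_bitSize _)), hs.out⟩

end Context

end RAM

/-! ### Reading the input -/

theorem prefix_drop_flatMap_finRange {k : ℕ} (f : Fin k → List ℕ) (i : Fin k) :
    f i <+: ((List.finRange k).flatMap f).drop (∑ j, if j < i then (f j).length else 0) := by
  induction k with
  | zero => exact i.elim0
  | succ k ih =>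
    rw [List.finRange_succ, List.flatMap_cons, List.flatMap_map, Fin.sum_univ_succ]
    cases i using Fin.cases with
    | zero => simp
    | succ i =>
      simp only [Fin.succ_pos, if_true, Fin.succ_lt_succ_iff, ← List.drop_drop, List.drop_left]
      exact ih (fun j => f j.succ) i

namespace RAM.Context

variable {ι : Type*} {C : Context ι} {L L' : ι → List ℕ} {b f g : ι → ℕ}

/-- A single program computes a position from which `L i` can be read in the input of every
situation `i`. -/
def Locates (C : Context ι) (L : ι → List ℕ) : Prop :=
  ∃ f, C.Computes f ∧ ∀ i, L i <+: (C.input i).drop (f i)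

namespace Locates

theorem of_input (h : ∀ i, C.input i = L i) : C.Locates L :=
  ⟨_, computes_const 0, fun i => by simp [h]⟩

theorem left (h : C.Locates fun i => L i ++ L' i) : C.Locates L := by
  obtain ⟨f, hf, hL⟩ := h
  exact ⟨f, hf, fun i => (List.prefix_append _ _).trans (hL i)⟩

theorem right (h : C.Locates fun i => L i ++ L' i) (hL : C.Computes fun i => (L i).length) :
    C.Locates L' := by
  obtain ⟨f, hf, hp⟩ := h
  refine ⟨_, hf.add hL, fun i => ?_⟩
  obtain ⟨t, ht⟩ := hp i
  exact ⟨t, by simp [← List.drop_drop, ← ht]⟩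

theorem flatMap_finRange {L : ∀ i, Fin (b i) → List ℕ} {k : ∀ i, Fin (b i)}
    (h : C.Locates fun i => (List.finRange (b i)).flatMap (L i)) (hb : C.IsBound b)
    (hL : (C.bind b).Computes fun p => (L p.1 p.2).length) (hk : C.Computes fun i => (k i : ℕ)) :
    C.Locates fun i => L i (k i) := by
  obtain ⟨f, hf, hp⟩ := h
  have hlt : (C.bind b).Decides fun p => p.2 < k p.1 := .lt (computes_index b) (hk.weaken b)
  have hstart : C.Computes fun i => ∑ j, if j < k i then (L i j).length else 0 :=
    .sum (.ite hlt hL (computes_const 0)) hb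
  refine ⟨_, hf.add hstart, fun i => ?_⟩
  rw [← List.drop_drop]
  exact (prefix_drop_flatMap_finRange _ (k i)).trans ((hp i).drop _)

theorem computes_getElem (h : C.Locates L) (hf : C.Computes f)
    (hg : ∀ i, (L i)[f i]? = some (g i)) : C.Computes g := by
  obtain ⟨o, ho, hp⟩ := h
  convert (ho.add hf).input with i
  obtain ⟨t, ht⟩ := hp i
  obtain ⟨hlt, -⟩ := List.getElem?_eq_some_iff.1 (hg i)
  rw [List.getD_eq_getElem?_getD, ← List.getElem?_drop, ← ht, List.getElem?_append_left hlt, hg i,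
    Option.getD_some]

end Locates

end RAM.Context

/-! ### Deciding properties of finite sets of indices -/

namespace RAM.Context

variable {ι : Type*} {C : Context ι} {b : ι → ℕ}

theorem Decides.const (p : Prop) : C.Decides fun _ => p := by
  classical
  exact ⟨_, computes_const (if p then 1 else 0), fun _ => by simp⟩

theorem Decides.exists_lt {P : ι → ℕ → Prop} (hP : (C.bind b).Decides fun p => P p.1 p.2)
    (hb : C.IsBound b) : C.Decides fun i => ∃ j < b i, P i j :=
  (exists_fin (P := fun i j => P i j) hP hb).congr fun i => by simp [Fin.exists_iff]

theorem Decides.forall_lt {P : ι → ℕ → Prop} (hP : (C.bind b).Decides fun p => P p.1 p.2)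
    (hb : C.IsBound b) : C.Decides fun i => ∀ j < b i, P i j :=
  (forall_fin (P := fun i j => P i j) hP hb).congr fun i => by simp [Fin.forall_iff]

theorem Decides.exists_prod_bool {P : ∀ i, Fin (b i) × Bool → Prop}
    (hP : ∀ s, (C.bind b).Decides fun p => P p.1 (p.2, s)) (hb : C.IsBound b) :
    C.Decides fun i => ∃ h, P i h :=
  (exists_fin (P := fun i j => P i (j, false) ∨ P i (j, true)) ((hP false).or (hP true)) hb).congr
    fun i => by simp

theorem Decides.forall_prod_bool {P : ∀ i, Fin (b i) × Bool → Prop}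
    (hP : ∀ s, (C.bind b).Decides fun p => P p.1 (p.2, s)) (hb : C.IsBound b) :
    C.Decides fun i => ∀ h, P i h :=
  (exists_prod_bool (P := fun i h => ¬ P i h) (fun s => (hP s).not) hb).not.congr fun i => by simp

theorem Computes.sum_prod_bool {f : ∀ i, Fin (b i) × Bool → ℕ}
    (hf : ∀ s, (C.bind b).Computes fun p => f p.1 (p.2, s)) (hb : C.IsBound b) :
    C.Computes fun i => ∑ h, f i h := by
  simp only [Fintype.sum_prod_type, Fintype.sum_bool]
  exact .sum ((hf true).add (hf false)) hb

theorem Computes.card_filter {P : ∀ i, Fin (b i) → Prop} {_ : ∀ i, DecidablePred (P i)}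
    (hP : (C.bind b).Decides fun p => P p.1 p.2) (hb : C.IsBound b) :
    C.Computes fun i => Finset.card {j | P i j} := by
  simp only [Finset.card_filter]
  exact .sum hP.indicator hb

theorem Computes.card_filter_range {P : ι → ℕ → Prop} {_ : ∀ i, DecidablePred (P i)}
    (hP : (C.bind b).Decides fun p => P p.1 p.2) (hb : C.IsBound b) :
    C.Computes fun i => Finset.card {j ∈ Finset.range (b i) | P i j} := by
  simp only [Finset.card_filter, Finset.sum_range]
  exact .sum hP.indicator hb

theorem Writes.filter_finRange {P : ∀ i, Fin (b i) → Prop} {_ : ∀ i, DecidablePred (P i)}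
    (hP : (C.bind b).Decides fun p => P p.1 p.2) (hb : C.IsBound b) :
    C.Writes fun i => ((List.finRange (b i)).filter fun j => P i j).map Fin.val := by
  have hlist : ∀ i, ((List.finRange (b i)).filter fun j => P i j).map Fin.val =
      (List.finRange (b i)).flatMap fun j => if P i j then [(j : ℕ)] else [] := fun i => by
    induction List.finRange (b i) with
    | nil => rfl
    | cons a l ih => by_cases h : P i a <;> simp [h, ih]
  simp only [hlist]
  exact .flatMap_finRange (.guard hP (computes_index b).emit) hb

variable {γ : ι → Type*} {f : ∀ i, Fin (b i) → γ i}

theorem Decides.isFirst {r : ∀ i, Fin (b i)} (hr : C.Computes fun i => (r i : ℕ))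
    (hf : (C.bind b).Decides fun p => f p.1 p.2 = f p.1 (r p.1)) (hb : C.IsBound b) :
    C.Decides fun i => IsFirst (f i) (r i) :=
  forall_fin (P := fun i x => x < r i → f i x ≠ f i (r i))
    (.imp (.lt (computes_index b) (hr.weaken b)) hf.not) hb

end RAM.Context

/-! ### Evaluating the path model of the input -/

/-- A representation that the algorithm takes as its input. -/
structure Instance where
  n : ℕ
  p : ℕ
  m : ℕ
  H : Graph (Fin p) (Fin m)
  G : SimpleGraph (Fin n)
  S : HRepresentation H G
  edgeSet_eq : H.edgeSet = Set.univ
  pos : 0 < m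
  isNonCrossing : S.IsNonCrossing

namespace Instance

variable (I : Instance)

instance : NeZero I.m := ⟨I.pos.ne'⟩

/-- The path model of the representation, with the given numbering of the vertices of `H`. -/
noncomputable def model : PathModel (Fin I.n) (Fin I.m) :=
  I.S.model id fun x => (x : ℕ)

/-- The words that describe the edge `e` of `H`. -/
def edgeRecord (e : Fin I.m) : List ℕ :=
  [(I.S.framework.src e : ℕ), (I.S.framework.tgt e : ℕ), I.S.framework.len e]

open Classical in
/-- The characteristic vector of the set of `v` on the vertices of `H`. -/
noncomputable def vertexBits (v : Fin I.n) : List ℕ :=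
  (List.finRange I.p).map fun x => if Sum.inl x ∈ I.S.rep v then 1 else 0

open Classical in
/-- The characteristic vector of the set of `v` on the internal vertices of the edge `e` of `H`. -/
noncomputable def edgeBits (v : Fin I.n) (e : Fin I.m) : List ℕ :=
  (List.range (I.model.len e)).map fun k => if Sum.inr (e, k + 1) ∈ I.S.rep v then 1 else 0

theorem encode_eq : I.S.encode = [I.n, I.p, I.m] ++ (List.finRange I.m).flatMap I.edgeRecord ++
    (List.finRange I.n).flatMap fun v =>
      I.vertexBits v ++ (List.finRange I.m).flatMap (I.edgeBits v) :=
  rfl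

@[simp] theorem length_edgeRecord (e : Fin I.m) : (I.edgeRecord e).length = 3 := rfl

@[simp] theorem length_vertexBits (v : Fin I.n) : (I.vertexBits v).length = I.p := by
  simp [vertexBits]

@[simp] theorem length_edgeBits (v : Fin I.n) (e : Fin I.m) :
    (I.edgeBits v e).length = I.model.len e := by
  simp [edgeBits]

theorem length_encode : I.S.encode.length =
    3 + I.m * 3 + I.n * (I.p + ∑ e, I.model.len e) := by
  simp [encode_eq, List.length_flatMap, ← Fin.sum_univ_def]
  ring

theorem represents : I.model.Represents I.G :=
  I.S.model_represents I.isNonCrossing Function.injective_id (by simp [I.edgeSet_eq])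
    Fin.val_injective.injOn

theorem mem_model {v : Fin I.n} {e : Fin I.m} {j : ℕ} : I.model.mem v e j ↔
    (j = 0 ∧ Sum.inl (I.S.framework.src e) ∈ I.S.rep v ∨
      ∃ k < I.model.len e, j = k + 1 ∧ Sum.inr (e, k + 1) ∈ I.S.rep v) ∨
    I.model.len e < j ∧ Sum.inl (I.S.framework.tgt e) ∈ I.S.rep v := by
  simp only [model, HRepresentation.model, Graph.Subdivision.pathVertex, id]
  rcases j with _ | j
  · simp
  · by_cases hj : j + 1 ≤ I.S.framework.len e
    · simp [hj, show ¬ I.S.framework.len e < j + 1 by omega]; omega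
    · simp [hj]; grind

end Instance

namespace RAM.Context

/-- The inputs are the encodings of the given representations. -/
def Reads {ι : Type*} (C : Context ι) (I : ι → Instance) : Prop :=
  ∀ i, C.input i = (I i).S.encode

namespace Reads

open Instance

variable {ι : Type*} {C : Context ι} {I : ι → Instance} {j k : ι → ℕ} {x : ∀ i, Fin (I i).p}
  {v : ∀ i, Fin (I i).n} {e : ∀ i, Fin (I i).m}

theorem weaken (hI : C.Reads I) (b : ι → ℕ) : (C.bind b).Reads fun p => I p.1 :=
  fun p => hI p.1

theorem locates_encode (hI : C.Reads I) : C.Locates fun i =>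
    [(I i).n, (I i).p, (I i).m] ++ (List.finRange (I i).m).flatMap (I i).edgeRecord ++
      (List.finRange (I i).n).flatMap fun v =>
        (I i).vertexBits v ++ (List.finRange (I i).m).flatMap ((I i).edgeBits v) :=
  Locates.of_input fun i => (hI i).trans (I i).encode_eq

theorem isBound_n (hI : C.Reads I) : C.IsBound fun i => (I i).n := by
  refine ⟨hI.locates_encode.left.left.computes_getElem (computes_const 0) fun _ => rfl,
    fun i => ?_⟩
  have hp : 0 < (I i).p := Fin.pos ((I i).S.framework.src 0)
  rw [hI i, (I i).length_encode]
  exact (Nat.le_mul_of_pos_right _ (by omega)).trans (Nat.le_add_left _ _)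

theorem computes_p (hI : C.Reads I) : C.Computes fun i => (I i).p :=
  hI.locates_encode.left.left.computes_getElem (computes_const 1) fun _ => rfl

theorem isBound_m (hI : C.Reads I) : C.IsBound fun i => (I i).m :=
  ⟨hI.locates_encode.left.left.computes_getElem (computes_const 2) fun _ => rfl, fun i => by
    rw [hI i, (I i).length_encode]
    dsimp only
    omega⟩

theorem isBound_p (hI : C.Reads I) (v : ∀ i, Fin (I i).n) : C.IsBound fun i => (I i).p := by
  refine ⟨hI.computes_p, fun i => ?_⟩
  have hn : 0 < (I i).n := (v i).pos
  rw [hI i, (I i).length_encode]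
  exact ((Nat.le_add_right _ _).trans (Nat.le_mul_of_pos_left _ hn)).trans (Nat.le_add_left _ _)

theorem locates_edge (hI : C.Reads I) (he : C.Computes fun i => (e i : ℕ)) :
    C.Locates fun i => (I i).edgeRecord (e i) :=
  (hI.locates_encode.left.right (computes_const 3)).flatMap_finRange hI.isBound_m
    (computes_const 3) he

theorem computes_src (hI : C.Reads I) (he : C.Computes fun i => (e i : ℕ)) :
    C.Computes fun i => ((I i).S.framework.src (e i) : ℕ) :=
  (hI.locates_edge he).computes_getElem (computes_const 0) fun _ => rfl

theorem computes_tgt (hI : C.Reads I) (he : C.Computes fun i => (e i : ℕ)) :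
    C.Computes fun i => ((I i).S.framework.tgt (e i) : ℕ) :=
  (hI.locates_edge he).computes_getElem (computes_const 1) fun _ => rfl

theorem computes_len (hI : C.Reads I) (he : C.Computes fun i => (e i : ℕ)) :
    C.Computes fun i => (I i).model.len (e i) :=
  (hI.locates_edge he).computes_getElem (computes_const 2) fun _ => rfl

theorem isBound_len_add_two (hI : C.Reads I) (v : ∀ i, Fin (I i).n)
    (he : C.Computes fun i => (e i : ℕ)) : C.IsBound fun i => (I i).model.len (e i) + 2 := by
  refine ⟨(hI.computes_len he).add (computes_const 2), fun i => ?_⟩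
  have hn : 0 < (I i).n := (v i).pos
  have hlen : (I i).model.len (e i) ≤ ∑ e, (I i).model.len e :=
    Finset.single_le_sum (f := (I i).model.len) (fun _ _ => Nat.zero_le _)
      (Finset.mem_univ (e i))
  rw [hI i, (I i).length_encode]
  dsimp only
  nlinarith

theorem isBound_len (hI : C.Reads I) (v : ∀ i, Fin (I i).n)
    (he : C.Computes fun i => (e i : ℕ)) : C.IsBound fun i => (I i).model.len (e i) :=
  ⟨hI.computes_len he, fun i => (Nat.le_add_right _ 2).trans ((hI.isBound_len_add_two v he).2 i)⟩

theorem locates_rep (hI : C.Reads I) (hv : C.Computes fun i => (v i : ℕ)) :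
    C.Locates fun i => (I i).vertexBits (v i) ++
      (List.finRange (I i).m).flatMap ((I i).edgeBits (v i)) := by
  have hhead : C.Computes fun i =>
      ([(I i).n, (I i).p, (I i).m] ++ (List.finRange (I i).m).flatMap (I i).edgeRecord).length := by
    simp only [List.length_append, List.length_flatMap, length_edgeRecord, ← Fin.sum_univ_def]
    exact (computes_const 3).add (.sum (computes_const 3) hI.isBound_m)
  refine (hI.locates_encode.right hhead).flatMap_finRange hI.isBound_n ?_ hv
  simp only [List.length_append, List.length_flatMap, length_vertexBits, length_edgeBits,
    ← Fin.sum_univ_def]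
  have hI' := hI.weaken fun i => (I i).n
  exact hI'.computes_p.add (.sum ((hI'.weaken _).computes_len (computes_index _)) hI'.isBound_m)

theorem decides_inl_mem_rep (hI : C.Reads I) (hv : C.Computes fun i => (v i : ℕ))
    (hx : C.Computes fun i => (x i : ℕ)) :
    C.Decides fun i => Sum.inl (x i) ∈ (I i).S.rep (v i) := by
  classical
  refine ⟨fun i => if Sum.inl (x i) ∈ (I i).S.rep (v i) then 1 else 0, ?_, fun i => by simp⟩
  exact (hI.locates_rep hv).left.computes_getElem hx fun i => by simp [vertexBits]

theorem decides_inr_mem_rep (hI : C.Reads I) (hv : C.Computes fun i => (v i : ℕ))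
    (he : C.Computes fun i => (e i : ℕ)) (hk : C.Computes k)
    (hlt : ∀ i, k i < (I i).model.len (e i)) :
    C.Decides fun i => Sum.inr (e i, k i + 1) ∈ (I i).S.rep (v i) := by
  classical
  refine ⟨fun i => if Sum.inr (e i, k i + 1) ∈ (I i).S.rep (v i) then 1 else 0, ?_,
    fun i => by simp⟩
  have hvertices : C.Computes fun i => ((I i).vertexBits (v i)).length := by
    simpa only [length_vertexBits] using hI.computes_p
  have hbits := ((hI.locates_rep hv).right hvertices).flatMap_finRange hI.isBound_m
    (by simpa only [length_edgeBits] using (hI.weaken _).computes_len (computes_index _)) he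
  exact hbits.computes_getElem hk fun i => by
    simp only [edgeBits, List.getElem?_map]
    rw [List.getElem?_range (hlt i), Option.map_some]

theorem decides_mem (hI : C.Reads I) (hv : C.Computes fun i => (v i : ℕ))
    (he : C.Computes fun i => (e i : ℕ)) (hj : C.Computes j) :
    C.Decides fun i => (I i).model.mem (v i) (e i) (j i) := by
  simp only [mem_model]
  refine .or (.or
    (.and (.eq hj (computes_const 0)) (hI.decides_inl_mem_rep hv (hI.computes_src he)))
    (.exists_lt ?_ (hI.isBound_len v he)))
    (.and (.lt (hI.computes_len he) hj) (hI.decides_inl_mem_rep hv (hI.computes_tgt he)))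
  exact .and (.eq (hj.weaken _) ((computes_index _).add (computes_const 1)))
    ((hI.weaken _).decides_inr_mem_rep (hv.weaken _) (he.weaken _) (computes_index _)
      fun q => q.2.isLt)

end Reads

end RAM.Context

namespace RAM.Context.Reads

open Instance

variable {ι : Type*} {C : Context ι} {I : ι → Instance} {j : ι → ℕ}
  {u v : ∀ i, Fin (I i).n} {e f : ∀ i, Fin (I i).m}

theorem decides_side (hI : C.Reads I) (hv : C.Computes fun i => (v i : ℕ))
    (he : C.Computes fun i => (e i : ℕ)) (s : Bool) (hj : C.Computes j) :
    C.Decides fun i => (I i).model.Side (v i) (e i, s) (j i) := by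
  cases s
  · exact hI.decides_mem hv he hj
  · exact hI.decides_mem hv he (((hI.computes_len he).add (computes_const 1)).sub hj)

theorem decides_branch (hI : C.Reads I) (hv : C.Computes fun i => (v i : ℕ)) :
    C.Decides fun i => (I i).model.Branch (v i) :=
  .exists_prod_bool (fun s =>
    (hI.weaken _).decides_side (hv.weaken _) (computes_index _) s (computes_const 0)) hI.isBound_m

theorem decides_full (hI : C.Reads I) (hv : C.Computes fun i => (v i : ℕ))
    (he : C.Computes fun i => (e i : ℕ)) : C.Decides fun i => (I i).model.Full (v i) (e i) :=
  .forall_lt (.iff ((hI.weaken _).decides_mem (hv.weaken _) (he.weaken _) (computes_index _))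
    ((hI.decides_branch hv).weaken _)) (hI.isBound_len_add_two v he)

theorem computes_run (hI : C.Reads I) (hv : C.Computes fun i => (v i : ℕ))
    (he : C.Computes fun i => (e i : ℕ)) (s : Bool) :
    C.Computes fun i => (I i).model.run (v i) (e i, s) := by
  have hlen := hI.isBound_len_add_two v he
  have hb : (C.bind fun i => (I i).model.len (e i)).IsBound fun p => (p.2 : ℕ) + 2 :=
    ⟨(computes_index _).add (computes_const 2), fun p =>
      (Nat.add_le_add_right p.2.isLt.le 2).trans (hlen.2 p.1)⟩
  refine .card_filter_range (.forall_lt (.iff ?_ ?_) hb) (hI.isBound_len v he)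
  · exact ((hI.weaken _).weaken _).decides_side ((hv.weaken _).weaken _) ((he.weaken _).weaken _) s
      (computes_index _)
  · exact ((hI.decides_branch hv).weaken _).weaken _

theorem decides_type_eq (hI : C.Reads I) (hu : C.Computes fun i => (u i : ℕ))
    (hv : C.Computes fun i => (v i : ℕ)) :
    C.Decides fun i => (I i).model.type (u i) = (I i).model.type (v i) := by
  have hsides : C.Decides fun i => ∀ h, (I i).model.Side (u i) h 0 ↔ (I i).model.Side (v i) h 0 :=
    .forall_prod_bool (fun s => .iff
      ((hI.weaken _).decides_side (hu.weaken _) (computes_index _) s (computes_const 0))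
      ((hI.weaken _).decides_side (hv.weaken _) (computes_index _) s (computes_const 0)))
      hI.isBound_m
  have hfull : C.Decides fun i => ∀ e, (I i).model.Full (u i) e ↔ (I i).model.Full (v i) e :=
    .forall_fin (.iff ((hI.weaken _).decides_full (hu.weaken _) (computes_index _))
      ((hI.weaken _).decides_full (hv.weaken _) (computes_index _))) hI.isBound_m
  exact (hsides.and hfull).congr fun i => by simp [PathModel.type, Set.ext_iff]

theorem decides_run_ne (hI : C.Reads I) (hu : C.Computes fun i => (u i : ℕ))
    (hv : C.Computes fun i => (v i : ℕ)) (he : C.Computes fun i => (e i : ℕ)) (s : Bool) :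
    C.Decides fun i => (I i).model.run (u i) (e i, s) ≠ (I i).model.run (v i) (e i, s) :=
  .not (.eq (hI.computes_run hu he s) (hI.computes_run hv he s))

theorem decides_differs (hI : C.Reads I) (hv : C.Computes fun i => (v i : ℕ))
    (he : C.Computes fun i => (e i : ℕ)) : C.Decides fun i => (I i).model.Differs (v i) (e i) := by
  have hI' := hI.weaken fun i => (I i).n
  have hr := computes_index (C := C) fun i => (I i).n
  have hfirst : (C.bind fun i => (I i).n).Decides fun p => IsFirst (I p.1).model.type p.2 :=
    .isFirst hr ((hI'.weaken _).decides_type_eq (computes_index _) (hr.weaken _)) hI'.isBound_n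
  have hruns := (hI'.decides_run_ne hr (hv.weaken _) (he.weaken _) false).or
    (hI'.decides_run_ne hr (hv.weaken _) (he.weaken _) true)
  refine .and (hI.decides_branch hv) (.exists_fin ?_ hI.isBound_n)
  refine ((hfirst.and (hI'.decides_type_eq hr (hv.weaken _))).and hruns).congr fun p => ?_
  simp only [ne_comm (a := (I p.1).model.run p.2 _), Bool.exists_bool, exists_and_left]

theorem decides_classOf_eq (hI : C.Reads I) (hu : C.Computes fun i => (u i : ℕ))
    (hv : C.Computes fun i => (v i : ℕ)) :
    C.Decides fun i => (I i).model.classOf (u i) = (I i).model.classOf (v i) := by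
  have hdiffers : C.Decides fun i =>
      ∀ e, (I i).model.Differs (u i) e ↔ (I i).model.Differs (v i) e :=
    .forall_fin (.iff ((hI.weaken _).decides_differs (hu.weaken _) (computes_index _))
      ((hI.weaken _).decides_differs (hv.weaken _) (computes_index _))) hI.isBound_m
  exact ((hI.decides_type_eq hu hv).and hdiffers).congr fun i => by
    simp [PathModel.classOf, Set.ext_iff]

theorem decides_varies (hI : C.Reads I) (hv : C.Computes fun i => (v i : ℕ))
    (he : C.Computes fun i => (e i : ℕ)) (s : Bool) :
    C.Decides fun i => (I i).model.Varies (v i) (e i, s) :=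
  .exists_fin (.and ((hI.weaken _).decides_classOf_eq (computes_index _) (hv.weaken _))
    ((hI.weaken _).decides_run_ne (computes_index _) (hv.weaken _) (he.weaken _) s)) hI.isBound_n

theorem decides_leading (hI : C.Reads I) (hv : C.Computes fun i => (v i : ℕ))
    (he : C.Computes fun i => (e i : ℕ)) (s : Bool) :
    C.Decides fun i => (I i).model.Leading (v i) (e i, s) := by
  have hle : ∀ s', (C.bind fun i => (I i).m).Decides fun p =>
      toLex (e p.1, s) ≤ toLex (p.2, s') := fun s' =>
    ((Decides.lt (he.weaken _) (computes_index _)).or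
      ((Decides.eq (he.weaken _) (computes_index _)).and (.const (s ≤ s')))).congr fun p => by
        rw [Prod.Lex.toLex_le_toLex, Fin.lt_def, Fin.ext_iff]
  exact .and (hI.decides_varies hv he s) (.forall_prod_bool (fun s' =>
    .imp ((hI.weaken _).decides_varies (hv.weaken _) (computes_index _) s') (hle s')) hI.isBound_m)

theorem decides_degenerate (hI : C.Reads I) (hv : C.Computes fun i => (v i : ℕ)) :
    C.Decides fun i => (I i).model.Degenerate (v i) :=
  .and (.not (hI.decides_branch hv))
    (.forall_fin ((hI.weaken _).decides_full (hv.weaken _) (computes_index _)) hI.isBound_m)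

theorem computes_tag (hI : C.Reads I) (hv : C.Computes fun i => (v i : ℕ)) :
    C.Computes fun i => (I i).model.tag (v i) := by
  classical
  have htag : ∀ i, (I i).model.tag (v i) =
      ∑ x, if Sum.inl x ∈ (I i).S.rep (v i) then (x : ℕ) + 1 else 0 := fun i => by
    rw [← Finset.sum_filter, ← finsum_mem_coe_finset]
    simp [model, HRepresentation.model]
  simp only [htag]
  exact .sum (.ite ((hI.weaken _).decides_inl_mem_rep (hv.weaken _) (computes_index _))
    ((computes_index _).add (computes_const 1)) (computes_const 0)) (hI.isBound_p v)

theorem computes_key (hI : C.Reads I) (hv : C.Computes fun i => (v i : ℕ)) :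
    C.Computes fun i => (I i).model.key (v i) := by
  refine .ite (hI.decides_degenerate hv) (hI.computes_tag hv)
    (.sum_prod_bool (fun s => ?_) hI.isBound_m)
  have hrun := (hI.weaken _).computes_run (hv.weaken _) (computes_index fun i => (I i).m) s
  exact .ite ((hI.weaken _).decides_leading (hv.weaken _) (computes_index _) s) hrun
    (((hI.weaken _).computes_len (computes_index _)).sub hrun)

theorem decides_meets (hI : C.Reads I) (hu : C.Computes fun i => (u i : ℕ))
    (hv : C.Computes fun i => (v i : ℕ)) :
    C.Decides fun i => (I i).model.Meets (u i) (v i) := by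
  have hI' := hI.weaken fun i => (I i).m
  have he := computes_index (C := C) fun i => (I i).m
  exact .exists_fin (.exists_lt (.and
    ((hI'.weaken _).decides_mem ((hu.weaken _).weaken _) (he.weaken _) (computes_index _))
    ((hI'.weaken _).decides_mem ((hv.weaken _).weaken _) (he.weaken _) (computes_index _)))
    (hI'.isBound_len_add_two (fun p => v p.1) he)) hI.isBound_m

theorem decides_adj (hI : C.Reads I) (hu : C.Computes fun i => (u i : ℕ))
    (hv : C.Computes fun i => (v i : ℕ)) : C.Decides fun i => (I i).G.Adj (u i) (v i) := by
  have htags := ((Decides.eq (hI.computes_tag hu) (hI.computes_tag hv)).and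
    (Decides.eq (hI.computes_tag hu) (computes_const 0)).not)
  refine ((Decides.eq hu hv).not.and ((hI.decides_meets hu hv).or ((hI.decides_degenerate hu).and
    ((hI.decides_degenerate hv).and htags)))).congr fun i => ?_
  rw [Fin.val_inj]
  exact ⟨fun h => ((I i).represents.adj_iff _ _ h.1).2 h.2,
    fun h => ⟨h.ne, ((I i).represents.adj_iff _ _ h.ne).1 h⟩⟩

end RAM.Context.Reads

/-- The arrangement of the vertices of `G` that the algorithm computes. -/
noncomputable def Instance.arrangement (I : Instance) :
    Arrangement (Fin I.n) (Fin (thinnessBound (Fintype.card (Fin I.m)))) (ℕ ×ₗ Fin I.n) :=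
  I.represents.arrangement

namespace RAM.Context.Reads

open Instance

variable {ι : Type*} {C : Context ι} {I : ι → Instance} {P : ι → Prop}
  {a b u v u' v' : ∀ i, Fin (I i).n}

theorem computes_cls (hI : C.Reads I) (hv : C.Computes fun i => (v i : ℕ)) :
    C.Computes fun i => ((I i).arrangement.cls (v i) : ℕ) := by
  have hI' := hI.weaken fun i => (I i).n
  have hr := computes_index (C := C) fun i => (I i).n
  have hfirst : (C.bind fun i => (I i).n).Decides fun p => IsFirst (I p.1).model.classOf p.2 :=
    .isFirst hr ((hI'.weaken _).decides_classOf_eq (computes_index _) (hr.weaken _)) hI'.isBound_n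
  refine .card_filter (.and hfirst (.forall_fin ?_ hI'.isBound_n)) hI.isBound_n
  exact .imp (.le (computes_index _) (hr.weaken _))
    ((hI'.weaken _).decides_classOf_eq (computes_index _) ((hv.weaken _).weaken _)).not

theorem decides_cls_eq (hI : C.Reads I) (hu : C.Computes fun i => (u i : ℕ))
    (hv : C.Computes fun i => (v i : ℕ)) :
    C.Decides fun i => (I i).arrangement.cls (u i) = (I i).arrangement.cls (v i) :=
  (hI.decides_classOf_eq hu hv).congr fun i => (I i).represents.cls_eq_iff.symm

theorem decides_pos_lt (hI : C.Reads I) (hu : C.Computes fun i => (u i : ℕ))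
    (hv : C.Computes fun i => (v i : ℕ)) :
    C.Decides fun i => (I i).arrangement.pos (u i) < (I i).arrangement.pos (v i) := by
  have hku := hI.computes_key hu
  have hkv := hI.computes_key hv
  exact ((Decides.lt hku hkv).or ((Decides.eq hku hkv).and (.lt hu hv))).congr fun i =>
    (Prod.Lex.toLex_lt_toLex (x := ((I i).model.key (u i), u i))
      (y := ((I i).model.key (v i), v i))).symm

theorem decides_pos_le (hI : C.Reads I) (hu : C.Computes fun i => (u i : ℕ))
    (hv : C.Computes fun i => (v i : ℕ)) :
    C.Decides fun i => (I i).arrangement.pos (u i) ≤ (I i).arrangement.pos (v i) :=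
  (hI.decides_pos_lt hv hu).not.congr fun _ => not_lt

theorem decides_orientedLE (hI : C.Reads I) (hP : C.Decides P)
    (hu : C.Computes fun i => (u i : ℕ)) (hv : C.Computes fun i => (v i : ℕ)) :
    C.Decides fun i =>
      OrientedLE (P i) ((I i).arrangement.pos (u i)) ((I i).arrangement.pos (v i)) :=
  .and (.imp hP (hI.decides_pos_le hv hu)) (.imp hP.not (hI.decides_pos_le hu hv))

theorem decides_inside (hI : C.Reads I) (hP : C.Decides P) (hu : C.Computes fun i => (u i : ℕ))
    (hv : C.Computes fun i => (v i : ℕ)) (hu' : C.Computes fun i => (u' i : ℕ))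
    (hv' : C.Computes fun i => (v' i : ℕ)) :
    C.Decides fun i => (I i).arrangement.Inside (P i) (u i) (v i) (u' i) (v' i) :=
  .and (.and (hI.decides_cls_eq hu' hu) (hI.decides_pos_le hu hu'))
    (.and (hI.decides_cls_eq hv' hv) (hI.decides_orientedLE hP hv' hv))

theorem decides_exists_not_adj {Q : ∀ i, Fin (I i).n → Fin (I i).n → Prop} (hI : C.Reads I)
    (hQ : ((C.bind fun i => (I i).n).bind fun p => (I p.1).n).Decides fun p => Q p.1.1 p.1.2 p.2) :
    C.Decides fun i => ∃ u v, Q i u v ∧ ¬ (I i).G.Adj u v :=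
  .exists_fin (.exists_fin (.and hQ (((hI.weaken _).weaken _).decides_adj
    ((computes_index _).weaken _) (computes_index _)).not) (hI.weaken _).isBound_n) hI.isBound_n

theorem decides_cut (hI : C.Reads I) (hP : C.Decides P) (hu : C.Computes fun i => (u i : ℕ))
    (hv : C.Computes fun i => (v i : ℕ)) :
    C.Decides fun i => (I i).arrangement.Cut (I i).G (P i) (u i) (v i) :=
  hI.decides_exists_not_adj (((hI.weaken _).weaken _).decides_inside ((hP.weaken _).weaken _)
    ((hu.weaken _).weaken _) ((hv.weaken _).weaken _) ((computes_index _).weaken _)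
    (computes_index _))

theorem decides_compatible (hI : C.Reads I) (hP : C.Decides P)
    (ha : C.Computes fun i => (a i : ℕ)) (hb : C.Computes fun i => (b i : ℕ)) :
    C.Decides fun i => (I i).arrangement.Compatible (I i).G (P i)
      ((I i).arrangement.cls (a i)) ((I i).arrangement.cls (b i)) := by
  refine .forall_fin (.forall_fin ?_ (hI.weaken _).isBound_n) hI.isBound_n
  have hI' := (hI.weaken fun i => (I i).n).weaken fun p => (I p.1).n
  have hP' := (hP.weaken fun i => (I i).n).weaken fun p => (I p.1).n
  have hu := (computes_index (C := C) fun i => (I i).n).weaken fun p => (I p.1).n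
  have hv := computes_index (C := C.bind fun i => (I i).n) fun p => (I p.1).n
  refine .imp (hI'.decides_cls_eq hu ((ha.weaken _).weaken _))
    (.imp (hI'.decides_cls_eq hv ((hb.weaken _).weaken _))
      (.imp (hI'.decides_cut hP' hu hv) (.imp ?_ (hI'.decides_adj hu hv).not)))
  exact hI'.decides_exists_not_adj (((hI'.weaken _).weaken _).decides_inside
    ((hP'.weaken _).weaken _) ((computes_index _).weaken _) (computes_index _)
    ((hu.weaken _).weaken _) ((hv.weaken _).weaken _))

theorem decides_reversed (hI : C.Reads I) (ha : C.Computes fun i => (a i : ℕ))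
    (hb : C.Computes fun i => (b i : ℕ)) :
    C.Decides fun i => (I i).arrangement.Reversed (I i).G
      ((I i).arrangement.cls (a i)) ((I i).arrangement.cls (b i)) :=
  (hI.decides_compatible (.const False) ha hb).not

theorem computes_position (hI : C.Reads I) (ha : C.Computes fun i => (a i : ℕ))
    (hb : C.Computes fun i => (b i : ℕ)) (hv : C.Computes fun i => (v i : ℕ)) :
    C.Computes fun i => (I i).arrangement.position (I i).G
      ((I i).arrangement.cls (a i)) ((I i).arrangement.cls (b i)) (v i) := by
  have hI' := hI.weaken fun i => (I i).n
  have hx := computes_index (C := C) fun i => (I i).n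
  have hrev := (hI.decides_reversed ha hb).weaken fun i => (I i).n
  have hxa := hI'.decides_cls_eq hx (ha.weaken _)
  have hxb := hI'.decides_cls_eq hx (hb.weaken _)
  have hne := ((hI.decides_cls_eq ha hb).weaken fun i => (I i).n).not
  refine .ite (hI.decides_cls_eq hv ha)
    (.add (.card_filter (.and hxa (hI'.decides_pos_lt hx (hv.weaken _))) hI.isBound_n)
      (.card_filter (.and hxb (.and hne (hI'.decides_cut hrev (hv.weaken _) hx).not))
        hI.isBound_n))
    (.add (.card_filter (.and hxa (hI'.decides_cut hrev hx (hv.weaken _))) hI.isBound_n)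
      (.card_filter (.and hxb (.and ?_ (hI'.decides_orientedLE hrev hx (hv.weaken _))))
        hI.isBound_n))
  exact (Decides.eq hx (hv.weaken _)).not.congr fun p => by rw [Fin.val_inj]

end RAM.Context.Reads

/-! ### Writing the output -/

section SortedBy

variable {n : ℕ} {P : Fin n → Prop} {f : Fin n → ℕ}

open Classical in
variable (P f) in
/-- The list of all `v` with the property `P`, sorted by `f`, whose values at these `v` have to be
distinct and less than `n`. -/
noncomputable def sortedBy : List (Fin n) :=
  (List.finRange n).flatMap fun r : Fin n =>
    (List.finRange n).filter fun v => P v ∧ f v = r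

theorem mem_sortedBy_iff (hf : ∀ v, P v → f v < n) {v : Fin n} : v ∈ sortedBy P f ↔ P v := by
  simp only [sortedBy, List.mem_flatMap, List.mem_filter, List.mem_finRange, true_and,
    decide_eq_true_eq]
  exact ⟨fun ⟨_, hv, _⟩ => hv, fun hv => ⟨⟨f v, hf v hv⟩, hv, rfl⟩⟩

theorem pairwise_sortedBy (hf : Set.InjOn f {v | P v}) :
    (sortedBy P f).Pairwise fun u v => f u < f v := by
  classical
  refine List.pairwise_flatMap.2 ⟨fun r _ => ?_, ?_⟩
  · refine (List.nodup_finRange n).filter _ |>.imp_of_mem fun {u v} hu hv hne => ?_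
    simp only [List.mem_filter, decide_eq_true_eq] at hu hv
    exact absurd (hf hu.2.1 hv.2.1 (hu.2.2.trans hv.2.2.symm)) hne
  · refine (List.pairwise_lt_finRange n).imp fun {r s} hrs u hu v hv => ?_
    simp only [List.mem_filter, decide_eq_true_eq] at hu hv
    exact hu.2.2 ▸ hv.2.2 ▸ hrs

end SortedBy

namespace Arrangement

section

variable {V ι L : Type*} [Fintype V] [LinearOrder L] {A : Arrangement V ι L} {G : SimpleGraph V}
  {i j : ι} {x : V}

theorem position_lt_card (hx : A.cls x = i ∨ A.cls x = j) :
    A.position G i j x < Fintype.card V := by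
  classical
  unfold position
  split_ifs with hi
  · rw [← Finset.card_union_of_disjoint]
    · exact Finset.card_lt_univ_of_notMem (x := x) (by simp; grind)
    · simp only [Finset.disjoint_left, Finset.mem_filter]; grind
  · rw [← Finset.card_union_of_disjoint]
    · refine Finset.card_lt_univ_of_notMem (x := x) (by simp [hi])
    · simp only [Finset.disjoint_left, Finset.mem_filter]; grind

end

variable {n k : ℕ} {L : Type*} {A : Arrangement (Fin n) (Fin k) L}

open Classical in
variable (A) in
/-- The pairs `i ≤ j` of nonempty classes, obtained from the first elements of the classes. -/
noncomputable def pairs : List (Fin k × Fin k) :=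
  ((List.finRange n ×ˢ List.finRange n).filter fun p =>
    (IsFirst A.cls p.1 ∧ IsFirst A.cls p.2) ∧ A.cls p.1 ≤ A.cls p.2).map (Prod.map A.cls A.cls)

open Classical in
theorem flatMap_pairs (g : Fin k × Fin k → List ℕ) :
    A.pairs.flatMap g = (List.finRange n).flatMap fun a => (List.finRange n).flatMap fun b =>
      if (IsFirst A.cls a ∧ IsFirst A.cls b) ∧ A.cls a ≤ A.cls b then g (A.cls a, A.cls b)
      else [] := by
  have hfilter (P : Fin n × Fin n → Prop) [DecidablePred P] (l : List (Fin n × Fin n)) :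
      (l.filter fun p => P p).flatMap (fun p => g (A.cls p.1, A.cls p.2)) =
        l.flatMap fun p => if P p then g (A.cls p.1, A.cls p.2) else [] := by
    induction l with
    | nil => rfl
    | cons p l ih => by_cases h : P p <;> simp [h, ih]
  rw [pairs, List.flatMap_map]
  refine (hfilter _ _).trans ?_
  simp only [SProd.sprod, List.product, List.flatMap_assoc, List.flatMap_map]

theorem mem_pairs_iff {i j : Fin k} :
    (i, j) ∈ A.pairs ↔ i ≤ j ∧ (∃ v, A.cls v = i) ∧ ∃ v, A.cls v = j := by
  simp only [pairs, List.mem_map, List.mem_filter, List.mem_product, List.mem_finRange, true_and,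
    decide_eq_true_eq, Prod.exists, Prod.map_apply, Prod.mk.injEq]
  constructor
  · rintro ⟨a, b, ⟨-, hab⟩, rfl, rfl⟩
    exact ⟨hab, ⟨a, rfl⟩, b, rfl⟩
  · rintro ⟨hij, ⟨u, rfl⟩, v, rfl⟩
    obtain ⟨a, ha, hau⟩ := exists_isFirst (f := A.cls) u
    obtain ⟨b, hb, hbv⟩ := exists_isFirst (f := A.cls) v
    exact ⟨a, b, ⟨⟨ha, hb⟩, by rwa [hau, hbv]⟩, hau, hbv⟩

theorem nodup_pairs : A.pairs.Nodup := by
  classical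
  refine .map_on (fun p hp q hq hpq => ?_)
    (((List.nodup_finRange n).product (List.nodup_finRange n)).filter _)
  simp only [List.mem_filter, decide_eq_true_eq, Prod.map, Prod.mk.injEq] at hp hq hpq
  exact Prod.ext (hp.2.1.1.eq_of_apply_eq hq.2.1.1 hpq.1) (hp.2.1.2.eq_of_apply_eq hq.2.1.2 hpq.2)

variable [LinearOrder L] (A) (G : SimpleGraph (Fin n))

/-- The merged order of the classes `i` and `j`. -/
noncomputable def merged (i j : Fin k) : List (Fin n) :=
  sortedBy (fun v => A.cls v = i ∨ A.cls v = j) (A.position G i j)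

/-- The words that describe the choice of `E_{ij}` and the order `<_{ij}` for the nonempty classes
`i ≤ j`. -/
noncomputable def record (i j : Fin k) : List ℕ :=
  [(i : ℕ), (j : ℕ), if i = j then 1 else 0] ++ (A.merged G i j).map Fin.val

/-- The words that describe the representation obtained from the arrangement. -/
noncomputable def description : List ℕ :=
  (List.finRange n).map (fun v => (A.cls v : ℕ)) ++ A.pairs.flatMap fun q => A.record G q.1 q.2

variable {A G}

theorem mixedThinRep_isEncodedBy (hP : A.IsProper G)
    (hC : ∀ i j, i ≠ j → A.Compatible G False i j ∨ A.Compatible G True i j) :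
    (mixedThinRep hP hC).IsEncodedBy (A.description G) := by
  refine ⟨A.pairs, fun q => A.merged G q.1 q.2, nodup_pairs, fun _ _ => mem_pairs_iff,
    fun i j _ => ⟨fun v => mem_sortedBy_iff fun v hv => ?_,
      pairwise_sortedBy (position_injOn i j)⟩, ?_⟩
  · simpa using position_lt_card (G := G) hv
  · simp [description, record, mixedThinRep, List.map_eq_flatMap]

end Arrangement

namespace RAM.Context

variable {ι : Type*} {C : Context ι}

theorem Writes.sortedBy {n : ι → ℕ} {P : ∀ i, Fin (n i) → Prop} {f : ∀ i, Fin (n i) → ℕ}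
    (hPf : ((C.bind n).bind fun p => n p.1).Decides fun q => P q.1.1 q.2 ∧ f q.1.1 q.2 = q.1.2)
    (hn : C.IsBound n) : C.Writes fun i => (sortedBy (P i) (f i)).map Fin.val := by
  simp only [_root_.sortedBy, List.map_flatMap]
  exact .flatMap_finRange (.filter_finRange (P := fun p v => P p.1 v ∧ f p.1 v = p.2) hPf
    (hn.weaken _)) hn

namespace Reads

variable {I : ι → Instance} {a b : ∀ i, Fin (I i).n}

theorem writes_merged (hI : C.Reads I) (ha : C.Computes fun i => (a i : ℕ))
    (hb : C.Computes fun i => (b i : ℕ)) :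
    C.Writes fun i => ((I i).arrangement.merged (I i).G ((I i).arrangement.cls (a i))
      ((I i).arrangement.cls (b i))).map Fin.val := by
  have hI' := (hI.weaken fun i => (I i).n).weaken fun p => (I p.1).n
  have ha' := (ha.weaken fun i => (I i).n).weaken fun p => (I p.1).n
  have hb' := (hb.weaken fun i => (I i).n).weaken fun p => (I p.1).n
  have hv := computes_index (C := C.bind fun i => (I i).n) fun p => (I p.1).n
  refine .sortedBy (.and (.or (hI'.decides_cls_eq hv ha') (hI'.decides_cls_eq hv hb'))
    (.eq (hI'.computes_position ha' hb' hv) ((computes_index _).weaken _))) hI.isBound_n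

theorem decides_isFirst_cls (hI : C.Reads I) (ha : C.Computes fun i => (a i : ℕ)) :
    C.Decides fun i => IsFirst (I i).arrangement.cls (a i) :=
  .isFirst ha ((hI.weaken _).decides_cls_eq (computes_index _) (ha.weaken _)) hI.isBound_n

theorem writes_record (hI : C.Reads I) (ha : C.Computes fun i => (a i : ℕ))
    (hb : C.Computes fun i => (b i : ℕ)) :
    C.Writes fun i => (I i).arrangement.record (I i).G ((I i).arrangement.cls (a i))
      ((I i).arrangement.cls (b i)) :=
  .append (.append (hI.computes_cls ha).emit (.append (hI.computes_cls hb).emit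
    (hI.decides_cls_eq ha hb).indicator.emit)) (hI.writes_merged ha hb)

theorem writes_description (hI : C.Reads I) :
    C.Writes fun i => (I i).arrangement.description (I i).G := by
  simp only [Arrangement.description, Arrangement.flatMap_pairs, List.map_eq_flatMap]
  have hI' := (hI.weaken fun i => (I i).n).weaken fun p => (I p.1).n
  have ha := (computes_index (C := C) fun i => (I i).n).weaken fun p => (I p.1).n
  have hb := computes_index (C := C.bind fun i => (I i).n) fun p => (I p.1).n
  exact .append
    (.flatMap_finRange ((hI.weaken _).computes_cls (computes_index _)).emit hI.isBound_n)
    (.flatMap_finRange (.flatMap_finRange (.guard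
      (.and (.and (hI'.decides_isFirst_cls ha) (hI'.decides_isFirst_cls hb))
        (.le (hI'.computes_cls ha) (hI'.computes_cls hb)))
      (hI'.writes_record ha hb)) (hI.weaken _).isBound_n) hI.isBound_n)

end Reads

end RAM.Context

/-! ### The theorem -/

theorem properMixedThinness_le_thinnessBound {α β V : Type*} [Finite V] {H : Graph α β}
    {G : SimpleGraph V} (hH : 0 < H.size) (hG : IsNonCrossingHGraph H G) :
    properMixedThinness G ≤ (thinnessBound H.size : ℕ∞) :=
  iInf₂_le _ ⟨hH.trans_le (Nat.le_add_left _ _), exists_properMixedThinRep hH hG⟩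

theorem Instance.exists_isEncodedBy (I : Instance) :
    ∃ R : ProperMixedThinRep I.G (thinnessBound I.H.size),
      R.IsEncodedBy (I.arrangement.description I.G) := by
  rw [show I.H.size = Fintype.card (Fin I.m) by simp [Graph.size, I.edgeSet_eq]]
  exact ⟨_, Arrangement.mixedThinRep_isEncodedBy I.represents.isProper
    fun _ _ => I.represents.compatible⟩

theorem theorem4_general :
    (∀ (α : Type*) (β : Type*) (V : Type*) [Finite V] (H : Graph α β) (G : SimpleGraph V),
      0 < H.size → IsNonCrossingHGraph H G →
        properMixedThinness G ≤ (thinnessBound H.size : ℕ∞)) ∧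
    (∃ (prog : RAM.Prog) (time : Polynomial ℕ),
      ∀ (n p m : ℕ) (H : Graph (Fin p) (Fin m)) (G : SimpleGraph (Fin n))
        (S : HRepresentation H G),
        H.edgeSet = Set.univ → 0 < m → S.IsNonCrossing →
          ∃ (s : RAM.State) (T : ℕ), RAM.Exec S.encode prog RAM.State.init s T ∧
            T ≤ time.eval (RAM.bitSize S.encode) ∧
            ∃ R : ProperMixedThinRep G (thinnessBound H.size), R.IsEncodedBy s.out) := by
  refine ⟨fun _ _ _ _ _ _ => properMixedThinness_le_thinnessBound, ?_⟩
  let C : RAM.Context Instance := ⟨fun I => I.S.encode, 0, fun _ _ => 0⟩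
  have hC : C.Reads id := fun _ => rfl
  obtain ⟨prog, time, hprog⟩ := hC.writes_description.exists_prog rfl
  refine ⟨prog, time, fun n p m H G S hE hm hS => ?_⟩
  let I : Instance := ⟨n, p, m, H, G, S, hE, hm, hS⟩
  obtain ⟨s, T, hexec, hT, hout⟩ := hprog I
  exact ⟨s, T, hexec, hT, hout ▸ I.exists_isEncodedBy⟩

theorem theorem4 :
    (∀ (α : Type*) (β : Type*) (V : Type*) [Finite V] (H : Graph α β) (G : SimpleGraph V),
      H.vertexSet.Finite → H.edgeSet.Finite → 0 < H.size → IsNonCrossingHGraph H G →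
        properMixedThinness G ≤ (thinnessBound H.size : ℕ∞)) ∧
    (∃ (prog : RAM.Prog) (time : Polynomial ℕ),
      ∀ (n p m : ℕ) (H : Graph (Fin p) (Fin m)) (G : SimpleGraph (Fin n))
        (S : HRepresentation H G),
        H.vertexSet = Set.univ → H.edgeSet = Set.univ → 0 < m → S.IsNonCrossing →
          ∃ (s : RAM.State) (T : ℕ), RAM.Exec S.encode prog RAM.State.init s T ∧
            T ≤ time.eval (RAM.bitSize S.encode) ∧
            ∃ R : ProperMixedThinRep G (thinnessBound H.size), R.IsEncodedBy s.out) :=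
  have ⟨hbound, prog, time, hprog⟩ := theorem4_general
  ⟨fun α β V _ H G _ _ => hbound α β V H G, prog, time, fun n p m H G S _ => hprog n p m H G S⟩
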